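/- Let $\mathbb{K}$ be $\mathbb{R}$ or $\mathbb{C}$ and let $\mathfrak{t}$ be a finite-dimensional commutative Lie algebra over $\mathbb{K}$ with basis $(\xi_i)_i$ and dual basis $(\xi_i^*)_i$ of $\mathfrak{t}^*$. *Semi-infinite Weil algebra.* Let $\mathcal{W}=\mathcal{W}(\mathfrak{t})=\mathcal{E}(\mathfrak{t})\otimes\mathcal{S}(\mathfrak{t})$ be the tensor product of the $bc$-system and the $\beta\gamma$-system of $\mathfrak{t}$, with vacuum $\mathbf{1}$, odd fields $b^{\xi}(z),c^{\xi^*}(z)$ and even fields $\beta^{\xi}(z),\gamma^{\xi^*}(z)$ whose only non-zero (super)commutators are $[b^{\xi}_{(m)},c^{\xi^*}_{(n)}]=[\beta^{\xi}_{(m)},\gamma^{\xi^*}_{(n)}]=\langle\xi^*,\xi\rangle\delta_{m+n,-1}$. The degrees of $b,c,\beta,\gamma$ are $-1,1,-2,2$, their weights $1,0,1,0$. The differential is $d_{\mathcal{W}}=D_{(0)}$ with $D=\sum_i\gamma^{\xi_i^*}_{(-1)}b^{\xi_i}_{(-1)}\mathbf{1}$. Let $\langle\gamma\rangle\subset\mathcal{W}'=\langle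 c,\gamma\rangle\subset\mathcal{W}$ be the vertex subalgebras generated by the $\gamma^{\xi^*}$, respectively by the $c^{\xi^*}$ and $\gamma^{\xi^*}$. The operator $\iota_{\xi,(n)}$ acts on $\mathcal{W}$ by $b^{\xi}_{(n)}$ for $n\ge0$. *Chiral $W^*$-modules.* A differential $\mathfrak{st}[t]$-module is a super vector space $\mathcal{A}$ with compatible $\mathbb{Z}$-gradings by degree and by weight, an odd differential $d_{\mathcal{A}}$ of degree $1$ and weight $0$, and operators $L_{\xi,(n)}$ (even, degree $0$, weight $-n$) and $\iota_{\xi,(n)}$ (odd, degree $-1$, weight $-n$), linear in $\xi\in\mathfrak{t}$, $n\ge0$, which all supercommute with each other and satisfy $[d_{\mathcal{A}},\iota_{\xi,(n)}]=L_{\xi,(n)}$, $[d_{\mathcal{A}},L_{\xi,(n)}]=0$, such that each vector is killed by all $L_{\xi,(n)},\iota_{\xi,(n)}$ with $n$ sufficiently large. A chiral $W^*$-module is such an $\mathcal{A}$ with a module structure $Y^{\mathcal{A}}$ over the vertex superalgebra $\langle c,\gamma\rangle$, compatible with parity, degree and weight, such that, writing $c^{\xi^*,\mathcal{A}}_{(n)}$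 for the modes of $Y^{\mathcal{A}}(c^{\xi^*}_{(-1)}\mathbf{1},z)$, one has $[d_{\mathcal{A}},Y^{\mathcal{A}}(x,z)]=Y^{\mathcal{A}}(d_{\mathcal{W}}x,z)$ for $x\in\langle c,\gamma\rangle$, $[L_{\xi,(m)},c^{\xi^*,\mathcal{A}}_{(n)}]=0$ and $[\iota_{\xi,(m)},c^{\xi^*,\mathcal{A}}_{(n)}]=\langle\xi^*,\xi\rangle\delta_{m+n,-1}$ for all $m\ge0$, $n\in\mathbb{Z}$. Put $$\mathcal{A}_{inv}=\bigcap_{\xi,\,n\ge0}\ker L_{\xi,(n)},\qquad \mathcal{A}_{bas}=\mathcal{A}_{inv}\cap\bigcap_{\xi,\,n\ge0}\ker\iota_{\xi,(n)}.$$ *Small chiral Cartan model.* Let $$\Phi_{\mathcal{W},\mathcal{A}}=\exp\Bigl(\sum_i\sum_{n\ge0}c^{\xi_i^*}_{(-n-1)}\otimes\iota_{\xi_i,(n)}\Bigr)\ \text{on}\ \mathcal{W}\otimes\mathcal{A},\qquad \Phi_{\mathcal{A},\mathcal{W}}=\exp\Bigl(\sum_i\sum_{n\ge0}c^{\xi_i^*,\mathcal{A}}_{(-n-1)}\otimes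 b^{\xi_i}_{(n)}\Bigr)\ \text{on}\ \mathcal{A}\otimes\mathcal{W},$$ with the Koszul sign rule, and let $\tau:\mathcal{W}\otimes\mathcal{A}\to\mathcal{A}\otimes\mathcal{W}$ be the (super) switching map. Put $$C'(\mathcal{A};\mathcal{W})=(\Phi_{\mathcal{A},\mathcal{W}}\circ\tau\circ\Phi_{\mathcal{W},\mathcal{A}}^{-1})\bigl(\langle\gamma\rangle\otimes\mathcal{A}_{inv}\bigr),\qquad d'=\Phi_{\mathcal{A},\mathcal{W}}\circ(d_{\mathcal{A}}\otimes1+1\otimes d_{\mathcal{W}})\circ\Phi_{\mathcal{A},\mathcal{W}}^{-1}\big|_{C'(\mathcal{A};\mathcal{W})}.$$ **Proposition.** Let $\mathcal{A}$ be a chiral $W^*$-module with respect to $\mathfrak{t}$. Then $(\mathcal{A}_{bas},d_{\mathcal{A}})$ and $(C'(\mathcal{A};\mathcal{W}),d')$ are cochain complexes (graded by degree), $C'(\mathcal{A};\mathcal{W})=\mathcal{A}_{bas}\otimes\langle c,\gamma\rangle$ as subspaces of $\mathcal{A}\otimes\mathcal{W}$, and the map $$(\mathcal{A}_{bas},d_{\mathcal{A}})\to(C'(\mathcal{A};\mathcal{W}),d'),\qquad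 a\mapsto a\otimes\mathbf{1},$$ is a quasi-isomorphism: it is a morphism of complexes and induces an isomorphism on cohomology in every degree. -/

import Mathlib

open scoped TensorProduct

noncomputable section

namespace ChiralWeil

/-! ## Signs, locally finite sums, exponentials -/

/-- The sign `(-1)^s` of a parity `s`. -/
def sgn (s : ZMod 2) : ℤ := if s = 1 then -1 else 1

/-- The Koszul sign `(-1)^(s t)` of two parities. -/
def koszul (s t : ZMod 2) : ℤ := if s = 1 ∧ t = 1 then -1 else 1

section Linear

variable {K V : Type*} [Field K] [AddCommGroup V] [Module K V]

open Classical in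
/-- The sum of a family of operators which is locally finite, i.e. such that for every vector `v`
all but finitely many members of the family kill `v`. (By convention it is `0` when the family is
not locally finite.) -/
def locSum {J : Type*} (f : J → Module.End K V) : Module.End K V :=
  if h : ∀ v, (Function.support fun j => f j v).Finite then
    { toFun := fun v => ∑ᶠ j, f j v
      map_add' := fun v w => by
        simp only [map_add]
        exact finsum_add_distrib (h v) (h w)
      map_smul' := fun a v => by
        simp only [map_smul, RingHom.id_apply]
        exact (smul_finsum' a (h v)).symm }
  else 0

/-- The exponential `∑ fᵏ / k!` of a locally nilpotent operator. -/
def locExp (f : Module.End K V) : Module.End K V :=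
  locSum fun k : ℕ => (k.factorial : K)⁻¹ • f ^ k

end Linear

/-! ## Formal distributions and their `n`-th products -/

/-- An `End V`-valued formal distribution `∑ A₍ₙ₎ z^(-n-1)`, given by its modes `A₍ₙ₎`. -/
abbrev Modes (K V : Type*) [Field K] [AddCommGroup V] [Module K V] : Type _ :=
  ℤ → Module.End K V

section Fields

variable {K V : Type*} [Field K] [AddCommGroup V] [Module K V]

/-- The identity field `id_V`, which is the vertex operator of the vacuum vector. -/
def idField : Modes K V := fun n => if n = -1 then 1 else 0

/-- The derivative `∂A(z)` of a formal distribution. -/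
def derivField (A : Modes K V) : Modes K V := fun n => (-n) • A (n - 1)

/-- The `n`-th product of two fields `A(z)`, `B(z)` of parities `s`, `t`:
`(A₍ₙ₎B)(w) = Res_z (A(z)B(w) i_{|z|>|w|}(z-w)ⁿ - (-1)^(st) B(w)A(z) i_{|w|>|z|}(z-w)ⁿ)`. -/
def nthProd (s t : ZMod 2) (n : ℤ) (A B : Modes K V) : Modes K V := fun m =>
  locSum fun j : ℕ =>
    ((-1 : ℤ) ^ j * Ring.choose n j) •
      (A (n - j) * B (m + j) -
        (koszul s t * ((n.negOnePow : ℤˣ) : ℤ)) • (B (m + n - j) * A j))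

/-- `Generated S s A`: the field `A` is an element of parity `s` of the vertex superalgebra of
fields generated by the fields in `S 0` (even ones) and `S 1` (odd ones), i.e. of the smallest
space of fields containing the generators and the identity field and closed under all `n`-th
products. -/
inductive Generated (S : ZMod 2 → Set (Modes K V)) : ZMod 2 → Modes K V → Prop
  | vac : Generated S 0 idField
  | gen {s : ZMod 2} {A : Modes K V} (h : A ∈ S s) : Generated S s A
  | add {s : ZMod 2} {A B : Modes K V} (hA : Generated S s A) (hB : Generated S s B) :
      Generated S s (A + B)
  | zero {s : ZMod 2} : Generated S s 0
  | smul {s : ZMod 2} (a : K) {A : Modes K V} (hA : Generated S s A) : Generated S s (a • A)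
  | prod {s t : ZMod 2} (n : ℤ) {A B : Modes K V} (hA : Generated S s A)
      (hB : Generated S t B) : Generated S (s + t) (nthProd s t n A B)

/-- The parity `s` part of the vertex superalgebra of fields generated by `S`. -/
def vsa (S : ZMod 2 → Set (Modes K V)) (s : ZMod 2) : Submodule K (Modes K V) where
  carrier := {A | Generated S s A}
  add_mem' := Generated.add
  zero_mem' := Generated.zero
  smul_mem' := fun a _ h => Generated.smul a h

/-- The vacuum of the vertex superalgebra generated by `S`. -/
def vsa.one (S : ZMod 2 → Set (Modes K V)) : vsa S 0 := ⟨idField, Generated.vac⟩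

/-- The `n`-th product of the vertex superalgebra generated by `S`. -/
def vsa.prod {S : ZMod 2 → Set (Modes K V)} {s t : ZMod 2} (n : ℤ) (x : vsa S s) (y : vsa S t) :
    vsa S (s + t) :=
  ⟨nthProd s t n x.1 y.1, Generated.prod n x.2 y.2⟩

/-- The state-field correspondence read backwards: `A(z) ↦ A(z)v|_{z=0} = A₍₋₁₎ v`, where `v` is the
vacuum vector. -/
def state (v : V) : Modes K V →ₗ[K] V where
  toFun := fun A => A (-1) v
  map_add' := fun _ _ => rfl
  map_smul' := fun _ _ => rfl

/-- The subspace of `V` of all states of the vertex superalgebra of fields generated by `S`. -/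
def states (v : V) (S : ZMod 2 → Set (Modes K V)) : Submodule K V :=
  ⨆ s, (vsa S s).map (state v)

end Fields

/-! ## The semi-infinite Weil algebra

`(ξᵢ)` is a basis of the Lie algebra, indexed by `ι`. The spaces below are the Fock modules of the
`bc`- and `βγ`-systems: the free supercommutative algebras on the creation modes
`b^{ξᵢ}₍₋ₖ₋₁₎, c^{ξᵢ*}₍₋ₖ₋₁₎` (odd) and `β^{ξᵢ}₍₋ₖ₋₁₎, γ^{ξᵢ*}₍₋ₖ₋₁₎` (even), `k ≥ 0`. -/

section Fock

variable (K ι : Type*) [Field K]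

/-- Labels of the creation modes: `Sum.inl (i, k)` for `b^{ξᵢ}₍₋ₖ₋₁₎` or `β^{ξᵢ}₍₋ₖ₋₁₎`,
`Sum.inr (i, k)` for `c^{ξᵢ*}₍₋ₖ₋₁₎` or `γ^{ξᵢ*}₍₋ₖ₋₁₎`. -/
abbrev Label : Type _ := (ι × ℕ) ⊕ (ι × ℕ)

/-- The `bc`-system. -/
abbrev BC : Type _ := ExteriorAlgebra K (Label ι →₀ K)

/-- The `βγ`-system. -/
abbrev BetaGamma : Type _ := MvPolynomial (Label ι) K

/-- The semi-infinite Weil algebra. -/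
def Weil : Type _ := BC K ι ⊗[K] BetaGamma K ι

instance : AddCommGroup (Weil K ι) := inferInstanceAs (AddCommGroup (BC K ι ⊗[K] BetaGamma K ι))

instance : Module K (Weil K ι) := inferInstanceAs (Module K (BC K ι ⊗[K] BetaGamma K ι))

/-- The vacuum vector. -/
def vac : Weil K ι := (1 ⊗ₜ 1 : BC K ι ⊗[K] BetaGamma K ι)

variable {K ι} in
/-- The operator `f ⊗ g` on the semi-infinite Weil algebra. -/
def Weil.map (f : Module.End K (BC K ι)) (g : Module.End K (BetaGamma K ι)) :
    Module.End K (Weil K ι) :=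
  (TensorProduct.map f g : Module.End K (BC K ι ⊗[K] BetaGamma K ι))

/-- The parity operator of the semi-infinite Weil algebra: `1` on even vectors, `-1` on odd
ones. -/
def weilParity : Module.End K (Weil K ι) :=
  Weil.map
    (CliffordAlgebra.involute (Q := (0 : QuadraticForm K (Label ι →₀ K)))).toLinearMap LinearMap.id

variable {ι}

/-- Multiplication by the odd creation mode with label `x`. -/
def oddCreate (x : Label ι) : Module.End K (BC K ι) :=
  LinearMap.mulLeft K (ExteriorAlgebra.ι K (Finsupp.single x 1))

/-- The odd derivation sending the odd creation mode with label `x` to `1` and the others to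
`0`. -/
def oddAnnihilate (x : Label ι) : Module.End K (BC K ι) :=
  CliffordAlgebra.contractLeft (Q := (0 : QuadraticForm K (Label ι →₀ K))) (Finsupp.lapply x)

/-- Multiplication by the even creation mode with label `x`. -/
def evenCreate (x : Label ι) : Module.End K (BetaGamma K ι) :=
  LinearMap.mulLeft K (MvPolynomial.X x)

/-- The partial derivative with respect to the even creation mode with label `x`. -/
def evenAnnihilate (x : Label ι) : Module.End K (BetaGamma K ι) :=
  (MvPolynomial.pderiv x).toLinearMap

/-- The field `b^{ξᵢ}(z)`; one has `[b^{ξᵢ}₍ₘ₎, c^{ξⱼ*}₍ₙ₎] = δᵢⱼ δ_{m+n,-1}`. -/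
def bBasis (i : ι) : Modes K (Weil K ι)
  | Int.negSucc k => Weil.map (oddCreate K (Sum.inl (i, k))) LinearMap.id
  | Int.ofNat n => Weil.map (oddAnnihilate K (Sum.inr (i, n))) LinearMap.id

/-- The field `c^{ξᵢ*}(z)`. -/
def cBasis (i : ι) : Modes K (Weil K ι)
  | Int.negSucc k => Weil.map (oddCreate K (Sum.inr (i, k))) LinearMap.id
  | Int.ofNat n => Weil.map (oddAnnihilate K (Sum.inl (i, n))) LinearMap.id

/-- The field `β^{ξᵢ}(z)`; one has `[β^{ξᵢ}₍ₘ₎, γ^{ξⱼ*}₍ₙ₎] = δᵢⱼ δ_{m+n,-1}`. -/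
def betaBasis (i : ι) : Modes K (Weil K ι)
  | Int.negSucc k => Weil.map LinearMap.id (evenCreate K (Sum.inl (i, k)))
  | Int.ofNat n => Weil.map LinearMap.id (evenAnnihilate K (Sum.inr (i, n)))

/-- The field `γ^{ξᵢ*}(z)`. -/
def gammaBasis (i : ι) : Modes K (Weil K ι)
  | Int.negSucc k => Weil.map LinearMap.id (evenCreate K (Sum.inr (i, k)))
  | Int.ofNat n => -Weil.map LinearMap.id (evenAnnihilate K (Sum.inl (i, n)))

variable (ι) [Fintype ι]

/-- The conformal field `ω = -∑ b^{ξᵢ} ∂c^{ξᵢ*} + ∑ β^{ξᵢ} ∂γ^{ξᵢ*}` (normally ordered). -/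
def omegaField : Modes K (Weil K ι) :=
  -∑ i : ι, nthProd 1 1 (-1) (bBasis K i) (derivField (cBasis K i))
    + ∑ i : ι, nthProd 0 0 (-1) (betaBasis K i) (derivField (gammaBasis K i))

/-- The weight operator `ω₍₁₎`. -/
def weightOp : Module.End K (Weil K ι) := omegaField K ι 1

/-- The degree operator `j_bc₍₀₎ + 2 j_βγ₍₀₎`, where `j_bc = -∑ b^{ξᵢ} c^{ξᵢ*}` and
`j_βγ = ∑ β^{ξᵢ} γ^{ξᵢ*}`. -/
def degreeOp : Module.End K (Weil K ι) :=
  (-∑ i : ι, nthProd 1 1 (-1) (bBasis K i) (cBasis K i)) 0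
    + 2 • (∑ i : ι, nthProd 0 0 (-1) (betaBasis K i) (gammaBasis K i)) 0

/-- The vectors of degree `p`. -/
def weilDeg (p : ℤ) : Submodule K (Weil K ι) :=
  LinearMap.ker (degreeOp K ι - p • (1 : Module.End K (Weil K ι)))

/-- The vectors of parity, degree and weight `q = (s, p, n)`. -/
def weilGr (q : ZMod 2 × ℤ × ℤ) : Submodule K (Weil K ι) :=
  LinearMap.ker (weilParity K ι - sgn q.1 • (1 : Module.End K (Weil K ι)))
    ⊓ weilDeg K ι q.2.1
    ⊓ LinearMap.ker (weightOp K ι - q.2.2 • (1 : Module.End K (Weil K ι)))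

end Fock

section WeilOfLie

variable {K ι g : Type*} [Field K] [Fintype ι] [LieRing g] [LieAlgebra K g]
  (e : Module.Basis ι K g)

/-- The field `b^ξ(z)` for `ξ ∈ g`. -/
def bField (ξ : g) : Modes K (Weil K ι) := ∑ i, e.repr ξ i • bBasis K i

/-- The field `β^ξ(z)` for `ξ ∈ g`. -/
def betaField (ξ : g) : Modes K (Weil K ι) := ∑ i, e.repr ξ i • betaBasis K i

/-- The field `c^φ(z)` for `φ ∈ g*`. -/
def cField (φ : Module.Dual K g) : Modes K (Weil K ι) := ∑ i, φ (e i) • cBasis K i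

/-- The field `γ^φ(z)` for `φ ∈ g*`. -/
def gammaField (φ : Module.Dual K g) : Modes K (Weil K ι) := ∑ i, φ (e i) • gammaBasis K i

/-- The coadjoint action of `g` on `g*`. -/
def coad (ξ : g) (φ : Module.Dual K g) : Module.Dual K g := -(φ ∘ₗ (LieAlgebra.ad K g ξ))

/-- The field of `D = J + K`, where
`J = -∑ β^{[ξᵢ,ξⱼ]} γ^{ξⱼ*} c^{ξᵢ*} - ½ ∑ c^{ξᵢ*} c^{ξⱼ*} b^{[ξᵢ,ξⱼ]}` and `K = ∑ γ^{ξᵢ*} b^{ξᵢ}`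
(normally ordered products, nested to the right). -/
def DField : Modes K (Weil K ι) :=
  -(∑ i, ∑ j, nthProd 0 1 (-1) (betaField e ⁅e i, e j⁆)
      (nthProd 0 1 (-1) (gammaBasis K j) (cBasis K i)))
    - (2 : K)⁻¹ • (∑ i, ∑ j, nthProd 1 0 (-1) (cBasis K i)
      (nthProd 1 1 (-1) (cBasis K j) (bField e ⁅e i, e j⁆)))
    + ∑ i, nthProd 0 1 (-1) (gammaBasis K i) (bBasis K i)

/-- The differential `d_W = D₍₀₎` of the semi-infinite Weil complex. -/
def weilD : Module.End K (Weil K ι) := DField e 0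

/-- The generators of `⟨γ⟩`. -/
def gammaGen (s : ZMod 2) : Set (Modes K (Weil K ι)) :=
  {A | s = 0 ∧ ∃ φ, A = gammaField e φ}

/-- The generators of `⟨c, γ⟩`. -/
def cGammaGen (s : ZMod 2) : Set (Modes K (Weil K ι)) :=
  {A | (s = 1 ∧ ∃ φ, A = cField e φ) ∨ (s = 0 ∧ ∃ φ, A = gammaField e φ)}

/-- The vertex superalgebra `W' = ⟨c, γ⟩` (its parity `s` part), as a space of fields on `W`. -/
abbrev cGamma (s : ZMod 2) : Submodule K (Modes K (Weil K ι)) := vsa (cGammaGen e) s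

/-- `c^φ` as an element of `⟨c, γ⟩`. -/
def cElt (φ : Module.Dual K g) : cGamma e 1 :=
  ⟨cField e φ, Generated.gen (Or.inl ⟨rfl, φ, rfl⟩)⟩

/-- `γ^φ` as an element of `⟨c, γ⟩`. -/
def gammaElt (φ : Module.Dual K g) : cGamma e 0 :=
  ⟨gammaField e φ, Generated.gen (Or.inr ⟨rfl, φ, rfl⟩)⟩

/-- `W' = ⟨c, γ⟩` as a subspace of the semi-infinite Weil algebra `W`. -/
def cGammaStates : Submodule K (Weil K ι) := states (vac K ι) (cGammaGen e)

/-- `⟨γ⟩` as a subspace of the semi-infinite Weil algebra `W`. -/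
def gammaStates : Submodule K (Weil K ι) := states (vac K ι) (gammaGen e)

end WeilOfLie

/-! ## Differential `sg[t]`-modules and chiral `W*`-modules -/

section Modules

/-- `f` is homogeneous of parity, degree and weight `q = (s, p, n)` for the given grading. -/
def IsHomog {K A : Type*} [Field K] [AddCommGroup A] [Module K A]
    (gr : ZMod 2 × ℤ × ℤ → Submodule K A) (q : ZMod 2 × ℤ × ℤ) (f : Module.End K A) : Prop :=
  ∀ r, ∀ a ∈ gr r, f a ∈ gr (r + q)

/-- A differential `sg[t]`-module structure on `A`: a degree-weight-graded super vector space
(`gr (s, p, n)` is the subspace of parity `s`, degree `p` and weight `n`) with an odd differential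
of degree `1` and weight `0`, and a continuous action
`(ξ, η) tⁿ ↦ L_{ξ,(n)} + ι_{η,(n)}` of the Lie superalgebra `sg[t]`, compatible with the
differential `(ξ, η) tⁿ ↦ (η, 0) tⁿ` of `sg[t]` and with the gradings. -/
structure SgModule (K g A : Type*) [Field K] [LieRing g] [LieAlgebra K g]
    [AddCommGroup A] [Module K A] where
  gr : ZMod 2 × ℤ × ℤ → Submodule K A
  internal : DirectSum.IsInternal gr
  d : Module.End K A
  d_homog : IsHomog gr (1, 1, 0) d
  d_sq : d * d = 0
  L : ℕ → g →ₗ[K] Module.End K A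
  iota : ℕ → g →ₗ[K] Module.End K A
  L_homog : ∀ (n : ℕ) (ξ : g), IsHomog gr (0, 0, -n) (L n ξ)
  iota_homog : ∀ (n : ℕ) (ξ : g), IsHomog gr (1, -1, -n) (iota n ξ)
  L_L : ∀ m n ξ η, L m ξ * L n η - L n η * L m ξ = L (m + n) ⁅ξ, η⁆
  L_iota : ∀ m n ξ η, L m ξ * iota n η - iota n η * L m ξ = iota (m + n) ⁅ξ, η⁆
  iota_iota : ∀ m n ξ η, iota m ξ * iota n η + iota n η * iota m ξ = 0
  d_L : ∀ n ξ, d * L n ξ - L n ξ * d = 0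
  d_iota : ∀ n ξ, d * iota n ξ + iota n ξ * d = L n ξ
  continuous : ∀ a, ∃ k, ∀ n ≥ k, ∀ ξ, L n ξ a = 0 ∧ iota n ξ a = 0

namespace SgModule

variable {K g A : Type*} [Field K] [LieRing g] [LieAlgebra K g] [AddCommGroup A] [Module K A]
  (M : SgModule K g A)

/-- The parity operator: `1` on even vectors, `-1` on odd ones. -/
def parity : Module.End K A :=
  (DirectSum.toModule K (ZMod 2 × ℤ × ℤ) A fun q => sgn q.1 • (M.gr q).subtype) ∘ₗ
    (LinearEquiv.ofBijective (DirectSum.coeLinearMap M.gr) M.internal).symm.toLinearMap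

/-- The vectors of degree `p`. -/
def deg (p : ℤ) : Submodule K A := ⨆ s, ⨆ n, M.gr (s, p, n)

/-- The chiral horizontal subspace. -/
def hor : Submodule K A := ⨅ n, ⨅ ξ, LinearMap.ker (M.iota n ξ)

/-- The chiral invariant subspace. -/
def inv : Submodule K A := ⨅ n, ⨅ ξ, LinearMap.ker (M.L n ξ)

/-- The chiral basic subspace. -/
def bas : Submodule K A := M.hor ⊓ M.inv

end SgModule

/-- A chiral `W*`-module structure on `A` with respect to a finite-dimensional Lie algebra `g`
(with basis `e`): a differential `sg[t]`-module with a module structure `Y` over the vertex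
superalgebra `⟨c, γ⟩`, compatible with the gradings, satisfying the three compatibility conditions
`d_Y`, `L_c`, `iota_c`. The fields `Y_vac`, `Y_trunc`, `Y_borcherds` are the axioms of a module
over a vertex superalgebra: the vacuum acts as the identity, every `Y(x, z)` is a field, and the
Borcherds (Jacobi) identity holds. -/
structure ChiralWStarModule {K ι g : Type*} [Field K] [Fintype ι] [LieRing g] [LieAlgebra K g]
    (e : Module.Basis ι K g) (A : Type*) [AddCommGroup A] [Module K A]
    extends SgModule K g A where
  Y : ∀ s : ZMod 2, cGamma e s →ₗ[K] Modes K A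
  Y_vac : Y 0 (vsa.one (cGammaGen e)) = idField
  Y_trunc : ∀ s (x : cGamma e s) a, ∃ N : ℤ, ∀ n ≥ N, Y s x n a = 0
  Y_borcherds : ∀ (s t : ZMod 2) (x : cGamma e s) (y : cGamma e t) (l m n : ℤ) (a : A),
    ∑ᶠ j : ℕ, Ring.choose m j • Y (s + t) (vsa.prod (l + j) x y) (m + n - j) a =
      ∑ᶠ j : ℕ, ((-1 : ℤ) ^ j * Ring.choose l j) •
        (Y s x (m + l - j) (Y t y (n + j) a) -
          (koszul s t * ((l.negOnePow : ℤˣ) : ℤ)) • Y t y (n + l - j) (Y s x (m + j) a))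
  Y_homog : ∀ (s : ZMod 2) (x : cGamma e s) (p n : ℤ),
    state (vac K ι) x.1 ∈ weilGr K ι (s, p, n) → ∀ k : ℤ,
      IsHomog gr (s, p, n - k - 1) (Y s x k)
  /-- `[d_A, Y(x, z)] = Y(d_W x, z)`; here `y` is the element `d_W x` of `⟨c, γ⟩`. -/
  d_Y : ∀ (s : ZMod 2) (x : cGamma e s) (y : cGamma e (s + 1)),
    state (vac K ι) y.1 = weilD e (state (vac K ι) x.1) →
      ∀ n, d * Y s x n - sgn s • (Y s x n * d) = Y (s + 1) y n
  L_c : ∀ (m : ℕ) (n : ℤ) (ξ : g) (φ : Module.Dual K g),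
    L m ξ * Y 1 (cElt e φ) n - Y 1 (cElt e φ) n * L m ξ = Y 1 (cElt e (coad ξ φ)) (m + n)
  iota_c : ∀ (m : ℕ) (n : ℤ) (ξ : g) (φ : Module.Dual K g),
    iota m ξ * Y 1 (cElt e φ) n + Y 1 (cElt e φ) n * iota m ξ =
      if m + n = -1 then φ ξ • 1 else 0

end Modules

/-! ## Complexes and cohomology -/

/-- A subspace `carrier` of a space `V` with degree pieces `deg p` and an operator `d`. -/
structure PreComplex (K V : Type*) [Field K] [AddCommGroup V] [Module K V] where
  deg : ℤ → Submodule K V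
  d : Module.End K V
  carrier : Submodule K V

namespace PreComplex

variable {K V V' : Type*} [Field K] [AddCommGroup V] [Module K V] [AddCommGroup V'] [Module K V']

/-- The degree `p` part. -/
def piece (C : PreComplex K V) (p : ℤ) : Submodule K V := C.carrier ⊓ C.deg p

/-- `C` is a cochain complex: it is the direct sum of its degree pieces, and `d` maps the piece of
degree `p` to the piece of degree `p + 1` and squares to zero. -/
structure IsComplex (C : PreComplex K V) : Prop where
  independent : iSupIndep C.piece
  graded : ⨆ p, C.piece p = C.carrier
  d_mem : ∀ p, ∀ x ∈ C.piece p, C.d x ∈ C.piece (p + 1)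
  d_sq : ∀ x ∈ C.carrier, C.d (C.d x) = 0

/-- The cocycles of degree `p`. -/
def cocycles (C : PreComplex K V) (p : ℤ) : Submodule K V := C.piece p ⊓ LinearMap.ker C.d

/-- The coboundaries of degree `p`. -/
def coboundaries (C : PreComplex K V) (p : ℤ) : Submodule K V := (C.piece (p - 1)).map C.d

/-- The cohomology in degree `p`. -/
abbrev Cohomology (C : PreComplex K V) (p : ℤ) : Type _ :=
  C.cocycles p ⧸ (C.coboundaries p).comap (C.cocycles p).subtype

/-- `f` restricts to a morphism of complexes from `C` to `C'`. -/
structure IsChainMap (C : PreComplex K V) (C' : PreComplex K V') (f : V →ₗ[K] V') : Prop where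
  mem : ∀ p, ∀ x ∈ C.piece p, f x ∈ C'.piece p
  comm : ∀ p, ∀ x ∈ C.piece p, C'.d (f x) = f (C.d x)

variable {C : PreComplex K V} {C' : PreComplex K V'} {f : V →ₗ[K] V'}

theorem IsChainMap.cocycle (h : C.IsChainMap C' f) (p : ℤ) :
    ∀ x ∈ C.cocycles p, f x ∈ C'.cocycles p := fun x hx =>
  ⟨h.mem p x hx.1, by
    have : C.d x = 0 := hx.2
    simp [h.comm p x hx.1, this]⟩

/-- The map induced in cohomology by a morphism of complexes. -/
def IsChainMap.cohomologyMap (h : C.IsChainMap C' f) (p : ℤ) :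
    C.Cohomology p →ₗ[K] C'.Cohomology p :=
  Submodule.mapQ _ _ (f.restrict (h.cocycle p)) (by
    rintro ⟨x, hx⟩ ⟨y, hy, hyx⟩
    exact ⟨f y, h.mem _ y hy, by rw [h.comm _ y hy, hyx]; rfl⟩)

/-- `f` restricts to a quasi-isomorphism from `C` to `C'`. -/
def IsQuasiIso (C : PreComplex K V) (C' : PreComplex K V') (f : V →ₗ[K] V') : Prop :=
  ∃ h : C.IsChainMap C' f, ∀ p, Function.Bijective (h.cohomologyMap p)

end PreComplex

/-! ## The chiral Cartan models -/

section Cartan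

/-- The operator `φ(0)_{≥0} = ∑ᵢ ∑ₙ c^{ξᵢ*}₍₋ₙ₋₁₎ ⊗ ι_{ξᵢ,(n)}` on `A ⊗ B`, where `σ` is the parity
operator of `A`: by the Koszul rule, `f ⊗ g` is `a ⊗ b ↦ (f σ a) ⊗ (g b)` for an odd
operator `g`. -/
def phiOp {K ι A B : Type*} [Field K] [AddCommGroup A] [Module K A] [AddCommGroup B] [Module K B]
    (σ : Module.End K A) (c : ι → Modes K A) (io : ι → ℕ → Module.End K B) :
    Module.End K (A ⊗[K] B) :=
  locSum fun x : ι × ℕ => TensorProduct.map (c x.1 (-x.2 - 1) * σ) (io x.1 x.2)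

namespace ChiralWStarModule

variable {K ι g A : Type*} [Field K] [Fintype ι] [LieRing g] [LieAlgebra K g]
  {e : Module.Basis ι K g} [AddCommGroup A] [Module K A] (M : ChiralWStarModule e A)

/-- The operator `φ(0)_{≥0}` on `W ⊗ A`. -/
def phiWA : Module.End K (Weil K ι ⊗[K] A) :=
  phiOp (weilParity K ι) (fun i => cBasis K i) (fun i n => M.iota n (e i))

/-- The operator `φ(0)_{≥0}` on `A ⊗ W`; recall that `ι_{ξ,(n)}` acts on `W` by `b^ξ₍ₙ₎`. -/
def phiAW : Module.End K (A ⊗[K] Weil K ι) :=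
  phiOp M.parity (fun i => M.Y 1 (cElt e (e.coord i))) (fun i n => bBasis K i n)

/-- The switching map `w ⊗ a ↦ (-1)^(|w||a|) a ⊗ w`. -/
def switch : Weil K ι ⊗[K] A →ₗ[K] A ⊗[K] Weil K ι :=
  (TensorProduct.comm K (Weil K ι) A).toLinearMap ∘ₗ
    ((2 : K)⁻¹ • (TensorProduct.map LinearMap.id (1 + M.parity)
      + TensorProduct.map (weilParity K ι) (1 - M.parity)))

/-- The small chiral Cartan model `⟨γ⟩ ⊗ A_inv` of the differential `sg[t]`-module `A`, as a
subspace of `W ⊗ A` (for commutative `g`). -/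
def cartanWA : Submodule K (Weil K ι ⊗[K] A) :=
  Submodule.map₂ (TensorProduct.mk K (Weil K ι) A) (gammaStates e) M.inv

/-- The space `C'(A; W) = (Φ_{A,W} ∘ τ ∘ Φ_{W,A}⁻¹)(⟨γ⟩ ⊗ A_inv)`, where `Φ = exp φ(0)_{≥0}`. -/
def smallCartanSpace : Submodule K (A ⊗[K] Weil K ι) :=
  M.cartanWA.map (locExp M.phiAW ∘ₗ M.switch ∘ₗ locExp (-M.phiWA))

/-- The differential `d_A ⊗ 1 + 1 ⊗ d_W` of `A ⊗ W`. -/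
def tensorD : Module.End K (A ⊗[K] Weil K ι) :=
  TensorProduct.map M.d LinearMap.id + TensorProduct.map M.parity (weilD e)

/-- The vectors of degree `p` in `A ⊗ W`. -/
def tensorDeg (p : ℤ) : Submodule K (A ⊗[K] Weil K ι) :=
  ⨆ q : ℤ, Submodule.map₂ (TensorProduct.mk K A (Weil K ι)) (M.deg q) (weilDeg K ι (p - q))

/-- The chiral basic complex `(A_bas, d_A)`. -/
def basicComplex : PreComplex K A where
  deg := M.deg
  d := M.d
  carrier := M.bas

/-- The complex `(C'(A; W), d'_{A,W})`, where `d'_{A,W}` is the restriction of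
`Φ_{A,W} ∘ (d_A ⊗ 1 + 1 ⊗ d_W) ∘ Φ_{A,W}⁻¹`. -/
def smallCartan : PreComplex K (A ⊗[K] Weil K ι) where
  deg := M.tensorDeg
  d := locExp M.phiAW * M.tensorD * locExp (-M.phiAW)
  carrier := M.smallCartanSpace

/-- The map `a ↦ a ⊗ 1`. -/
def tensorVac : A →ₗ[K] A ⊗[K] Weil K ι := (TensorProduct.mk K A (Weil K ι)).flip (vac K ι)

end ChiralWStarModule

end Cartan

end ChiralWeil

end

/-!
The two exponentials become comparable after transporting the first one to `A ⊗ W` by the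
switching map: the composite `Ψ = Φ_{A,W} τ Φ_{W,A}⁻¹ τ⁻¹` is an automorphism of `A_inv ⊗ ⟨c, γ⟩`,
because the Lie algebra is commutative and the operators `L_{ξ,(n)}` therefore commute with the
modes of the `c^{ξᵢ*}` and with the `ι_{ξ,(n)}`. Computing the commutators of the exponents with
`1 ⊗ b^ξ₍ₙ₎` and `ι_{ξ,(n)} ⊗ 1` shows that `Ψ` conjugates the former to the latter
(`locExp_conj`). The common kernel of the `1 ⊗ b^ξ₍ₙ₎` on `A_inv ⊗ ⟨c, γ⟩` is `A_inv ⊗ ⟨γ⟩`, since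
a vector of `⟨c, γ⟩` killed by all `b^ξ₍ₙ₎`, `n ≥ 0`, contains no `c` (`mem_gammaStates`); the
common kernel of the `ι_{ξ,(n)} ⊗ 1` is `A_bas ⊗ ⟨c, γ⟩`. Hence `C'(A; W) = A_bas ⊗ ⟨c, γ⟩`
(`smallCartanSpace_eq`).

The commutator of the exponent of `Φ_{A,W}` with `d_A ⊗ 1 + 1 ⊗ d_W` commutes with that exponent,
so that `d' = d_A ⊗ 1 + 1 ⊗ d_W - ∑ γ^{ξᵢ*,A}₍₋ₙ₋₁₎ ⊗ b^{ξᵢ}₍ₙ₎` (`smallCartan_d`). The operator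
`h = ∑ 1 ⊗ c^{ξᵢ*}₍₋ₙ₋₁₎ β^{ξᵢ}₍ₙ₎` has with the first two terms of `d'` the anticommutator which
counts the creation modes in `⟨c, γ⟩`, and with the last term the anticommutator `∑
γ^{ξᵢ*,A}₍₋ₙ₋₁₎ ⊗ β^{ξᵢ}₍ₙ₎`, which lowers that number. So on the filtration of `A_bas ⊗ ⟨c, γ⟩`
by the number of creation modes, `[d', h]` is `k` on the `k`-th piece modulo the previous one
(`homotopy_lower`). By induction on `k`, every homogeneous element of the small Cartan model whose
differential lies in `A_bas ⊗ 1` is the sum of an element of `A_bas ⊗ 1` and a coboundary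
(`exists_cohomologous`). Applied to cocycles this gives surjectivity of `a ↦ a ⊗ 1` on cohomology,
and applied to an element with coboundary `a ⊗ 1` it gives injectivity.

The supercommutation relations of the modes of `c^{ξᵢ*}` and `γ^{ξᵢ*}` on the module are not among
the axioms; they follow from the Borcherds identity, as the corresponding fields of `W`
supercommute (`Y_supercomm`). The subspaces `⟨γ⟩` and `⟨c, γ⟩` of `W`, defined as sets of states
of generated fields, are identified with the polynomials in creation modes applied to the vacuum
(`gammaStates_eq`, `cGammaStates_eq`), and the pieces of fixed degree are handled as eigenspaces
of a degree operator.
-/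

noncomputable section

namespace ChiralWeil

/-! ### Locally finite sums and exponentials of locally nilpotent operators -/

section LocallyFinite

variable {K V V' : Type*} [Field K] [AddCommGroup V] [Module K V] [AddCommGroup V'] [Module K V']
  {J : Type*}

/-- A family of operators is locally finite if every vector is killed by all but finitely many of
its members. -/
def LocFin (f : J → Module.End K V) : Prop :=
  ∀ v, (Function.support fun j => f j v).Finite

/-- An operator is locally nilpotent if every vector is killed by one of its powers. -/
def LocNilp (f : Module.End K V) : Prop := ∀ v, ∃ n : ℕ, (f ^ n) v = 0

theorem locSum_apply {f : J → Module.End K V} (hf : LocFin f) (v : V) :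
    locSum f v = ∑ᶠ j, f j v := by
  have h : ∀ v, (Function.support fun j => f j v).Finite := hf
  unfold locSum
  rw [dif_pos h]
  rfl

theorem locSum_apply_eq_sum {f : J → Module.End K V} (hf : LocFin f) {v : V} {s : Finset J}
    (hs : ∀ j, j ∉ s → f j v = 0) : locSum f v = ∑ j ∈ s, f j v := by
  rw [locSum_apply hf]
  refine finsum_eq_sum_of_support_subset _ fun j hj => ?_
  by_contra h
  exact hj (hs j h)

theorem locSum_mem {f : J → Module.End K V} {p : Submodule K V} {v : V} (h : ∀ j, f j v ∈ p) :
    locSum f v ∈ p := by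
  classical
  by_cases hf : LocFin f
  · rw [locSum_apply_eq_sum hf (s := (hf v).toFinset) (fun j hj => by simpa using hj)]
    exact p.sum_mem fun j _ => h j
  · have : ¬ ∀ v, (Function.support fun j => f j v).Finite := hf
    simp [locSum, this]

theorem locSum_apply_eq_zero {f : J → Module.End K V} {v : V} (h : ∀ j, f j v = 0) :
    locSum f v = 0 := by
  have := locSum_mem (p := ⊥) (f := f) (v := v) (fun j => by simp [h j])
  simpa using this

theorem locSum_zero : locSum (fun _ : J => (0 : Module.End K V)) = 0 :=
  LinearMap.ext fun _ => locSum_apply_eq_zero fun _ => rfl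

theorem LocFin.of_support {f g : J → Module.End K V} (hf : LocFin f)
    (h : ∀ j v, f j v = 0 → g j v = 0) : LocFin g :=
  fun v => (hf v).subset fun j hj hj' => hj (h j v hj')

theorem LocFin.mul_left {f : J → Module.End K V} (hf : LocFin f) (T : J → Module.End K V) :
    LocFin fun j => T j * f j :=
  hf.of_support fun j v h => by simp [h]

theorem LocFin.mul_right {f : J → Module.End K V} (hf : LocFin f) (T : Module.End K V) :
    LocFin fun j => f j * T :=
  fun v => hf (T v)

theorem LocFin.neg {f : J → Module.End K V} (hf : LocFin f) : LocFin fun j => -f j :=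
  hf.of_support fun j v h => by simp [h]

theorem LocFin.add {f g : J → Module.End K V} (hf : LocFin f) (hg : LocFin g) :
    LocFin fun j => f j + g j :=
  fun v => ((hf v).union (hg v)).subset (Function.support_add _ _)

theorem LocFin.sub {f g : J → Module.End K V} (hf : LocFin f) (hg : LocFin g) :
    LocFin fun j => f j - g j := by
  simpa only [sub_eq_add_neg] using hf.add hg.neg

theorem locSum_neg {f : J → Module.End K V} (hf : LocFin f) :
    locSum (fun j => -f j) = -locSum f := by
  ext v
  rw [locSum_apply hf.neg, LinearMap.neg_apply, locSum_apply hf, ← finsum_neg_distrib]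
  rfl

theorem locSum_add {f g : J → Module.End K V} (hf : LocFin f) (hg : LocFin g) :
    locSum (fun j => f j + g j) = locSum f + locSum g := by
  ext v
  rw [locSum_apply (hf.add hg), LinearMap.add_apply, locSum_apply hf, locSum_apply hg,
    ← finsum_add_distrib (hf v) (hg v)]
  rfl

theorem locSum_sub {f g : J → Module.End K V} (hf : LocFin f) (hg : LocFin g) :
    locSum (fun j => f j - g j) = locSum f - locSum g := by
  simp only [sub_eq_add_neg]
  rw [locSum_add hf hg.neg, locSum_neg hg]

theorem locSum_mul {f : J → Module.End K V} (hf : LocFin f) (T : Module.End K V) :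
    locSum f * T = locSum fun j => f j * T := by
  ext v
  rw [locSum_apply (hf.mul_right T), Module.End.mul_apply, locSum_apply hf]
  rfl

/-- A linear map intertwining two locally finite families intertwines their sums. -/
theorem comp_locSum {f : J → Module.End K V} {g : J → Module.End K V'} (hf : LocFin f)
    (hg : LocFin g) (T : V →ₗ[K] V') (h : ∀ j v, T (f j v) = g j (T v)) (v : V) :
    T (locSum f v) = locSum g (T v) := by
  classical
  have hs : ∀ j, j ∉ (hf v).toFinset → f j v = 0 := fun j hj => by simpa using hj
  rw [locSum_apply_eq_sum hf hs, map_sum,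
    locSum_apply_eq_sum hg (s := (hf v).toFinset) fun j hj => by rw [← h, hs j hj, map_zero]]
  exact Finset.sum_congr rfl fun j _ => h j v

theorem mul_locSum {f : J → Module.End K V} (hf : LocFin f) (T : Module.End K V) :
    T * locSum f = locSum fun j => T * f j := by
  classical
  ext v
  have hs : ∀ j, j ∉ (hf v).toFinset → f j v = 0 := fun j hj => by simpa using hj
  rw [Module.End.mul_apply, locSum_apply_eq_sum hf hs, map_sum,
    locSum_apply_eq_sum (hf.mul_left fun _ => T) (v := v) (s := (hf v).toFinset)
      fun j hj => by rw [Module.End.mul_apply, hs j hj, map_zero]]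
  rfl

theorem locSum_eq_single {f : J → Module.End K V} (hf : LocFin f) (i : J)
    (h : ∀ j, j ≠ i → f j = 0) : locSum f = f i := by
  ext v
  rw [locSum_apply_eq_sum hf (s := {i}) fun j hj => by
    rw [h j (by simpa using hj), LinearMap.zero_apply]]
  simp

/-- The sum of a locally finite commuting family of operators of square zero is locally
nilpotent. -/
theorem locNilp_locSum {f : J → Module.End K V} (hf : LocFin f)
    (hc : ∀ i j, Commute (f i) (f j)) (h0 : ∀ j, f j * f j = 0) : LocNilp (locSum f) := by
  classical
  intro v
  set s := (hf v).toFinset with hsdef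
  have hs : ∀ j, j ∉ s → f j v = 0 := fun j hj => by simpa [hsdef] using hj
  obtain ⟨n, hn⟩ : IsNilpotent (∑ j ∈ s, f j) :=
    Commute.isNilpotent_sum (fun j _ => ⟨2, by rw [pow_two, h0]⟩) fun i j _ _ => hc i j
  have key : ∀ k : ℕ, (locSum f ^ k) v = ((∑ j ∈ s, f j) ^ k) v ∧
      ∀ j, j ∉ s → f j (((∑ j ∈ s, f j) ^ k) v) = 0 := by
    intro k
    induction k with
    | zero => exact ⟨rfl, fun j hj => by simpa using hs j hj⟩
    | succ k ih =>
      refine ⟨?_, fun j hj => ?_⟩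
      · rw [pow_succ', pow_succ', Module.End.mul_apply, Module.End.mul_apply, ih.1,
          locSum_apply_eq_sum hf ih.2, LinearMap.sum_apply]
      · have : Commute (f j) (∑ j ∈ s, f j) := Commute.sum_right _ _ _ fun i _ => hc j i
        rw [pow_succ', Module.End.mul_apply, ← Module.End.mul_apply, this.eq,
          Module.End.mul_apply, ih.2 j hj, map_zero]
  exact ⟨n, by rw [(key n).1, hn, LinearMap.zero_apply]⟩

theorem LocNilp.neg {f : Module.End K V} (hf : LocNilp f) : LocNilp (-f) := fun v => by
  obtain ⟨n, hn⟩ := hf v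
  exact ⟨n, by rcases Nat.even_or_odd n with h | h <;> simp [h.neg_pow, hn]⟩

theorem pow_apply_eq_zero_of_le {f : Module.End K V} {v : V} {m n : ℕ} (h : (f ^ m) v = 0)
    (hmn : m ≤ n) : (f ^ n) v = 0 := by
  rw [← Nat.sub_add_cancel hmn, pow_add, Module.End.mul_apply, h, map_zero]

theorem LocNilp.locFin {f : Module.End K V} (hf : LocNilp f) :
    LocFin fun k : ℕ => (k.factorial : K)⁻¹ • f ^ k := fun v => by
  obtain ⟨n, hn⟩ := hf v
  refine (Finset.range n).finite_toSet.subset fun k hk => ?_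
  by_contra h
  have hk' : n ≤ k := by simpa using h
  exact hk (by simp [pow_apply_eq_zero_of_le hn hk'])

/-- The exponential of a locally nilpotent operator is, on each vector, a partial sum of the
exponential series. -/
theorem locExp_apply {f : Module.End K V} (hf : LocNilp f) {v : V} {n : ℕ} (hn : (f ^ n) v = 0) :
    locExp f v = ∑ k ∈ Finset.range n, (k.factorial : K)⁻¹ • (f ^ k) v := by
  rw [locExp, locSum_apply_eq_sum hf.locFin (s := Finset.range n)]
  · rfl
  · intro k hk
    have hk' : n ≤ k := by simpa using hk
    simp [pow_apply_eq_zero_of_le hn hk']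

theorem locExp_mem {f : Module.End K V} {p : Submodule K V} (h : ∀ v ∈ p, f v ∈ p) {v : V}
    (hv : v ∈ p) : locExp f v ∈ p := by
  refine locSum_mem fun k => p.smul_mem _ ?_
  induction k with
  | zero => simpa using hv
  | succ k ih =>
    rw [pow_succ', Module.End.mul_apply]
    exact h _ ih

/-- A linear map intertwining two locally nilpotent operators intertwines their exponentials. -/
theorem comp_locExp {f : Module.End K V} {g : Module.End K V'} (hf : LocNilp f)
    (hg : LocNilp g) (T : V →ₗ[K] V') (h : ∀ v, T (f v) = g (T v)) (v : V) :
    T (locExp f v) = locExp g (T v) := by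
  refine comp_locSum hf.locFin hg.locFin T (fun k v => ?_) v
  have : ∀ w, T ((f ^ k) w) = (g ^ k) (T w) := by
    induction k with
    | zero => exact fun w => rfl
    | succ k ih =>
      intro w
      rw [pow_succ', pow_succ', Module.End.mul_apply, Module.End.mul_apply, h, ih]
  simp [this]

/-- If `U = [f, T]` commutes with `f`, then `exp(f) T = (T + U) exp(f)`. -/
theorem locExp_mul [CharZero K] {f T U : Module.End K V} (hf : LocNilp f)
    (hU : f * T - T * f = U) (hfU : f * U = U * f) :
    locExp f * T = (T + U) * locExp f := by
  have hp : ∀ k : ℕ, f ^ (k + 1) * T = T * f ^ (k + 1) + (k + 1 : K) • (U * f ^ k) := by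
    have hfT : f * T = T * f + U := by rw [← hU]; abel
    intro k
    induction k with
    | zero => simp [hfT]
    | succ k ih =>
      rw [pow_succ' f (k + 1), mul_assoc, ih, mul_add, ← mul_assoc, hfT, add_mul, mul_assoc,
        mul_smul_comm, ← mul_assoc f U, hfU, mul_assoc U f, ← pow_succ']
      push_cast
      rw [add_smul (k + 1 : K) 1, one_smul, ← pow_succ' f k]
      abel
  ext v
  obtain ⟨m, hm⟩ := hf v
  obtain ⟨m', hm'⟩ := hf (T v)
  set n := max m m'
  have h1 : (f ^ n) v = 0 := pow_apply_eq_zero_of_le hm (le_max_left _ _)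
  have h2 : (f ^ (n + 1)) (T v) = 0 :=
    pow_apply_eq_zero_of_le hm' ((le_max_right _ _).trans (Nat.le_succ _))
  have h3 : (f ^ (n + 1)) v = 0 := pow_apply_eq_zero_of_le h1 (Nat.le_succ _)
  have e1 : T (locExp f v) = ∑ k ∈ Finset.range n,
      ((k + 1).factorial : K)⁻¹ • T ((f ^ (k + 1)) v) + T v := by
    rw [locExp_apply hf h3, Finset.sum_range_succ', map_add, map_sum]
    simp
  have e2 : U (locExp f v) = ∑ k ∈ Finset.range n, (k.factorial : K)⁻¹ • U ((f ^ k) v) := by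
    rw [locExp_apply hf h1, map_sum]
    simp
  rw [Module.End.mul_apply, Module.End.mul_apply, LinearMap.add_apply, e1, e2,
    locExp_apply hf h2, Finset.sum_range_succ', add_right_comm, ← Finset.sum_add_distrib]
  congr 1
  · refine Finset.sum_congr rfl fun k _ => ?_
    have h := LinearMap.congr_fun (hp k) v
    simp only [Module.End.mul_apply, LinearMap.add_apply, LinearMap.smul_apply] at h
    have hk : (k + 1 : K) ≠ 0 := Nat.cast_add_one_ne_zero k
    rw [h, smul_add, smul_smul]
    congr 2
    rw [Nat.factorial_succ]
    push_cast
    field_simp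
  · simp

/-- Exponentials of opposite locally nilpotent operators are mutually inverse. -/
theorem locExp_mul_locExp_neg [CharZero K] {f : Module.End K V} (hf : LocNilp f) :
    locExp f * locExp (-f) = 1 := by
  ext v
  obtain ⟨n, hn⟩ := hf v
  have hn' : ((-f) ^ n) v = 0 := by rcases Nat.even_or_odd n with h | h <;> simp [h.neg_pow, hn]
  have hpow : ∀ j, ((-f) ^ j) v = (-1 : K) ^ j • (f ^ j) v := fun j => by
    rw [← neg_one_smul K f, smul_pow, LinearMap.smul_apply]
  rw [Module.End.mul_apply, locExp_apply hf.neg hn', map_sum]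
  have h1 : ∀ j, locExp f ((j.factorial : K)⁻¹ • ((-f) ^ j) v) =
      ∑ i ∈ Finset.range n, ((i.factorial : K)⁻¹ * ((j.factorial : K)⁻¹ * (-1) ^ j)) •
        (f ^ (i + j)) v := fun j => by
    rw [hpow, smul_smul, map_smul, locExp_apply hf (n := n), Finset.smul_sum]
    · refine Finset.sum_congr rfl fun i _ => ?_
      rw [smul_smul, pow_add, Module.End.mul_apply, mul_comm]
    · rw [← Module.End.mul_apply, ← pow_add, add_comm, pow_add, Module.End.mul_apply, hn,
        map_zero]
  -- the coefficients of the power series identity `exp(X) * exp(-X) = 1`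
  have h2 : ∀ k, ∑ p ∈ Finset.HasAntidiagonal.antidiagonal k,
      ((p.1.factorial : K)⁻¹ * ((p.2.factorial : K)⁻¹ * (-1) ^ p.2)) = if k = 0 then 1 else 0 := by
    intro k
    have h := congrArg (PowerSeries.coeff k) (PowerSeries.exp_mul_exp_neg_eq_one (A := K))
    rw [PowerSeries.coeff_mul, PowerSeries.coeff_one] at h
    rw [← h]
    refine Finset.sum_congr rfl fun p _ => ?_
    simp [PowerSeries.coeff_exp, PowerSeries.evalNegHom, PowerSeries.coeff_rescale, mul_comm]
  simp only [h1]
  rw [Finset.sum_comm, ← Finset.sum_product', ← Finset.sum_fiberwise_of_maps_to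
    (t := Finset.range (2 * n)) (g := fun p : ℕ × ℕ => p.1 + p.2)]
  · have h3 : ∀ k ∈ Finset.range (2 * n), ∑ p ∈ Finset.range n ×ˢ Finset.range n with p.1 + p.2 = k,
        ((p.1.factorial : K)⁻¹ * ((p.2.factorial : K)⁻¹ * (-1) ^ p.2)) • (f ^ (p.1 + p.2)) v =
        if k = 0 then v else 0 := by
      intro k _
      have h4 : ∀ p ∈ (Finset.range n ×ˢ Finset.range n).filter fun p => p.1 + p.2 = k,
          ((p.1.factorial : K)⁻¹ * ((p.2.factorial : K)⁻¹ * (-1) ^ p.2)) • (f ^ (p.1 + p.2)) v =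
          ((p.1.factorial : K)⁻¹ * ((p.2.factorial : K)⁻¹ * (-1) ^ p.2)) • (f ^ k) v :=
        fun p hp => by rw [(Finset.mem_filter.1 hp).2]
      rw [Finset.sum_congr rfl h4]
      by_cases hk : n ≤ k
      · have : (f ^ k) v = 0 := pow_apply_eq_zero_of_le hn hk
        simp only [this, smul_zero, Finset.sum_const_zero]
        split_ifs with hk0
        · subst hk0
          simpa using this.symm
        · rfl
      · rw [← Finset.sum_smul]
        have h5 : (Finset.range n ×ˢ Finset.range n).filter (fun p => p.1 + p.2 = k) =
            Finset.HasAntidiagonal.antidiagonal k := by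
          ext p
          simp only [Finset.mem_filter, Finset.mem_product, Finset.mem_range,
            Finset.HasAntidiagonal.mem_antidiagonal]
          omega
        rw [h5, h2 k]
        split_ifs with hk0
        · subst hk0
          simp
        · simp
    rw [Finset.sum_congr rfl h3]
    rcases Nat.eq_zero_or_pos n with h0 | h0
    · subst h0
      simpa using hn.symm
    · rw [Finset.sum_eq_single 0 (fun b _ hb => if_neg hb) fun h => by simp at h; omega]
      simp
  · intro p hp
    simp at hp ⊢
    omega

end LocallyFinite

/-! ### Canonical commutation relations of the semi-infinite Weil algebra -/

section FockRelations

variable {K ι : Type*} [Field K]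

section Odd

theorem oddCreate_apply (x : Label ι) (v : BC K ι) :
    oddCreate K x v = ExteriorAlgebra.ι K (Finsupp.single x 1) * v := rfl

theorem oddCreate_anticomm (x y : Label ι) :
    oddCreate K x * oddCreate K y + oddCreate K y * oddCreate K x = 0 := by
  refine LinearMap.ext fun v => ?_
  have h := ExteriorAlgebra.ι_add_mul_swap (R := K)
    (Finsupp.single x (1 : K)) (Finsupp.single y (1 : K))
  simp only [LinearMap.add_apply, Module.End.mul_apply, oddCreate_apply, ← mul_assoc, ← add_mul, h,
    zero_mul, LinearMap.zero_apply]

theorem oddAnnihilate_anticomm (x y : Label ι) :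
    oddAnnihilate K x * oddAnnihilate K y + oddAnnihilate K y * oddAnnihilate K x = 0 := by
  refine LinearMap.ext fun v => ?_
  have h := CliffordAlgebra.contractLeft_comm (Q := (0 : QuadraticForm K (Label ι →₀ K)))
    (d := Finsupp.lapply x) (d' := Finsupp.lapply y) v
  change CliffordAlgebra.contractLeft _ (CliffordAlgebra.contractLeft _ v) +
    CliffordAlgebra.contractLeft _ (CliffordAlgebra.contractLeft _ v) = 0
  rw [h, neg_add_cancel]

theorem oddAnnihilate_ι_mul (x : Label ι) (m : Label ι →₀ K) (v : BC K ι) :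
    oddAnnihilate K x (ExteriorAlgebra.ι K m * v) =
      m x • v - ExteriorAlgebra.ι K m * oddAnnihilate K x v :=
  CliffordAlgebra.contractLeft_ι_mul (Q := (0 : QuadraticForm K (Label ι →₀ K))) _ _ _

theorem oddAnnihilate_algebraMap (x : Label ι) (r : K) :
    oddAnnihilate K x (algebraMap K (BC K ι) r) = 0 :=
  CliffordAlgebra.contractLeft_algebraMap (0 : QuadraticForm K (Label ι →₀ K)) _ _

open Classical in
theorem oddAnnihilate_oddCreate (x y : Label ι) :
    oddAnnihilate K x * oddCreate K y + oddCreate K y * oddAnnihilate K x =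
      if x = y then 1 else 0 := by
  refine LinearMap.ext fun v => ?_
  simp only [LinearMap.add_apply, Module.End.mul_apply, oddCreate_apply, oddAnnihilate_ι_mul,
    Finsupp.single_apply]
  by_cases h : x = y
  · simp [h]
  · simp [h, Ne.symm h]

theorem involute_oddCreate (x : Label ι) (v : BC K ι) :
    CliffordAlgebra.involute (Q := (0 : QuadraticForm K (Label ι →₀ K))) (oddCreate K x v) =
      -oddCreate K x (CliffordAlgebra.involute
        (Q := (0 : QuadraticForm K (Label ι →₀ K))) v) := by
  rw [oddCreate_apply, map_mul]
  refine (congrArg₂ _ (CliffordAlgebra.involute_ι _) rfl).trans ?_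
  exact neg_mul _ _

/-- Induction over the exterior algebra by left multiplication with vectors. -/
theorem bc_induction {P : BC K ι → Prop} (algebraMap : ∀ r : K, P (algebraMap K (BC K ι) r))
    (add : ∀ v w, P v → P w → P (v + w))
    (ι_mul : ∀ v m, P v → P (ExteriorAlgebra.ι K m * v)) (v : BC K ι) : P v :=
  CliffordAlgebra.left_induction (Q := (0 : QuadraticForm K (Label ι →₀ K))) algebraMap add ι_mul v

theorem involute_oddAnnihilate (x : Label ι) (v : BC K ι) :
    CliffordAlgebra.involute (Q := (0 : QuadraticForm K (Label ι →₀ K))) (oddAnnihilate K x v) =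
      -oddAnnihilate K x (CliffordAlgebra.involute
        (Q := (0 : QuadraticForm K (Label ι →₀ K))) v) := by
  induction v using bc_induction with
  | algebraMap r =>
    rw [oddAnnihilate_algebraMap, map_zero, AlgHom.commutes]
    exact (neg_eq_zero.2 (oddAnnihilate_algebraMap x r)).symm
  | add v w hv hw => rw [map_add, map_add, hv, hw, map_add, map_add, neg_add]
  | ι_mul v m hv =>
    have h1 : ∀ w : BC K ι, CliffordAlgebra.involute
        (Q := (0 : QuadraticForm K (Label ι →₀ K))) (ExteriorAlgebra.ι K m * w) =
        -(ExteriorAlgebra.ι K m * CliffordAlgebra.involute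
        (Q := (0 : QuadraticForm K (Label ι →₀ K))) w : BC K ι) := fun w => by
      rw [map_mul]
      refine (congrArg₂ _ (CliffordAlgebra.involute_ι _) rfl).trans ?_
      exact neg_mul _ _
    rw [h1, oddAnnihilate_ι_mul, map_sub, map_smul, h1, hv]
    refine Eq.trans ?_ (congrArg Neg.neg ((oddAnnihilate K x).map_neg _).symm)
    rw [oddAnnihilate_ι_mul]
    simp only [mul_neg, neg_neg]

/-- An element of the exterior algebra involves only finitely many generators, and the derivatives
with respect to the others vanish. -/
theorem finite_oddAnnihilate (v : BC K ι) :
    {x : Label ι | oddAnnihilate K x v ≠ 0}.Finite := by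
  induction v using bc_induction with
  | algebraMap r => simp [oddAnnihilate_algebraMap]
  | add v w hv hw =>
    refine (hv.union hw).subset fun x hx => ?_
    by_contra h
    simp only [Set.mem_union, Set.mem_ofPred_eq, not_or, not_not] at h
    exact hx (by rw [map_add, h.1, h.2, add_zero])
  | ι_mul v m hv =>
    refine (hv.union m.hasFiniteSupport).subset fun x hx => ?_
    by_contra h
    simp only [Set.mem_union, Set.mem_ofPred_eq, not_or, not_not, Function.mem_support] at h
    exact hx (by rw [oddAnnihilate_ι_mul, h.1, h.2, mul_zero, zero_smul, sub_zero])

end Odd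

section Even

theorem evenCreate_comm (x y : Label ι) : Commute (evenCreate K x) (evenCreate K y) := by
  refine LinearMap.ext fun v => ?_
  exact mul_left_comm (MvPolynomial.X x : MvPolynomial (Label ι) K) (MvPolynomial.X y) v

theorem evenAnnihilate_comm (x y : Label ι) :
    Commute (evenAnnihilate K x) (evenAnnihilate K y) := by
  classical
  have h : ⁅(MvPolynomial.pderiv x :
      Derivation K (MvPolynomial (Label ι) K) (MvPolynomial (Label ι) K)),
      (MvPolynomial.pderiv y :
      Derivation K (MvPolynomial (Label ι) K) (MvPolynomial (Label ι) K))⁆ = 0 := by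
    refine MvPolynomial.derivation_ext fun i => ?_
    rw [Derivation.commutator_apply]
    simp only [MvPolynomial.pderiv_X, Pi.single_apply]
    split_ifs <;> simp
  refine LinearMap.ext fun v => ?_
  have h' := DFunLike.congr_fun h v
  rw [Derivation.commutator_apply] at h'
  exact sub_eq_zero.1 h'

open Classical in
theorem evenAnnihilate_evenCreate (x y : Label ι) :
    evenAnnihilate K x * evenCreate K y - evenCreate K y * evenAnnihilate K x =
      if x = y then 1 else 0 := by
  refine LinearMap.ext fun v => ?_
  change MvPolynomial.pderiv x (MvPolynomial.X y * v) -
    MvPolynomial.X y * MvPolynomial.pderiv x v = _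
  rw [MvPolynomial.pderiv_mul, MvPolynomial.pderiv_X, add_sub_cancel_right, Pi.single_apply]
  by_cases h : x = y
  · simp [h]
  · simp [h, Ne.symm h]

theorem finite_evenAnnihilate (v : BetaGamma K ι) :
    {x : Label ι | evenAnnihilate K x v ≠ 0}.Finite :=
  v.vars.finite_toSet.subset fun x hx => by
    by_contra h
    exact hx (MvPolynomial.pderiv_eq_zero_of_notMem_vars h)

end Even

section WeilMap

variable (f f' : Module.End K (BC K ι)) (g g' : Module.End K (BetaGamma K ι))

theorem Weil.map_mul : Weil.map f g * Weil.map f' g' = Weil.map (f * f') (g * g') :=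
  (TensorProduct.map_mul f f' g g').symm

theorem Weil.map_one :
    Weil.map (1 : Module.End K (BC K ι)) (1 : Module.End K (BetaGamma K ι)) = 1 :=
  TensorProduct.map_one

theorem Weil.map_add_left : Weil.map (f + f') g = Weil.map f g + Weil.map f' g :=
  TensorProduct.map_add_left f f' g

theorem Weil.map_add_right : Weil.map f (g + g') = Weil.map f g + Weil.map f g' :=
  TensorProduct.map_add_right f g g'

theorem Weil.map_zero_left : Weil.map (0 : Module.End K (BC K ι)) g = 0 :=
  TensorProduct.map_zero_left g

theorem Weil.map_zero_right : Weil.map f (0 : Module.End K (BetaGamma K ι)) = 0 :=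
  TensorProduct.map_zero_right f

theorem Weil.map_neg_left : Weil.map (-f) g = -Weil.map f g := by
  rw [eq_neg_iff_add_eq_zero, ← Weil.map_add_left, neg_add_cancel, Weil.map_zero_left]

theorem Weil.map_neg_right : Weil.map f (-g) = -Weil.map f g := by
  rw [eq_neg_iff_add_eq_zero, ← Weil.map_add_right, neg_add_cancel, Weil.map_zero_right]

theorem Weil.induction {P : Weil K ι → Prop} (tmul : ∀ (v : BC K ι) (w : BetaGamma K ι),
    P (v ⊗ₜ[K] w : BC K ι ⊗[K] BetaGamma K ι)) (add : ∀ v w, P v → P w → P (v + w))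
    (zero : P 0) (v : Weil K ι) : P v :=
  TensorProduct.induction_on (motive := P) v zero tmul add

theorem Weil.finite_map {J : Type*} {f : J → Module.End K (BC K ι)}
    {g : J → Module.End K (BetaGamma K ι)}
    (h : ∀ (v : BC K ι) (w : BetaGamma K ι), {x | ¬ (f x v = 0 ∨ g x w = 0)}.Finite) :
    LocFin fun x => Weil.map (f x) (g x) := fun v => by
  induction v using Weil.induction with
  | zero => simp
  | add v w hv hw =>
    refine (hv.union hw).subset fun x hx => ?_
    by_contra h
    simp only [Set.mem_union, Function.mem_support, not_or, not_not] at h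
    exact hx (by simp only [map_add, h.1, h.2, add_zero])
  | tmul v w =>
    refine (h v w).subset fun x hx => ?_
    rintro (h0 | h0)
    · exact hx ((congrArg (· ⊗ₜ[K] g x w) h0).trans (TensorProduct.zero_tmul _ _))
    · exact hx ((congrArg (f x v ⊗ₜ[K] ·) h0).trans (TensorProduct.tmul_zero _ _))

end WeilMap

section Modes

theorem weilParity_mul_self : weilParity K ι * weilParity K ι = 1 := by
  rw [weilParity, Weil.map_mul, ← Weil.map_one]
  congr 1
  exact LinearMap.ext fun v => CliffordAlgebra.involute_involute v

/-- An operator of the form `f ⊗ 1` on the semi-infinite Weil algebra. -/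
abbrev oddOp (f : Module.End K (BC K ι)) : Module.End K (Weil K ι) := Weil.map f 1

/-- An operator of the form `1 ⊗ g` on the semi-infinite Weil algebra. -/
abbrev evenOp (g : Module.End K (BetaGamma K ι)) : Module.End K (Weil K ι) := Weil.map 1 g

theorem oddOp_anticomm {f f' : Module.End K (BC K ι)} (h : f * f' + f' * f = 0) :
    oddOp f * oddOp f' + oddOp f' * oddOp f = 0 := by
  rw [Weil.map_mul, Weil.map_mul, mul_one, ← Weil.map_add_left, h, Weil.map_zero_left]

theorem evenOp_comm {g g' : Module.End K (BetaGamma K ι)} (h : Commute g g') :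
    Commute (evenOp g : Module.End K (Weil K ι)) (evenOp g') := by
  unfold Commute SemiconjBy
  rw [Weil.map_mul, Weil.map_mul, h.eq]

theorem oddOp_evenOp_comm (f : Module.End K (BC K ι)) (g : Module.End K (BetaGamma K ι)) :
    Commute (oddOp f) (evenOp g) := by
  unfold Commute SemiconjBy
  rw [Weil.map_mul, Weil.map_mul, mul_one, mul_one, one_mul, one_mul]

theorem bBasis_eq (i : ι) (m : ℤ) : ∃ f, bBasis K i m = oddOp f := by
  cases m <;> exact ⟨_, rfl⟩

theorem cBasis_eq (i : ι) (m : ℤ) : ∃ f, cBasis K i m = oddOp f := by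
  cases m <;> exact ⟨_, rfl⟩

theorem betaBasis_eq (i : ι) (m : ℤ) : ∃ f, betaBasis K i m = evenOp f := by
  cases m <;> exact ⟨_, rfl⟩

theorem gammaBasis_eq (i : ι) (m : ℤ) : ∃ f, gammaBasis K i m = evenOp f := by
  cases m
  · exact ⟨_, (Weil.map_neg_right _ _).symm⟩
  · exact ⟨_, rfl⟩

theorem bBasis_betaBasis_comm (i j : ι) (m n : ℤ) :
    Commute (bBasis K i m) (betaBasis K j n) := by
  obtain ⟨f, hf⟩ := bBasis_eq (K := K) i m
  obtain ⟨g, hg⟩ := betaBasis_eq (K := K) j n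
  rw [hf, hg]; exact oddOp_evenOp_comm f g

theorem bBasis_gammaBasis_comm (i j : ι) (m n : ℤ) :
    Commute (bBasis K i m) (gammaBasis K j n) := by
  obtain ⟨f, hf⟩ := bBasis_eq (K := K) i m
  obtain ⟨g, hg⟩ := gammaBasis_eq (K := K) j n
  rw [hf, hg]; exact oddOp_evenOp_comm f g

theorem cBasis_betaBasis_comm (i j : ι) (m n : ℤ) :
    Commute (cBasis K i m) (betaBasis K j n) := by
  obtain ⟨f, hf⟩ := cBasis_eq (K := K) i m
  obtain ⟨g, hg⟩ := betaBasis_eq (K := K) j n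
  rw [hf, hg]; exact oddOp_evenOp_comm f g

theorem cBasis_gammaBasis_comm (i j : ι) (m n : ℤ) :
    Commute (cBasis K i m) (gammaBasis K j n) := by
  obtain ⟨f, hf⟩ := cBasis_eq (K := K) i m
  obtain ⟨g, hg⟩ := gammaBasis_eq (K := K) j n
  rw [hf, hg]; exact oddOp_evenOp_comm f g

theorem oddAnnihilate_oddCreate_ne {x y : Label ι} (h : x ≠ y) :
    oddAnnihilate K x * oddCreate K y + oddCreate K y * oddAnnihilate K x = 0 := by
  classical
  rw [oddAnnihilate_oddCreate, if_neg h]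

theorem oddCreate_oddAnnihilate_ne {x y : Label ι} (h : x ≠ y) :
    oddCreate K y * oddAnnihilate K x + oddAnnihilate K x * oddCreate K y = 0 := by
  rw [add_comm, oddAnnihilate_oddCreate_ne h]

theorem evenAnnihilate_evenCreate_ne {x y : Label ι} (h : x ≠ y) :
    Commute (evenAnnihilate K x) (evenCreate K y) := by
  classical
  exact sub_eq_zero.1 (by rw [evenAnnihilate_evenCreate, if_neg h])

theorem bBasis_anticomm (i j : ι) (m n : ℤ) :
    bBasis K i m * bBasis K j n + bBasis K j n * bBasis K i m = 0 := by
  cases m <;> cases n <;> refine oddOp_anticomm ?_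
  · exact oddAnnihilate_anticomm _ _
  · exact oddAnnihilate_oddCreate_ne (by simp)
  · exact oddCreate_oddAnnihilate_ne (by simp)
  · exact oddCreate_anticomm _ _

theorem cBasis_anticomm (i j : ι) (m n : ℤ) :
    cBasis K i m * cBasis K j n + cBasis K j n * cBasis K i m = 0 := by
  cases m <;> cases n <;> refine oddOp_anticomm ?_
  · exact oddAnnihilate_anticomm _ _
  · exact oddAnnihilate_oddCreate_ne (by simp)
  · exact oddCreate_oddAnnihilate_ne (by simp)
  · exact oddCreate_anticomm _ _

theorem gammaBasis_comm (i j : ι) (m n : ℤ) :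
    Commute (gammaBasis K i m) (gammaBasis K j n) := by
  cases m <;> cases n
  · exact Commute.neg_right (Commute.neg_left (evenOp_comm (evenAnnihilate_comm _ _)))
  · exact Commute.neg_left (evenOp_comm (evenAnnihilate_evenCreate_ne (by simp)))
  · exact Commute.neg_right (evenOp_comm (evenAnnihilate_evenCreate_ne (by simp)).symm)
  · exact evenOp_comm (evenCreate_comm _ _)

theorem betaBasis_comm (i j : ι) (m n : ℤ) :
    Commute (betaBasis K i m) (betaBasis K j n) := by
  cases m <;> cases n
  · exact evenOp_comm (evenAnnihilate_comm _ _)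
  · exact evenOp_comm (evenAnnihilate_evenCreate_ne (by simp))
  · exact evenOp_comm (evenAnnihilate_evenCreate_ne (by simp)).symm
  · exact evenOp_comm (evenCreate_comm _ _)

open Classical in
theorem bBasis_cBasis (i j : ι) (m n : ℤ) :
    bBasis K i m * cBasis K j n + cBasis K j n * bBasis K i m =
      if i = j ∧ m + n = -1 then 1 else 0 := by
  cases m with
  | ofNat m =>
    cases n with
    | ofNat n =>
      rw [if_neg (by simp only [Int.ofNat_eq_natCast]; omega)]
      exact oddOp_anticomm (oddAnnihilate_anticomm _ _)
    | negSucc n =>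
      change oddOp (oddAnnihilate K _) * oddOp (oddCreate K _) +
        oddOp (oddCreate K _) * oddOp (oddAnnihilate K _) = _
      rw [Weil.map_mul, Weil.map_mul, mul_one, ← Weil.map_add_left, oddAnnihilate_oddCreate]
      have : (Sum.inr (i, m) = (Sum.inr (j, n) : Label ι)) ↔
          i = j ∧ Int.ofNat m + Int.negSucc n = -1 := by
        simp only [Sum.inr.injEq, Prod.mk.injEq, Int.ofNat_eq_natCast, Int.negSucc_eq]
        exact and_congr_right fun _ => by omega
      simp only [this]
      split_ifs
      · exact Weil.map_one
      · exact Weil.map_zero_left _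
  | negSucc m =>
    cases n with
    | ofNat n =>
      change oddOp (oddCreate K _) * oddOp (oddAnnihilate K _) +
        oddOp (oddAnnihilate K _) * oddOp (oddCreate K _) = _
      rw [Weil.map_mul, Weil.map_mul, mul_one, ← Weil.map_add_left, add_comm,
        oddAnnihilate_oddCreate]
      have : (Sum.inl (j, n) = (Sum.inl (i, m) : Label ι)) ↔
          i = j ∧ Int.negSucc m + Int.ofNat n = -1 := by
        simp only [Sum.inl.injEq, Prod.mk.injEq, Int.ofNat_eq_natCast, Int.negSucc_eq]
        rw [eq_comm (a := j)]
        exact and_congr_right fun _ => by omega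
      simp only [this]
      split_ifs
      · exact Weil.map_one
      · exact Weil.map_zero_left _
    | negSucc n =>
      rw [if_neg (by omega)]
      exact oddOp_anticomm (oddCreate_anticomm _ _)

open Classical in
theorem betaBasis_gammaBasis (i j : ι) (m n : ℤ) :
    betaBasis K i m * gammaBasis K j n - gammaBasis K j n * betaBasis K i m =
      if i = j ∧ m + n = -1 then 1 else 0 := by
  cases m with
  | ofNat m =>
    cases n with
    | ofNat n =>
      rw [if_neg (by simp only [Int.ofNat_eq_natCast]; omega), sub_eq_zero]
      exact (evenOp_comm (evenAnnihilate_comm _ _)).neg_right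
    | negSucc n =>
      change evenOp (evenAnnihilate K _) * evenOp (evenCreate K _) -
        evenOp (evenCreate K _) * evenOp (evenAnnihilate K _) = _
      rw [Weil.map_mul, Weil.map_mul, mul_one, sub_eq_add_neg, ← Weil.map_neg_right,
        ← Weil.map_add_right, ← sub_eq_add_neg, evenAnnihilate_evenCreate]
      have : (Sum.inr (i, m) = (Sum.inr (j, n) : Label ι)) ↔
          i = j ∧ Int.ofNat m + Int.negSucc n = -1 := by
        simp only [Sum.inr.injEq, Prod.mk.injEq, Int.ofNat_eq_natCast, Int.negSucc_eq]
        exact and_congr_right fun _ => by omega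
      simp only [this]
      split_ifs
      · exact Weil.map_one
      · exact Weil.map_zero_right _
  | negSucc m =>
    cases n with
    | ofNat n =>
      change evenOp (evenCreate K _) * -evenOp (evenAnnihilate K _) -
        -evenOp (evenAnnihilate K _) * evenOp (evenCreate K _) = _
      rw [mul_neg, neg_mul, sub_neg_eq_add, neg_add_eq_sub,
        Weil.map_mul, Weil.map_mul, mul_one, sub_eq_add_neg, ← Weil.map_neg_right,
        ← Weil.map_add_right, ← sub_eq_add_neg, evenAnnihilate_evenCreate]
      have : (Sum.inl (j, n) = (Sum.inl (i, m) : Label ι)) ↔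
          i = j ∧ Int.negSucc m + Int.ofNat n = -1 := by
        simp only [Sum.inl.injEq, Prod.mk.injEq, Int.ofNat_eq_natCast, Int.negSucc_eq]
        rw [eq_comm (a := j)]
        exact and_congr_right fun _ => by omega
      simp only [this]
      split_ifs
      · exact Weil.map_one
      · exact Weil.map_zero_right _
    | negSucc n =>
      rw [if_neg (by omega), sub_eq_zero]
      exact evenOp_comm (evenCreate_comm _ _)

theorem weilParity_oddOp {f : Module.End K (BC K ι)}
    (h : ∀ v, CliffordAlgebra.involute (Q := (0 : QuadraticForm K (Label ι →₀ K))) (f v) =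
      -f (CliffordAlgebra.involute (Q := (0 : QuadraticForm K (Label ι →₀ K))) v)) :
    weilParity K ι * oddOp f = -(oddOp f * weilParity K ι) := by
  rw [weilParity, Weil.map_mul, Weil.map_mul, ← Weil.map_neg_left]
  congr 1
  exact LinearMap.ext h

theorem weilParity_cBasis (i : ι) (m : ℤ) :
    weilParity K ι * cBasis K i m = -(cBasis K i m * weilParity K ι) := by
  cases m
  · exact weilParity_oddOp (involute_oddAnnihilate _)
  · exact weilParity_oddOp (involute_oddCreate _)

theorem weilParity_gammaBasis (i : ι) (m : ℤ) :
    Commute (weilParity K ι) (gammaBasis K i m) := by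
  obtain ⟨g, hg⟩ := gammaBasis_eq (K := K) i m
  rw [hg]
  exact oddOp_evenOp_comm _ g

theorem weilParity_vac : weilParity K ι (vac K ι) = vac K ι := by
  have : CliffordAlgebra.involute (Q := (0 : QuadraticForm K (Label ι →₀ K))) 1 = 1 := map_one _
  exact congrArg (· ⊗ₜ[K] (1 : BetaGamma K ι)) this

theorem bBasis_vac (i : ι) (n : ℕ) : bBasis K i n (vac K ι) = 0 := by
  have : oddAnnihilate K (Sum.inr (i, n)) (1 : BC K ι) = 0 :=
    CliffordAlgebra.contractLeft_one (0 : QuadraticForm K (Label ι →₀ K)) _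
  exact (congrArg (· ⊗ₜ[K] (1 : BetaGamma K ι)) this).trans (TensorProduct.zero_tmul _ _)

theorem cBasis_vac (i : ι) (n : ℕ) : cBasis K i n (vac K ι) = 0 := by
  have : oddAnnihilate K (Sum.inl (i, n)) (1 : BC K ι) = 0 :=
    CliffordAlgebra.contractLeft_one (0 : QuadraticForm K (Label ι →₀ K)) _
  exact (congrArg (· ⊗ₜ[K] (1 : BetaGamma K ι)) this).trans (TensorProduct.zero_tmul _ _)

theorem betaBasis_vac (i : ι) (n : ℕ) : betaBasis K i n (vac K ι) = 0 := by
  have : evenAnnihilate K (Sum.inr (i, n)) (1 : BetaGamma K ι) = 0 := MvPolynomial.pderiv_one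
  exact (congrArg ((1 : BC K ι) ⊗ₜ[K] ·) this).trans (TensorProduct.tmul_zero _ _)

theorem gammaBasis_vac (i : ι) (n : ℕ) : gammaBasis K i n (vac K ι) = 0 := by
  have : evenAnnihilate K (Sum.inl (i, n)) (1 : BetaGamma K ι) = 0 := MvPolynomial.pderiv_one
  exact neg_eq_zero.2
    ((congrArg ((1 : BC K ι) ⊗ₜ[K] ·) this).trans (TensorProduct.tmul_zero _ _))

variable (K ι)

theorem locFin_bBasis : LocFin fun x : ι × ℕ => bBasis K x.1 x.2 :=
  Weil.finite_map fun v _ => ((finite_oddAnnihilate v).preimage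
    (f := fun x : ι × ℕ => (Sum.inr x : Label ι)) Sum.inr_injective.injOn).subset
      fun _ hx hx' => hx (Or.inl hx')

theorem locFin_cBasis : LocFin fun x : ι × ℕ => cBasis K x.1 x.2 :=
  Weil.finite_map fun v _ => ((finite_oddAnnihilate v).preimage
    (f := fun x : ι × ℕ => (Sum.inl x : Label ι)) Sum.inl_injective.injOn).subset
      fun _ hx hx' => hx (Or.inl hx')

theorem locFin_betaBasis : LocFin fun x : ι × ℕ => betaBasis K x.1 x.2 :=
  Weil.finite_map fun _ w => ((finite_evenAnnihilate w).preimage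
    (f := fun x : ι × ℕ => (Sum.inr x : Label ι)) Sum.inr_injective.injOn).subset
      fun _ hx hx' => hx (Or.inr hx')

theorem locFin_gammaBasis : LocFin fun x : ι × ℕ => gammaBasis K x.1 x.2 :=
  (Weil.finite_map fun _ w => ((finite_evenAnnihilate w).preimage
    (f := fun x : ι × ℕ => (Sum.inl x : Label ι)) Sum.inl_injective.injOn).subset
      fun _ hx hx' => hx (Or.inr hx')).neg

end Modes

end FockRelations

/-! ### Fields and the subspaces of states they generate -/

section FieldStates

variable {K V : Type*} [Field K] [AddCommGroup V] [Module K V]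

/-- A formal distribution is a field if every vector is killed by its modes of large index. -/
def IsFld (A : Modes K V) : Prop := ∀ v, ∃ N : ℤ, ∀ n ≥ N, A n v = 0

theorem nthProd_locFin {A B : Modes K V} (hA : IsFld A) (hB : IsFld B) (s t : ZMod 2) (n m : ℤ) :
    LocFin fun j : ℕ => ((-1 : ℤ) ^ j * Ring.choose n j) •
      (A (n - j) * B (m + j) -
        (koszul s t * ((n.negOnePow : ℤˣ) : ℤ)) • (B (m + n - j) * A j)) := fun v => by
  obtain ⟨N, hN⟩ := hA v
  obtain ⟨N', hN'⟩ := hB v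
  refine (Finset.range (max N.toNat (N' - m).toNat)).finite_toSet.subset fun j hj => ?_
  by_contra h
  simp only [Finset.coe_range, Set.mem_Iio, not_lt, max_le_iff, Int.toNat_le] at h
  have h1 : A j v = 0 := hN _ h.1
  have h2 : B (m + j) v = 0 := hN' _ (by omega)
  exact hj (by simp [h1, h2])

theorem nthProd_mem {p : Submodule K V} {A B : Modes K V} (hA : ∀ m, ∀ v ∈ p, A m v ∈ p)
    (hB : ∀ m, ∀ v ∈ p, B m v ∈ p) (s t : ZMod 2) (n m : ℤ) {v : V} (hv : v ∈ p) :
    nthProd s t n A B m v ∈ p := by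
  refine locSum_mem fun j => ?_
  rw [LinearMap.smul_apply, LinearMap.sub_apply, LinearMap.smul_apply]
  exact zsmul_mem (sub_mem (hA _ _ (hB _ _ hv)) (zsmul_mem (hB _ _ (hA _ _ hv)) _)) _

theorem nthProd_isFld {A B : Modes K V} (hA : IsFld A) (hB : IsFld B) (s t : ZMod 2) (n : ℤ) :
    IsFld (nthProd s t n A B) := fun v => by
  obtain ⟨N, hN⟩ := hA v
  obtain ⟨N', hN'⟩ := hB v
  choose M hM using fun w => hB w
  refine ⟨max N' (∑ j ∈ Finset.range N.toNat, |M (A j v)| + N.natAbs - n), fun m hm => ?_⟩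
  refine locSum_apply_eq_zero fun j => ?_
  have h2 : B (m + j) v = 0 := hN' _ (by have := le_trans (le_max_left _ _) hm; omega)
  have h3 : B (m + n - j) (A j v) = 0 := by
    by_cases hj : N ≤ j
    · rw [hN j hj, map_zero]
    · have hj' : j ∈ Finset.range N.toNat := by simp; omega
      have h4 := Finset.single_le_sum (f := fun j : ℕ => |M (A j v)|) (fun i _ => abs_nonneg _) hj'
      have h5 := le_trans (le_max_right _ _) hm
      have h6 := le_abs_self (M (A j v))
      refine hM _ _ ?_
      omega
  simp [h2, h3]

theorem nthProd_apply_vac {A B : Modes K V} {v : V} (hA : ∀ n : ℕ, A n v = 0)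
    (hB : ∀ n : ℕ, B n v = 0) (s t : ZMod 2) (n : ℤ) (m : ℕ) : nthProd s t n A B m v = 0 := by
  refine locSum_apply_eq_zero fun j => ?_
  have h : B (m + j) v = 0 := by exact_mod_cast hB (m + j)
  simp [h, hA]

/-- Acting with a mode `A₍ₙ₎`, `n < 0`, on the state of a field `B` gives the state of `A₍ₙ₎B`. -/
theorem nthProd_state {A B : Modes K V} (hA : IsFld A) (hB : IsFld B) {v : V}
    (hAv : ∀ n : ℕ, A n v = 0) (hBv : ∀ n : ℕ, B n v = 0) (s t : ZMod 2) (n : ℤ) :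
    nthProd s t n A B (-1) v = A n (B (-1) v) := by
  rw [nthProd, locSum_apply_eq_sum (nthProd_locFin hA hB s t n (-1)) (s := {0})]
  · have h : A 0 v = 0 := by exact_mod_cast hAv 0
    simp [h]
  · intro j hj
    have h : B (-1 + j) v = 0 := by
      obtain ⟨k, rfl⟩ := Nat.exists_eq_succ_of_ne_zero (by simpa using hj)
      have := hBv k
      push_cast
      rwa [show (-1 : ℤ) + (k + 1) = k by ring]
    simp [h, hAv]

theorem neg_one_pow_mul_choose (j : ℕ) : (-1 : ℤ) ^ j * Ring.choose (-1 : ℤ) j = 1 := by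
  rw [Ring.choose_neg, show (1 : ℤ) + j - 1 = (j : ℤ) by ring, Ring.choose_natCast,
    Nat.choose_self]
  rcases Nat.even_or_odd j with h | h <;> simp [Units.smul_def, Int.negOnePow_even,
    Int.negOnePow_odd, h]

theorem nthProd_neg_one (s t : ZMod 2) (A B : Modes K V) (m : ℤ) :
    nthProd s t (-1) A B m = locSum fun j : ℕ =>
      A (-j - 1) * B (m + j) + koszul s t • (B (m - j - 1) * A j) := by
  unfold nthProd
  congr 1
  funext j
  rw [neg_one_pow_mul_choose, one_smul, show (-1 : ℤ) - j = -j - 1 by ring,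
    show m + -1 - (j : ℤ) = m - j - 1 by ring]
  simp

variable {S : ZMod 2 → Set (Modes K V)}

/-- A subspace stable under the modes of the generators is stable under the modes of all fields
they generate. -/
theorem Generated.mode_mem {p : Submodule K V}
    (hS : ∀ s, ∀ A ∈ S s, ∀ m, ∀ v ∈ p, A m v ∈ p) {s : ZMod 2} {A : Modes K V}
    (hA : Generated S s A) : ∀ m, ∀ v ∈ p, A m v ∈ p := by
  induction hA with
  | vac =>
    intro m v hv
    unfold idField
    split_ifs
    · exact hv
    · exact p.zero_mem
  | gen h => exact hS _ _ h
  | add _ _ hA hB => exact fun m v hv => p.add_mem (hA m v hv) (hB m v hv)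
  | zero => exact fun m v _ => p.zero_mem
  | smul a _ hA => exact fun m v hv => p.smul_mem a (hA m v hv)
  | prod n _ _ hA hB => exact fun m v hv => nthProd_mem hA hB _ _ n m hv

theorem Generated.isFld (hS : ∀ s, ∀ A ∈ S s, IsFld A) {s : ZMod 2} {A : Modes K V}
    (hA : Generated S s A) : IsFld A := by
  induction hA with
  | vac => exact fun v => ⟨0, fun n hn => by rw [idField, if_neg (by omega)]; rfl⟩
  | gen h => exact hS _ _ h
  | add _ _ hA hB =>
    intro v
    obtain ⟨N, hN⟩ := hA v
    obtain ⟨N', hN'⟩ := hB v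
    refine ⟨max N N', fun n hn => ?_⟩
    rw [Pi.add_apply, LinearMap.add_apply, hN n (le_trans (le_max_left _ _) hn),
      hN' n (le_trans (le_max_right _ _) hn), add_zero]
  | zero => exact fun v => ⟨0, fun n _ => rfl⟩
  | smul a _ hA =>
    intro v
    obtain ⟨N, hN⟩ := hA v
    exact ⟨N, fun n hn => by rw [Pi.smul_apply, LinearMap.smul_apply, hN n hn, smul_zero]⟩
  | prod n _ _ hA hB => exact nthProd_isFld hA hB _ _ n

theorem Generated.apply_vac {v : V} (hS : ∀ s, ∀ A ∈ S s, ∀ n : ℕ, A n v = 0) {s : ZMod 2}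
    {A : Modes K V} (hA : Generated S s A) : ∀ n : ℕ, A n v = 0 := by
  induction hA with
  | vac => exact fun n => by rw [idField, if_neg (by omega)]; rfl
  | gen h => exact hS _ _ h
  | add _ _ hA hB => exact fun n => by rw [Pi.add_apply, LinearMap.add_apply, hA, hB, add_zero]
  | zero => exact fun n => rfl
  | smul a _ hA => exact fun n => by rw [Pi.smul_apply, LinearMap.smul_apply, hA, smul_zero]
  | prod n _ _ hA hB => exact fun m => nthProd_apply_vac hA hB _ _ n m

theorem states_le {p : Submodule K V} {v : V} (hv : v ∈ p)
    (hS : ∀ s, ∀ A ∈ S s, ∀ m, ∀ w ∈ p, A m w ∈ p) : states v S ≤ p := by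
  refine iSup_le fun s => ?_
  rintro _ ⟨A, hA, rfl⟩
  exact Generated.mode_mem hS hA _ _ hv

theorem vac_mem_states (v : V) : v ∈ states v S :=
  Submodule.mem_iSup_of_mem 0 ⟨idField, Generated.vac, rfl⟩

theorem mode_mem_states {v : V} (hS : ∀ s, ∀ A ∈ S s, IsFld A ∧ ∀ n : ℕ, A n v = 0) {s : ZMod 2}
    {A : Modes K V} (hA : A ∈ S s) (n : ℤ) {w : V} (hw : w ∈ states v S) :
    A n w ∈ states v S := by
  have h : states v S ≤ (states v S).comap (A n) := by
    refine iSup_le fun t => ?_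
    rintro _ ⟨B, hB, rfl⟩
    refine Submodule.mem_iSup_of_mem (s + t)
      ⟨nthProd s t n A B, Generated.prod n (Generated.gen hA) hB, ?_⟩
    exact nthProd_state (hS s A hA).1 (Generated.isFld (fun s A hA => (hS s A hA).1) hB)
      (hS s A hA).2 (Generated.apply_vac (fun s A hA => (hS s A hA).2) hB) s t n
  exact h hw

end FieldStates

/-! ### Filtrations by the number of creation operators -/

section Filtration

variable {K V : Type*} [Field K] [AddCommGroup V] [Module K V]

/-- The span of all vectors obtained from a subspace `F` by applying at most `k` operators
of the set `ops`. -/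
def filt (F : Submodule K V) (ops : Set (Module.End K V)) : ℕ → Submodule K V
  | 0 => F
  | k + 1 => filt F ops k ⊔ ⨆ T ∈ ops, (filt F ops k).map T

variable {F : Submodule K V} {ops : Set (Module.End K V)}

theorem filt_le_succ (k : ℕ) : filt F ops k ≤ filt F ops (k + 1) := le_sup_left

theorem op_mem_filt {T : Module.End K V} (hT : T ∈ ops) {k : ℕ} {v : V} (hv : v ∈ filt F ops k) :
    T v ∈ filt F ops (k + 1) :=
  Submodule.mem_sup_right (Submodule.mem_iSup_of_mem T (Submodule.mem_iSup_of_mem hT ⟨v, hv, rfl⟩))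

theorem filt_succ_le {q : Submodule K V} {k : ℕ} (h : filt F ops k ≤ q)
    (hT : ∀ T ∈ ops, ∀ v ∈ filt F ops k, T v ∈ q) : filt F ops (k + 1) ≤ q := by
  refine sup_le h (iSup₂_le fun T hT' => ?_)
  rintro _ ⟨v, hv, rfl⟩
  exact hT T hT' v hv

theorem filt_mono : Monotone (filt F ops) := monotone_nat_of_le_succ filt_le_succ

theorem mem_iSup_filt {v : V} : v ∈ ⨆ k, filt F ops k ↔ ∃ k, v ∈ filt F ops k :=
  Submodule.mem_iSup_of_directed _ filt_mono.directed_le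

theorem op_mem_iSup_filt {T : Module.End K V} (hT : T ∈ ops) {v : V}
    (hv : v ∈ ⨆ k, filt F ops k) : T v ∈ ⨆ k, filt F ops k := by
  obtain ⟨k, hk⟩ := mem_iSup_filt.1 hv
  exact mem_iSup_filt.2 ⟨k + 1, op_mem_filt hT hk⟩

theorem iSup_filt_le {q : Submodule K V} (hF : F ≤ q) (hT : ∀ T ∈ ops, ∀ v ∈ q, T v ∈ q) :
    ⨆ k, filt F ops k ≤ q := by
  refine iSup_le fun k => ?_
  induction k with
  | zero => exact hF
  | succ k ih => exact filt_succ_le ih fun T hT' v hv => hT T hT' v (ih hv)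

/-- If `N` kills `F` and satisfies `[N, T] = T` for the operators `T` in `ops`, then
`N` acts as the number `k + 1` on the piece of index `k + 1` of the filtration, modulo the piece
of index `k`. -/
theorem number_filt {N : Module.End K V} (hF : ∀ v ∈ F, N v = 0)
    (hN : ∀ T ∈ ops, N * T = T * N + T) (k : ℕ) :
    ∀ v ∈ filt F ops (k + 1), N v - (k + 1 : K) • v ∈ filt F ops k := by
  have hN' : ∀ T ∈ ops, ∀ v, N (T v) = T (N v) + T v := fun T hT v =>
    LinearMap.congr_fun (hN T hT) v
  induction k with
  | zero =>
    have h : filt F ops 1 ≤ F.comap (N - (1 : K) • 1) := filt_succ_le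
      (fun v hv => by simpa [hF v hv] using (show v ∈ F from hv))
      (fun T hT v hv => by simp [hN' T hT, hF v hv])
    intro v hv
    change _ ∈ F
    simpa using h hv
  | succ k ih =>
    have h : filt F ops (k + 2) ≤ (filt F ops (k + 1)).comap (N - (k + 2 : K) • 1) := by
      refine filt_succ_le (fun v hv => ?_) (fun T hT v hv => ?_)
      · have h1 := sub_mem (filt_le_succ k (ih v hv)) hv
        refine (congrArg (· ∈ filt F ops (k + 1)) ?_).mpr h1
        simp only [LinearMap.sub_apply, LinearMap.smul_apply, Module.End.one_apply]
        module
      · have h1 := op_mem_filt hT (ih v hv)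
        refine (congrArg (· ∈ filt F ops (k + 1)) ?_).mpr h1
        simp only [LinearMap.sub_apply, LinearMap.smul_apply, Module.End.one_apply, hN' T hT,
          map_sub, map_smul]
        module
    intro v hv
    refine (congrArg (· ∈ filt F ops (k + 1)) ?_).mpr (h hv)
    simp only [LinearMap.sub_apply, LinearMap.smul_apply, Module.End.one_apply]
    push_cast
    module

/-- An operator which kills `F` and whose (super)commutators with the operators in `ops` are
scalars lowers the filtration. -/
theorem lower_filt {T : Module.End K V} (hF : ∀ v ∈ F, T v = 0)
    (h : ∀ S ∈ ops, ∃ ε a : K, T * S = ε • (S * T) + a • 1) (k : ℕ) :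
    ∀ v ∈ filt F ops (k + 1), T v ∈ filt F ops k := by
  induction k with
  | zero =>
    have h' : filt F ops 1 ≤ F.comap T := filt_succ_le
      (fun v hv => by simp [hF v hv])
      (fun S hS v hv => by
        obtain ⟨ε, a, hS'⟩ := h S hS
        have := LinearMap.congr_fun hS' v
        simp only [Module.End.mul_apply, LinearMap.add_apply, LinearMap.smul_apply, hF v hv,
          map_zero, smul_zero, zero_add] at this
        rw [Submodule.mem_comap, this]
        exact F.smul_mem a hv)
    exact fun v hv => h' hv
  | succ k ih =>
    have h' : filt F ops (k + 2) ≤ (filt F ops (k + 1)).comap T := filt_succ_le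
      (fun v hv => filt_le_succ k (ih v hv))
      (fun S hS v hv => by
        obtain ⟨ε, a, hS'⟩ := h S hS
        have := LinearMap.congr_fun hS' v
        simp only [Module.End.mul_apply, LinearMap.add_apply, LinearMap.smul_apply] at this
        rw [Submodule.mem_comap, this]
        exact add_mem (Submodule.smul_mem _ ε (op_mem_filt hS (ih v hv)))
          (Submodule.smul_mem _ a hv))
    exact fun v hv => h' hv

/-- A vector of `⨆ k, filt F ops k` killed by the number operator lies in `F`. -/
theorem mem_of_number_eq_zero [CharZero K] {N : Module.End K V} (hF : ∀ v ∈ F, N v = 0)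
    (hN : ∀ T ∈ ops, N * T = T * N + T) {v : V} (hv : v ∈ ⨆ k, filt F ops k) (h0 : N v = 0) :
    v ∈ F := by
  obtain ⟨k, hk⟩ := mem_iSup_filt.1 hv
  induction k with
  | zero => exact hk
  | succ k ih =>
    refine ih ?_
    have h := number_filt hF hN k v hk
    rw [h0, zero_sub, neg_mem_iff] at h
    exact (Submodule.smul_mem_iff _ (Nat.cast_add_one_ne_zero k)).1 h

end Filtration

/-! ### The subspaces `⟨γ⟩` and `⟨c, γ⟩` of the semi-infinite Weil algebra -/

section WeilModes

variable (K : Type*) {ι : Type*} [Field K]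

/-- The creation mode `b^{ξᵢ}₍₋ₙ₋₁₎`, for `x = (i, n)`. -/
abbrev bMinus (x : ι × ℕ) : Module.End K (Weil K ι) := bBasis K x.1 (-x.2 - 1)

/-- The creation mode `c^{ξᵢ*}₍₋ₙ₋₁₎`, for `x = (i, n)`. -/
abbrev cMinus (x : ι × ℕ) : Module.End K (Weil K ι) := cBasis K x.1 (-x.2 - 1)

/-- The creation mode `β^{ξᵢ}₍₋ₙ₋₁₎`, for `x = (i, n)`. -/
abbrev betaMinus (x : ι × ℕ) : Module.End K (Weil K ι) := betaBasis K x.1 (-x.2 - 1)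

/-- The creation mode `γ^{ξᵢ*}₍₋ₙ₋₁₎`, for `x = (i, n)`. -/
abbrev gammaMinus (x : ι × ℕ) : Module.End K (Weil K ι) := gammaBasis K x.1 (-x.2 - 1)

/-- The annihilation mode `b^{ξᵢ}₍ₙ₎`, for `x = (i, n)`. -/
abbrev bPlus (x : ι × ℕ) : Module.End K (Weil K ι) := bBasis K x.1 x.2

/-- The annihilation mode `c^{ξᵢ*}₍ₙ₎`, for `x = (i, n)`. -/
abbrev cPlus (x : ι × ℕ) : Module.End K (Weil K ι) := cBasis K x.1 x.2

/-- The annihilation mode `β^{ξᵢ}₍ₙ₎`, for `x = (i, n)`. -/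
abbrev betaPlus (x : ι × ℕ) : Module.End K (Weil K ι) := betaBasis K x.1 x.2

/-- The annihilation mode `γ^{ξᵢ*}₍ₙ₎`, for `x = (i, n)`. -/
abbrev gammaPlus (x : ι × ℕ) : Module.End K (Weil K ι) := gammaBasis K x.1 x.2

theorem index_eq_iff (x y : ι × ℕ) : (x.1 = y.1 ∧ (x.2 : ℤ) + (-y.2 - 1) = -1) ↔ x = y := by
  rw [Prod.ext_iff]
  exact and_congr_right fun _ => by omega

open Classical in
theorem bPlus_cMinus (x y : ι × ℕ) :
    bPlus K x * cMinus K y + cMinus K y * bPlus K x = if x = y then 1 else 0 := by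
  rw [bBasis_cBasis]
  simp only [index_eq_iff]

open Classical in
theorem betaPlus_gammaMinus (x y : ι × ℕ) :
    betaPlus K x * gammaMinus K y - gammaMinus K y * betaPlus K x = if x = y then 1 else 0 := by
  rw [betaBasis_gammaBasis]
  simp only [index_eq_iff]

theorem bMinus_cMinus (x y : ι × ℕ) :
    bMinus K x * cMinus K y + cMinus K y * bMinus K x = 0 := by
  classical
  rw [bBasis_cBasis, if_neg (by omega)]

theorem bPlus_cPlus (x y : ι × ℕ) :
    bPlus K x * cPlus K y + cPlus K y * bPlus K x = 0 := by
  classical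
  rw [bBasis_cBasis, if_neg (by omega)]

theorem betaMinus_gammaMinus (x y : ι × ℕ) : Commute (betaMinus K x) (gammaMinus K y) := by
  classical
  exact sub_eq_zero.1 (by rw [betaBasis_gammaBasis, if_neg (by omega)])

theorem betaPlus_gammaPlus (x y : ι × ℕ) : Commute (betaPlus K x) (gammaPlus K y) := by
  classical
  exact sub_eq_zero.1 (by rw [betaBasis_gammaBasis, if_neg (by omega)])

end WeilModes

section Brackets

theorem mul_commutator {R : Type*} [Ring R] (a b t : R) :
    a * b * t - t * (a * b) = a * (b * t - t * b) + (a * t - t * a) * b := by noncomm_ring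

theorem mul_commutator_odd {R : Type*} [Ring R] (a b t : R) :
    a * b * t - t * (a * b) = a * (b * t + t * b) - (a * t + t * a) * b := by noncomm_ring

variable {K V J : Type*} [Field K] [AddCommGroup V] [Module K V]

open Classical in
theorem locSum_commutator_single {f : J → Module.End K V} (hf : LocFin f) {T U : Module.End K V}
    (i : J) (h : ∀ j, f j * T - T * f j = if j = i then U else 0) :
    locSum f * T = T * locSum f + U := by
  rw [← sub_eq_iff_eq_add', locSum_mul hf, mul_locSum hf,
    ← locSum_sub (hf.mul_right T) (hf.mul_left fun _ => T),
    locSum_eq_single ((hf.mul_right T).sub (hf.mul_left fun _ => T)) i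
      (fun j hj => by rw [h, if_neg hj]), h, if_pos rfl]

theorem locSum_commute {f : J → Module.End K V} (hf : LocFin f) {T : Module.End K V}
    (h : ∀ j, Commute (f j) T) : Commute (locSum f) T := by
  unfold Commute SemiconjBy
  rw [locSum_mul hf, mul_locSum hf]
  congr 1
  exact funext h

end Brackets

section Number

variable (K ι : Type*) [Field K]

theorem locFin_cMinus_bPlus : LocFin fun x : ι × ℕ => cMinus K x * bPlus K x :=
  (locFin_bBasis K ι).mul_left _

theorem locFin_bMinus_cPlus : LocFin fun x : ι × ℕ => bMinus K x * cPlus K x :=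
  (locFin_cBasis K ι).mul_left _

theorem locFin_gammaMinus_betaPlus : LocFin fun x : ι × ℕ => gammaMinus K x * betaPlus K x :=
  (locFin_betaBasis K ι).mul_left _

theorem locFin_betaMinus_gammaPlus : LocFin fun x : ι × ℕ => betaMinus K x * gammaPlus K x :=
  (locFin_gammaBasis K ι).mul_left _

/-- The operator counting the creation modes of the `c^{ξᵢ*}`. -/
def cNumber : Module.End K (Weil K ι) := locSum fun x : ι × ℕ => cMinus K x * bPlus K x

/-- The operator counting the creation modes of the `b^{ξᵢ}`. -/
def bNumber : Module.End K (Weil K ι) := locSum fun x : ι × ℕ => bMinus K x * cPlus K x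

/-- The operator counting the creation modes of the `γ^{ξᵢ*}`. -/
def gammaNumber : Module.End K (Weil K ι) :=
  locSum fun x : ι × ℕ => gammaMinus K x * betaPlus K x

/-- Minus the operator counting the creation modes of the `β^{ξᵢ}`. -/
def betaNumber : Module.End K (Weil K ι) :=
  locSum fun x : ι × ℕ => betaMinus K x * gammaPlus K x

variable {ι}

theorem cNumber_cMinus (y : ι × ℕ) :
    cNumber K ι * cMinus K y = cMinus K y * cNumber K ι + cMinus K y := by
  classical
  refine locSum_commutator_single (locFin_cMinus_bPlus K ι) y fun x => ?_
  rw [mul_commutator_odd, bPlus_cMinus, cBasis_anticomm]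
  split_ifs with h
  · simp [h]
  · simp

theorem cNumber_bPlus (y : ι × ℕ) :
    cNumber K ι * bPlus K y = bPlus K y * cNumber K ι + -bPlus K y := by
  classical
  refine locSum_commutator_single (locFin_cMinus_bPlus K ι) y fun x => ?_
  rw [mul_commutator_odd, add_comm (cMinus K x * _), bPlus_cMinus, bBasis_anticomm]
  by_cases h : x = y
  · simp [h]
  · simp [h, Ne.symm h]

theorem cNumber_gammaMinus (y : ι × ℕ) : Commute (cNumber K ι) (gammaMinus K y) :=
  locSum_commute (locFin_cMinus_bPlus K ι) fun _ =>
    (cBasis_gammaBasis_comm _ _ _ _).mul_left (bBasis_gammaBasis_comm _ _ _ _)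

theorem cNumber_betaPlus (y : ι × ℕ) : Commute (cNumber K ι) (betaPlus K y) :=
  locSum_commute (locFin_cMinus_bPlus K ι) fun _ =>
    (cBasis_betaBasis_comm _ _ _ _).mul_left (bBasis_betaBasis_comm _ _ _ _)

theorem bNumber_cMinus (y : ι × ℕ) : Commute (bNumber K ι) (cMinus K y) :=
  locSum_commute (locFin_bMinus_cPlus K ι) fun x => sub_eq_zero.1 <| by
    rw [mul_commutator_odd, cBasis_anticomm, bMinus_cMinus, mul_zero, zero_mul, sub_zero]

theorem bNumber_bPlus (y : ι × ℕ) : Commute (bNumber K ι) (bPlus K y) :=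
  locSum_commute (locFin_bMinus_cPlus K ι) fun x => sub_eq_zero.1 <| by
    rw [mul_commutator_odd, add_comm (cPlus K x * _), bPlus_cPlus, bBasis_anticomm, mul_zero,
      zero_mul, sub_zero]

theorem bNumber_gammaMinus (y : ι × ℕ) : Commute (bNumber K ι) (gammaMinus K y) :=
  locSum_commute (locFin_bMinus_cPlus K ι) fun _ =>
    (bBasis_gammaBasis_comm _ _ _ _).mul_left (cBasis_gammaBasis_comm _ _ _ _)

theorem bNumber_betaPlus (y : ι × ℕ) : Commute (bNumber K ι) (betaPlus K y) :=
  locSum_commute (locFin_bMinus_cPlus K ι) fun _ =>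
    (bBasis_betaBasis_comm _ _ _ _).mul_left (cBasis_betaBasis_comm _ _ _ _)

theorem gammaNumber_gammaMinus (y : ι × ℕ) :
    gammaNumber K ι * gammaMinus K y = gammaMinus K y * gammaNumber K ι + gammaMinus K y := by
  classical
  refine locSum_commutator_single (locFin_gammaMinus_betaPlus K ι) y fun x => ?_
  rw [mul_commutator, betaPlus_gammaMinus, sub_eq_zero.2 (gammaBasis_comm _ _ _ _).eq]
  split_ifs with h
  · simp [h]
  · simp

theorem gammaNumber_betaPlus (y : ι × ℕ) :
    gammaNumber K ι * betaPlus K y = betaPlus K y * gammaNumber K ι + -betaPlus K y := by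
  classical
  refine locSum_commutator_single (locFin_gammaMinus_betaPlus K ι) y fun x => ?_
  rw [mul_commutator, ← neg_sub (betaPlus K y * gammaMinus K x), betaPlus_gammaMinus,
    sub_eq_zero.2 (betaBasis_comm _ _ _ _).eq]
  by_cases h : x = y
  · simp [h]
  · simp [h, Ne.symm h]

theorem gammaNumber_cMinus (y : ι × ℕ) : Commute (gammaNumber K ι) (cMinus K y) :=
  locSum_commute (locFin_gammaMinus_betaPlus K ι) fun _ =>
    (cBasis_gammaBasis_comm _ _ _ _).symm.mul_left (cBasis_betaBasis_comm _ _ _ _).symm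

theorem gammaNumber_bPlus (y : ι × ℕ) : Commute (gammaNumber K ι) (bPlus K y) :=
  locSum_commute (locFin_gammaMinus_betaPlus K ι) fun _ =>
    (bBasis_gammaBasis_comm _ _ _ _).symm.mul_left (bBasis_betaBasis_comm _ _ _ _).symm

theorem betaNumber_gammaMinus (y : ι × ℕ) : Commute (betaNumber K ι) (gammaMinus K y) :=
  locSum_commute (locFin_betaMinus_gammaPlus K ι) fun _ =>
    (betaMinus_gammaMinus K _ _).mul_left (gammaBasis_comm _ _ _ _)

theorem betaNumber_betaPlus (y : ι × ℕ) : Commute (betaNumber K ι) (betaPlus K y) :=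
  locSum_commute (locFin_betaMinus_gammaPlus K ι) fun _ =>
    (betaBasis_comm _ _ _ _).mul_left (betaPlus_gammaPlus K _ _).symm

theorem betaNumber_cMinus (y : ι × ℕ) : Commute (betaNumber K ι) (cMinus K y) :=
  locSum_commute (locFin_betaMinus_gammaPlus K ι) fun _ =>
    (cBasis_betaBasis_comm _ _ _ _).symm.mul_left (cBasis_gammaBasis_comm _ _ _ _).symm

theorem betaNumber_bPlus (y : ι × ℕ) : Commute (betaNumber K ι) (bPlus K y) :=
  locSum_commute (locFin_betaMinus_gammaPlus K ι) fun _ =>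
    (bBasis_betaBasis_comm _ _ _ _).symm.mul_left (bBasis_gammaBasis_comm _ _ _ _).symm

end Number

section Creation

variable (K ι : Type*) [Field K]

/-- The creation modes of the `γ^{ξᵢ*}`. -/
def gammaOps : Set (Module.End K (Weil K ι)) := Set.range (gammaMinus K)

/-- The creation modes of the `c^{ξᵢ*}` and `γ^{ξᵢ*}`. -/
def cGammaOps : Set (Module.End K (Weil K ι)) := Set.range (cMinus K) ∪ Set.range (gammaMinus K)

/-- The span of the monomials of length at most `k` in the creation modes of the `c^{ξᵢ*}` and
`γ^{ξᵢ*}`, applied to the vacuum. -/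
def cGammaFilt (k : ℕ) : Submodule K (Weil K ι) := filt (K ∙ vac K ι) (cGammaOps K ι) k

/-- The modes of the `c^{ξᵢ*}` and `γ^{ξᵢ*}` supercommute with one another, so their annihilation
modes can be moved to the vacuum. -/
theorem cPlus_eq_zero (x : ι × ℕ) {v : Weil K ι}
    (hv : v ∈ ⨆ k, cGammaFilt K ι k) : cPlus K x v = 0 := by
  classical
  have h : ⨆ k, cGammaFilt K ι k ≤ LinearMap.ker (cPlus K x) := by
    refine iSup_filt_le ?_ ?_
    · rw [Submodule.span_singleton_le_iff_mem]
      exact cBasis_vac _ _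
    · rintro _ (⟨y, rfl⟩ | ⟨y, rfl⟩) v hv
      · have h1 := LinearMap.congr_fun (cBasis_anticomm (K := K) x.1 y.1 x.2 (-y.2 - 1)) v
        have h2 : cPlus K x v = 0 := hv
        simpa [h2] using h1
      · have h1 := LinearMap.congr_fun (cBasis_gammaBasis_comm (K := K) x.1 y.1 x.2 (-y.2 - 1)).eq v
        have h2 : cPlus K x v = 0 := hv
        simpa [h2] using h1
  exact h hv

theorem gammaPlus_eq_zero (x : ι × ℕ) {v : Weil K ι}
    (hv : v ∈ ⨆ k, cGammaFilt K ι k) : gammaPlus K x v = 0 := by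
  classical
  have h : ⨆ k, cGammaFilt K ι k ≤ LinearMap.ker (gammaPlus K x) := by
    refine iSup_filt_le ?_ ?_
    · rw [Submodule.span_singleton_le_iff_mem]
      exact gammaBasis_vac _ _
    · rintro _ (⟨y, rfl⟩ | ⟨y, rfl⟩) v hv
      · have h1 := LinearMap.congr_fun (cBasis_gammaBasis_comm (K := K) y.1 x.1 (-y.2 - 1) x.2).eq v
        have h2 : gammaPlus K x v = 0 := hv
        simpa [h2] using h1.symm
      · have h1 := LinearMap.congr_fun (gammaBasis_comm (K := K) x.1 y.1 x.2 (-y.2 - 1)).eq v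
        have h2 : gammaPlus K x v = 0 := hv
        simpa [h2] using h1
  exact h hv

theorem int_cases (m : ℤ) : (∃ n : ℕ, m = n) ∨ ∃ n : ℕ, m = -n - 1 := by
  cases m with
  | ofNat n => exact Or.inl ⟨n, rfl⟩
  | negSucc n => exact Or.inr ⟨n, by omega⟩

theorem isFld_of_locFin {A : ι → Modes K (Weil K ι)}
    (h : LocFin fun x : ι × ℕ => A x.1 x.2) (i : ι) : IsFld (A i) := fun v => by
  have h1 : {n : ℕ | A i n v ≠ 0}.Finite :=
    ((h v).preimage (f := fun n : ℕ => (i, n)) (fun a _ b _ hab => (Prod.mk.inj hab).2))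
  obtain ⟨N, hN⟩ := h1.bddAbove
  refine ⟨N + 1, fun n hn => ?_⟩
  by_contra h0
  lift n to ℕ using by omega
  have := hN (show n ∈ {n : ℕ | A i n v ≠ 0} from h0)
  omega

variable {K ι}

theorem bPlus_lower (x : ι × ℕ) (k : ℕ) : ∀ v ∈ cGammaFilt K ι (k + 1),
    bPlus K x v ∈ cGammaFilt K ι k := by
  classical
  refine lower_filt (fun v hv => ?_) ?_ k
  · obtain ⟨a, rfl⟩ := Submodule.mem_span_singleton.1 hv
    rw [map_smul, bBasis_vac, smul_zero]
  · rintro _ (⟨y, rfl⟩ | ⟨y, rfl⟩)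
    · refine ⟨-1, if x = y then 1 else 0, ?_⟩
      have h := eq_sub_of_add_eq (bPlus_cMinus K x y)
      rw [h]
      split_ifs
      · rw [neg_one_smul, one_smul]; abel
      · rw [neg_one_smul, zero_smul]; abel
    · exact ⟨1, 0, by rw [one_smul, zero_smul, add_zero, (bBasis_gammaBasis_comm _ _ _ _).eq]⟩

theorem betaPlus_lower (x : ι × ℕ) (k : ℕ) : ∀ v ∈ cGammaFilt K ι (k + 1),
    betaPlus K x v ∈ cGammaFilt K ι k := by
  classical
  refine lower_filt (fun v hv => ?_) ?_ k
  · obtain ⟨a, rfl⟩ := Submodule.mem_span_singleton.1 hv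
    rw [map_smul, betaBasis_vac, smul_zero]
  · rintro _ (⟨y, rfl⟩ | ⟨y, rfl⟩)
    · exact ⟨1, 0, by rw [one_smul, zero_smul, add_zero, (cBasis_betaBasis_comm _ _ _ _).eq]⟩
    · refine ⟨1, if x = y then 1 else 0, ?_⟩
      have h := eq_add_of_sub_eq' (betaPlus_gammaMinus K x y)
      rw [h]
      split_ifs <;> simp

/-- On the piece of index `k + 1` of the filtration of `⟨c, γ⟩`, the number of creation modes is
`k + 1`, modulo the piece of index `k`. -/
theorem number_cGammaFilt (k : ℕ) : ∀ v ∈ cGammaFilt K ι (k + 1),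
    (cNumber K ι + gammaNumber K ι) v - (k + 1 : K) • v ∈ cGammaFilt K ι k := by
  refine number_filt (fun v hv => ?_) ?_ k
  · obtain ⟨a, rfl⟩ := Submodule.mem_span_singleton.1 hv
    have h1 : cNumber K ι (vac K ι) = 0 := locSum_apply_eq_zero fun x => by
      rw [Module.End.mul_apply, bBasis_vac, map_zero]
    have h2 : gammaNumber K ι (vac K ι) = 0 := locSum_apply_eq_zero fun x => by
      rw [Module.End.mul_apply, betaBasis_vac, map_zero]
    rw [map_smul, LinearMap.add_apply, h1, h2, add_zero, smul_zero]
  · rintro _ (⟨y, rfl⟩ | ⟨y, rfl⟩)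
    · rw [add_mul, mul_add, cNumber_cMinus, (gammaNumber_cMinus K y).eq]
      abel
    · rw [add_mul, mul_add, gammaNumber_gammaMinus, (cNumber_gammaMinus K y).eq]
      abel

variable [Fintype ι] {g : Type*} [LieRing g] [LieAlgebra K g] (e : Module.Basis ι K g)

theorem cField_coord (i : ι) : cField e (e.coord i) = cBasis K i := by
  classical
  rw [cField, Finset.sum_eq_single i (fun j _ hj => by simp [hj]) (by simp)]
  simp

theorem gammaField_coord (i : ι) : gammaField e (e.coord i) = gammaBasis K i := by
  classical
  rw [gammaField,
    Finset.sum_eq_single i (fun j _ hj => by simp [hj]) (by simp)]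
  simp

theorem cField_apply (φ : Module.Dual K g) (m : ℤ) (v : Weil K ι) :
    cField e φ m v = ∑ i, φ (e i) • cBasis K i m v := by
  simp [cField, LinearMap.sum_apply]

theorem gammaField_apply (φ : Module.Dual K g) (m : ℤ) (v : Weil K ι) :
    gammaField e φ m v = ∑ i, φ (e i) • gammaBasis K i m v := by
  simp [gammaField, LinearMap.sum_apply]

theorem sum_smul_isFld {A : ι → Modes K (Weil K ι)} (hA : ∀ i, IsFld (A i)) (a : ι → K) :
    IsFld (∑ i, a i • A i) := fun v => by
  choose N hN using fun i => hA i v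
  refine ⟨∑ i, |N i|, fun n hn => ?_⟩
  simp only [Finset.sum_apply, Pi.smul_apply, LinearMap.sum_apply, LinearMap.smul_apply]
  refine Finset.sum_eq_zero fun i _ => ?_
  have h1 := Finset.single_le_sum (f := fun i => |N i|) (fun i _ => abs_nonneg _)
    (Finset.mem_univ i)
  rw [hN i n ((le_abs_self _).trans (h1.trans hn)), smul_zero]

theorem cGammaGen_isFld (s : ZMod 2) (A : Modes K (Weil K ι)) (hA : A ∈ cGammaGen e s) :
    IsFld A ∧ ∀ n : ℕ, A n (vac K ι) = 0 := by
  rcases hA with ⟨_, φ, rfl⟩ | ⟨_, φ, rfl⟩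
  · exact ⟨sum_smul_isFld (isFld_of_locFin K ι (locFin_cBasis K ι)) _, fun n => by
      rw [cField_apply]; simp [cBasis_vac]⟩
  · exact ⟨sum_smul_isFld (isFld_of_locFin K ι (locFin_gammaBasis K ι)) _, fun n => by
      rw [gammaField_apply]; simp [gammaBasis_vac]⟩

theorem gammaGen_isFld (s : ZMod 2) (A : Modes K (Weil K ι)) (hA : A ∈ gammaGen e s) :
    IsFld A ∧ ∀ n : ℕ, A n (vac K ι) = 0 :=
  cGammaGen_isFld e s A (Or.inr hA)

/-- The vectors of `⟨c, γ⟩` are the polynomials in the creation modes of the `c^{ξᵢ*}` and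
`γ^{ξᵢ*}`, applied to the vacuum. -/
theorem cGammaStates_eq : cGammaStates e = ⨆ k, cGammaFilt K ι k := by
  apply le_antisymm
  · refine states_le ?_ ?_
    · exact Submodule.mem_iSup_of_mem 0 (Submodule.mem_span_singleton_self _)
    · rintro s A (⟨_, φ, rfl⟩ | ⟨_, φ, rfl⟩) m v hv
      · rw [cField_apply]
        refine Submodule.sum_mem _ fun i _ => Submodule.smul_mem _ _ ?_
        rcases int_cases m with ⟨n, rfl⟩ | ⟨n, rfl⟩
        · have := cPlus_eq_zero K ι (i, n) hv
          rw [this]; exact Submodule.zero_mem _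
        · exact op_mem_iSup_filt (Or.inl ⟨(i, n), rfl⟩) hv
      · rw [gammaField_apply]
        refine Submodule.sum_mem _ fun i _ => Submodule.smul_mem _ _ ?_
        rcases int_cases m with ⟨n, rfl⟩ | ⟨n, rfl⟩
        · have := gammaPlus_eq_zero K ι (i, n) hv
          rw [this]; exact Submodule.zero_mem _
        · exact op_mem_iSup_filt (Or.inr ⟨(i, n), rfl⟩) hv
  · refine iSup_filt_le ?_ ?_
    · rw [Submodule.span_singleton_le_iff_mem]
      exact vac_mem_states _
    · rintro _ (⟨x, rfl⟩ | ⟨x, rfl⟩) v hv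
      · have hA : cField e (e.coord x.1) ∈ cGammaGen e 1 := Or.inl ⟨rfl, _, rfl⟩
        have := mode_mem_states (cGammaGen_isFld e) hA (-x.2 - 1) hv
        rwa [cField_coord] at this
      · have hA : gammaField e (e.coord x.1) ∈ cGammaGen e 0 := Or.inr ⟨rfl, _, rfl⟩
        have := mode_mem_states (cGammaGen_isFld e) hA (-x.2 - 1) hv
        rwa [gammaField_coord] at this

theorem gammaStates_eq : gammaStates e = ⨆ k, filt (K ∙ vac K ι) (gammaOps K ι) k := by
  apply le_antisymm
  · refine states_le ?_ ?_
    · exact Submodule.mem_iSup_of_mem 0 (Submodule.mem_span_singleton_self _)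
    · rintro s A ⟨_, φ, rfl⟩ m v hv
      rw [gammaField_apply]
      refine Submodule.sum_mem _ fun i _ => Submodule.smul_mem _ _ ?_
      rcases int_cases m with ⟨n, rfl⟩ | ⟨n, rfl⟩
      · have h : ⨆ k, filt (K ∙ vac K ι) (gammaOps K ι) k ≤ ⨆ k, cGammaFilt K ι k :=
          iSup_filt_le (le_iSup (cGammaFilt K ι) 0) fun T hT v hv =>
            op_mem_iSup_filt (Or.inr hT) hv
        have := gammaPlus_eq_zero K ι (i, n) (h hv)
        rw [this]; exact Submodule.zero_mem _
      · exact op_mem_iSup_filt (Set.mem_range_self (i, n)) hv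
  · refine iSup_filt_le ?_ ?_
    · rw [Submodule.span_singleton_le_iff_mem]
      exact vac_mem_states _
    · rintro _ ⟨x, rfl⟩ v hv
      have hA : gammaField e (e.coord x.1) ∈ gammaGen e 0 := ⟨rfl, _, rfl⟩
      have := mode_mem_states (gammaGen_isFld e) hA (-x.2 - 1) hv
      rwa [gammaField_coord] at this

theorem vac_mem_cGammaStates : vac K ι ∈ cGammaStates e := vac_mem_states _

theorem cMinus_mem (x : ι × ℕ) {v : Weil K ι} (hv : v ∈ cGammaStates e) :
    cMinus K x v ∈ cGammaStates e := by
  rw [cGammaStates_eq] at hv ⊢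
  exact op_mem_iSup_filt (Or.inl ⟨x, rfl⟩) hv

theorem gammaMinus_mem (x : ι × ℕ) {v : Weil K ι} (hv : v ∈ cGammaStates e) :
    gammaMinus K x v ∈ cGammaStates e := by
  rw [cGammaStates_eq] at hv ⊢
  exact op_mem_iSup_filt (Or.inr ⟨x, rfl⟩) hv

/-- An induction principle for `⟨c, γ⟩`. -/
theorem cGammaStates_le {q : Submodule K (Weil K ι)} (h0 : vac K ι ∈ q)
    (hc : ∀ x, ∀ v ∈ q, cMinus K x v ∈ q) (hg : ∀ x, ∀ v ∈ q, gammaMinus K x v ∈ q) :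
    cGammaStates e ≤ q := by
  rw [cGammaStates_eq]
  refine iSup_filt_le ((Submodule.span_singleton_le_iff_mem _ _).2 h0) ?_
  rintro _ (⟨x, rfl⟩ | ⟨x, rfl⟩) v hv
  · exact hc x v hv
  · exact hg x v hv

theorem gammaStates_le {q : Submodule K (Weil K ι)} (h0 : vac K ι ∈ q)
    (hg : ∀ x, ∀ v ∈ q, gammaMinus K x v ∈ q) : gammaStates e ≤ q := by
  rw [gammaStates_eq]
  refine iSup_filt_le ((Submodule.span_singleton_le_iff_mem _ _).2 h0) ?_
  rintro _ ⟨x, rfl⟩ v hv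
  exact hg x v hv

theorem gammaStates_le_cGammaStates : gammaStates e ≤ cGammaStates e :=
  gammaStates_le e (vac_mem_cGammaStates e) fun x _ hv => gammaMinus_mem e x hv

theorem bPlus_mem (x : ι × ℕ) {v : Weil K ι} (hv : v ∈ cGammaStates e) :
    bPlus K x v ∈ cGammaStates e := by
  rw [cGammaStates_eq] at hv ⊢
  obtain ⟨k, hk⟩ := mem_iSup_filt.1 hv
  exact mem_iSup_filt.2 ⟨k, bPlus_lower x k v (filt_le_succ k hk)⟩

theorem betaPlus_mem (x : ι × ℕ) {v : Weil K ι} (hv : v ∈ cGammaStates e) :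
    betaPlus K x v ∈ cGammaStates e := by
  rw [cGammaStates_eq] at hv ⊢
  obtain ⟨k, hk⟩ := mem_iSup_filt.1 hv
  exact mem_iSup_filt.2 ⟨k, betaPlus_lower x k v (filt_le_succ k hk)⟩

theorem bPlus_gammaStates (x : ι × ℕ) {v : Weil K ι} (hv : v ∈ gammaStates e) :
    bPlus K x v = 0 := by
  have h : gammaStates e ≤ LinearMap.ker (bPlus K x) := gammaStates_le e (bBasis_vac _ _)
    fun y v hv => by
      have h1 := LinearMap.congr_fun (bBasis_gammaBasis_comm (K := K) x.1 y.1 x.2 (-y.2 - 1)).eq v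
      have h2 : bPlus K x v = 0 := hv
      simpa [h2] using h1
  exact h hv

/-- The subspace `⟨γ⟩` consists of the vectors of `⟨c, γ⟩` killed by all `b^ξ₍ₙ₎`, `n ≥ 0`:
such vectors contain no creation mode of a `c^{ξᵢ*}`. -/
theorem mem_gammaStates [CharZero K] {v : Weil K ι} (hv : v ∈ cGammaStates e)
    (hb : ∀ x, bPlus K x v = 0) : v ∈ gammaStates e := by
  -- filter `⟨c, γ⟩` by the number of creation modes of the `c^{ξᵢ*}`, starting from `⟨γ⟩`
  have h1 : v ∈ ⨆ k, filt (gammaStates e) (Set.range (cMinus K)) k := by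
    refine cGammaStates_le e (q := ⨆ k, filt (gammaStates e) (Set.range (cMinus K)) k) ?_ ?_ ?_ hv
    · exact Submodule.mem_iSup_of_mem 0 (vac_mem_states _)
    · exact fun x v hv => op_mem_iSup_filt (Set.mem_range_self x) hv
    · intro x v hv
      have h2 : ⨆ k, filt (gammaStates e) (Set.range (cMinus K)) k ≤
          (⨆ k, filt (gammaStates e) (Set.range (cMinus K)) k ⊓
            (filt (gammaStates e) (Set.range (cMinus K)) k).comap (gammaMinus K x)) := by
        refine iSup_mono fun k => le_inf le_rfl ?_
        induction k with
        | zero =>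
          intro w hw
          have hA : gammaField e (e.coord x.1) ∈ gammaGen e 0 := ⟨rfl, _, rfl⟩
          have := mode_mem_states (gammaGen_isFld e) hA (-x.2 - 1) hw
          rwa [gammaField_coord] at this
        | succ k ih =>
          refine filt_succ_le (ih.trans fun w hw => filt_le_succ k hw) ?_
          rintro _ ⟨y, rfl⟩ w hw
          rw [Submodule.mem_comap]
          have h3 := LinearMap.congr_fun
            (cBasis_gammaBasis_comm (K := K) y.1 x.1 (-y.2 - 1) (-x.2 - 1)).eq w
          rw [Module.End.mul_apply, Module.End.mul_apply] at h3
          rw [← h3]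
          exact op_mem_filt (Set.mem_range_self y) (ih hw)
      have h4 : (⨆ k, filt (gammaStates e) (Set.range (cMinus K)) k ⊓
            (filt (gammaStates e) (Set.range (cMinus K)) k).comap (gammaMinus K x)) ≤
          (⨆ k, filt (gammaStates e) (Set.range (cMinus K)) k).comap (gammaMinus K x) :=
        iSup_le fun k w hw => Submodule.mem_iSup_of_mem k hw.2
      exact h4 (h2 hv)
  refine mem_of_number_eq_zero (N := cNumber K ι) (fun w hw => ?_) ?_ h1 ?_
  · exact locSum_apply_eq_zero fun x => by
      rw [Module.End.mul_apply, bPlus_gammaStates e x hw, map_zero]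
  · rintro _ ⟨y, rfl⟩
    exact cNumber_cMinus K y
  · exact locSum_apply_eq_zero fun x => by rw [Module.End.mul_apply, hb x, map_zero]

theorem weilParity_gammaStates {v : Weil K ι} (hv : v ∈ gammaStates e) :
    weilParity K ι v = v := by
  have h : gammaStates e ≤ LinearMap.ker (weilParity K ι - 1) :=
    gammaStates_le e (by simp [weilParity_vac]) fun y v hv => by
      have h1 := LinearMap.congr_fun (weilParity_gammaBasis (K := K) y.1 (-y.2 - 1)).eq v
      have h2 : weilParity K ι v = v := sub_eq_zero.1 hv
      simp only [Module.End.mul_apply, h2] at h1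
      simp [h1]
  exact sub_eq_zero.1 (h hv)

end Creation

/-! ### The differential and the gradings of the semi-infinite Weil algebra -/

section Anticommutators

theorem mul_anticommutator_even_odd {R : Type*} [Ring R] (a b t : R) :
    a * b * t + t * (a * b) = a * (b * t + t * b) - (a * t - t * a) * b := by noncomm_ring

theorem mul_anticommutator_odd_even {R : Type*} [Ring R] (a b t : R) :
    a * b * t + t * (a * b) = a * (b * t - t * b) + (a * t + t * a) * b := by noncomm_ring

variable {K V J : Type*} [Field K] [AddCommGroup V] [Module K V]

open Classical in
theorem locSum_anticommutator_single {f : J → Module.End K V} (hf : LocFin f)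
    {T U : Module.End K V} (i : J) (h : ∀ j, f j * T + T * f j = if j = i then U else 0) :
    locSum f * T + T * locSum f = U := by
  rw [locSum_mul hf, mul_locSum hf, ← locSum_add (hf.mul_right T) (hf.mul_left fun _ => T),
    locSum_eq_single ((hf.mul_right T).add (hf.mul_left fun _ => T)) i
      (fun j hj => by rw [h, if_neg hj]), h, if_pos rfl]

theorem locSum_anticommute {f : J → Module.End K V} (hf : LocFin f) {T : Module.End K V}
    (h : ∀ j, f j * T + T * f j = 0) : locSum f * T + T * locSum f = 0 := by
  rw [locSum_mul hf, mul_locSum hf, ← locSum_add (hf.mul_right T) (hf.mul_left fun _ => T)]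
  simp only [h]
  exact locSum_zero

theorem sum_locSum {I : Type*} [Fintype I] {f : I × J → Module.End K V} (hf : LocFin f) :
    ∑ i, locSum (fun j => f (i, j)) = locSum f := by
  classical
  have hf' : ∀ i, LocFin fun j => f (i, j) := fun i v =>
    (hf v).preimage (f := fun j => (i, j)) fun a _ b _ hab => (Prod.mk.inj hab).2
  ext v
  set s : Finset J := (hf v).toFinset.image Prod.snd with hs
  have hs' : ∀ i j, j ∉ s → f (i, j) v = 0 := fun i j hj => by
    by_contra h
    exact hj (Finset.mem_image.2 ⟨(i, j), by simpa using h, rfl⟩)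
  rw [LinearMap.sum_apply, locSum_apply_eq_sum hf (s := Finset.univ ×ˢ s)
    (fun x hx => hs' x.1 x.2 fun h => hx (by simp [h])), Finset.sum_product]
  exact Finset.sum_congr rfl fun i _ => locSum_apply_eq_sum (hf' i) (hs' i)

end Anticommutators

section Differential

variable {K ι : Type*} [Field K]

/-- The zero mode of a sum of normally ordered products of two families of fields. -/
theorem sum_nthProd_neg_one [Fintype ι] {A B : ι → Modes K (Weil K ι)}
    (hA : LocFin fun x : ι × ℕ => A x.1 x.2) (hB : LocFin fun x : ι × ℕ => B x.1 x.2)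
    (s t : ZMod 2) : (∑ i, nthProd s t (-1) (A i) (B i)) 0 =
      locSum fun x : ι × ℕ => A x.1 (-x.2 - 1) * B x.1 x.2 +
        koszul s t • (B x.1 (-x.2 - 1) * A x.1 x.2) := by
  rw [Finset.sum_apply, ← sum_locSum]
  · refine Finset.sum_congr rfl fun i _ => ?_
    rw [nthProd_neg_one]
    simp only [zero_add, zero_sub]
  · refine (hB.mul_left _).add ?_
    simp only [← smul_mul_assoc]
    exact hA.mul_left _

theorem nthProd_zero_left {V : Type*} [AddCommGroup V] [Module K V] (s t : ZMod 2) (n : ℤ)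
    (B : Modes K V) : nthProd s t n 0 B = 0 := by
  funext m
  refine LinearMap.ext fun v => locSum_apply_eq_zero fun j => ?_
  simp

theorem nthProd_zero_right {V : Type*} [AddCommGroup V] [Module K V] (s t : ZMod 2) (n : ℤ)
    (A : Modes K V) : nthProd s t n A 0 = 0 := by
  funext m
  refine LinearMap.ext fun v => locSum_apply_eq_zero fun j => ?_
  simp

theorem locFin_weilD : LocFin fun x : ι × ℕ =>
    gammaMinus K x * bPlus K x + bMinus K x * gammaPlus K x :=
  ((locFin_bBasis K ι).mul_left _).add ((locFin_gammaBasis K ι).mul_left _)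

theorem weilParity_cBasis_vac (i : ι) :
    weilParity K ι (cBasis K i (-1) (vac K ι)) = -cBasis K i (-1) (vac K ι) := by
  have h := LinearMap.congr_fun (weilParity_cBasis (K := K) i (-1)) (vac K ι)
  simpa [weilParity_vac] using h

variable [Fintype ι] {g : Type*} [LieRing g] [LieAlgebra K g]

/-- The differential of the semi-infinite Weil algebra of a commutative Lie algebra; the terms of
`D` containing brackets of basis elements vanish. -/
theorem weilD_eq [IsLieAbelian g] (e : Module.Basis ι K g) :
    weilD e = locSum fun x : ι × ℕ =>
      gammaMinus K x * bPlus K x + bMinus K x * gammaPlus K x := by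
  have h1 : ∀ i j, betaField e ⁅e i, e j⁆ = 0 := fun i j => by
    rw [trivial_lie_zero g g (e i) (e j)]; simp [betaField]
  have h2 : ∀ i j, bField e ⁅e i, e j⁆ = 0 := fun i j => by
    rw [trivial_lie_zero g g (e i) (e j)]; simp [bField]
  rw [weilD, DField]
  simp only [h1, h2, nthProd_zero_left, nthProd_zero_right, Finset.sum_const_zero, smul_zero,
    neg_zero, sub_zero, zero_add]
  rw [sum_nthProd_neg_one (locFin_gammaBasis K ι) (locFin_bBasis K ι)]
  simp [koszul]

variable (K ι) in
theorem degreeOp_eq : degreeOp K ι =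
    cNumber K ι - bNumber K ι + 2 • (betaNumber K ι + gammaNumber K ι) := by
  rw [degreeOp, Pi.neg_apply, sum_nthProd_neg_one (locFin_bBasis K ι) (locFin_cBasis K ι),
    sum_nthProd_neg_one (locFin_betaBasis K ι) (locFin_gammaBasis K ι), cNumber, bNumber,
    betaNumber, gammaNumber, ← locSum_add (locFin_betaMinus_gammaPlus K ι)
      (locFin_gammaMinus_betaPlus K ι), ← neg_sub (locSum _),
    ← locSum_sub (locFin_bMinus_cPlus K ι) (locFin_cMinus_bPlus K ι)]
  have h1 : koszul 1 1 = -1 := rfl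
  have h2 : koszul 0 0 = 1 := rfl
  simp only [h1, h2, neg_smul, one_smul, ← sub_eq_add_neg]

section

variable [IsLieAbelian g] (e : Module.Basis ι K g)

theorem weilD_bBasis (i : ι) (m : ℤ) : weilD e * bBasis K i m + bBasis K i m * weilD e = 0 := by
  rw [weilD_eq]
  refine locSum_anticommute locFin_weilD fun x => ?_
  rw [add_mul, mul_add, add_add_add_comm, mul_anticommutator_even_odd, mul_anticommutator_odd_even,
    bBasis_anticomm, bBasis_anticomm, sub_eq_zero.2 (bBasis_gammaBasis_comm _ _ _ _).symm.eq,
    sub_eq_zero.2 (bBasis_gammaBasis_comm _ _ _ _).symm.eq]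
  simp

theorem weilD_gammaBasis (i : ι) (m : ℤ) : Commute (weilD e) (gammaBasis K i m) := by
  rw [weilD_eq]
  refine locSum_commute locFin_weilD fun x => ?_
  have h1 : Commute (gammaMinus K x * bPlus K x) (gammaBasis K i m) :=
    (gammaBasis_comm _ _ _ _).mul_left (bBasis_gammaBasis_comm _ _ _ _)
  have h2 : Commute (bMinus K x * gammaPlus K x) (gammaBasis K i m) :=
    (bBasis_gammaBasis_comm _ _ _ _).mul_left (gammaBasis_comm _ _ _ _)
  exact h1.add_left h2

theorem weilD_cMinus (y : ι × ℕ) :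
    weilD e * cMinus K y + cMinus K y * weilD e = gammaMinus K y := by
  classical
  rw [weilD_eq]
  refine locSum_anticommutator_single locFin_weilD y fun x => ?_
  rw [add_mul, mul_add, add_add_add_comm, mul_anticommutator_even_odd, mul_anticommutator_odd_even,
    bPlus_cMinus, bMinus_cMinus, sub_eq_zero.2 (cBasis_gammaBasis_comm _ _ _ _).symm.eq,
    sub_eq_zero.2 (cBasis_gammaBasis_comm _ _ _ _).symm.eq]
  split_ifs with h
  · simp [h]
  · simp

theorem weilD_betaPlus (y : ι × ℕ) :
    weilD e * betaPlus K y = betaPlus K y * weilD e + -bPlus K y := by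
  classical
  rw [weilD_eq]
  refine locSum_commutator_single locFin_weilD y fun x => ?_
  rw [add_mul, mul_add, add_sub_add_comm, mul_commutator, mul_commutator,
    ← neg_sub (betaPlus K y * gammaMinus K x), betaPlus_gammaMinus,
    sub_eq_zero.2 (betaPlus_gammaPlus K _ _).symm.eq,
    sub_eq_zero.2 (bBasis_betaBasis_comm _ _ _ _).eq,
    sub_eq_zero.2 (bBasis_betaBasis_comm _ _ _ _).eq]
  by_cases h : x = y
  · simp [h]
  · simp [h, Ne.symm h]

theorem weilD_vac : weilD e (vac K ι) = 0 := by
  rw [weilD_eq]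
  exact locSum_apply_eq_zero fun x => by simp [bBasis_vac, gammaBasis_vac]

/-- The differential anticommutes with the `b`'s and commutes with the `γ`'s, hence anticommutes
with itself, being a sum of products of these. -/
theorem weilD_sq [CharZero K] : weilD e * weilD e = 0 := by
  have h : weilD e * weilD e + weilD e * weilD e = 0 := by
    conv_lhs =>
      enter [1, 1]
      rw [weilD_eq]
    conv_lhs =>
      enter [2, 2]
      rw [weilD_eq]
    refine locSum_anticommute locFin_weilD fun x => ?_
    rw [add_mul, mul_add, add_add_add_comm, mul_anticommutator_even_odd,
      mul_anticommutator_odd_even, add_comm (bPlus K x * _), add_comm (bMinus K x * weilD e),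
      weilD_bBasis, weilD_bBasis, sub_eq_zero.2 (weilD_gammaBasis e _ _).symm.eq,
      sub_eq_zero.2 (weilD_gammaBasis e _ _).symm.eq]
    simp
  rw [← two_nsmul] at h
  have h2 : (2 : K) • (weilD e * weilD e) = 0 := by
    rw [← h, ← Nat.cast_smul_eq_nsmul K]; rfl
  exact (smul_eq_zero.1 h2).resolve_left two_ne_zero

theorem weilD_mem {v : Weil K ι} (hv : v ∈ cGammaStates e) : weilD e v ∈ cGammaStates e := by
  rw [weilD_eq]
  refine locSum_mem fun x => ?_
  have h : gammaPlus K x v = 0 := gammaPlus_eq_zero K ι x (by rwa [← cGammaStates_eq e])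
  simp only [LinearMap.add_apply, Module.End.mul_apply, h, map_zero, add_zero]
  exact gammaMinus_mem e x (bPlus_mem e x hv)

end

theorem degreeOp_cMinus (y : ι × ℕ) :
    degreeOp K ι * cMinus K y = cMinus K y * degreeOp K ι + cMinus K y := by
  rw [degreeOp_eq]
  simp only [add_mul, mul_add, sub_mul, mul_sub, smul_mul_assoc, mul_smul_comm, cNumber_cMinus,
    (bNumber_cMinus K y).eq, (betaNumber_cMinus K y).eq, (gammaNumber_cMinus K y).eq]
  abel

theorem degreeOp_gammaMinus (y : ι × ℕ) :
    degreeOp K ι * gammaMinus K y = gammaMinus K y * degreeOp K ι + 2 • gammaMinus K y := by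
  rw [degreeOp_eq]
  simp only [add_mul, mul_add, sub_mul, mul_sub, smul_mul_assoc, mul_smul_comm,
    gammaNumber_gammaMinus, (bNumber_gammaMinus K y).eq, (betaNumber_gammaMinus K y).eq,
    (cNumber_gammaMinus K y).eq]
  abel

theorem degreeOp_bPlus (y : ι × ℕ) :
    degreeOp K ι * bPlus K y = bPlus K y * degreeOp K ι - bPlus K y := by
  rw [degreeOp_eq]
  simp only [add_mul, mul_add, sub_mul, mul_sub, smul_mul_assoc, mul_smul_comm, cNumber_bPlus,
    (bNumber_bPlus K y).eq, (betaNumber_bPlus K y).eq, (gammaNumber_bPlus K y).eq]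
  abel

theorem degreeOp_betaPlus (y : ι × ℕ) :
    degreeOp K ι * betaPlus K y = betaPlus K y * degreeOp K ι - 2 • betaPlus K y := by
  rw [degreeOp_eq]
  simp only [add_mul, mul_add, sub_mul, mul_sub, smul_mul_assoc, mul_smul_comm,
    gammaNumber_betaPlus, (bNumber_betaPlus K y).eq, (betaNumber_betaPlus K y).eq,
    (cNumber_betaPlus K y).eq]
  abel

theorem degreeOp_vac : degreeOp K ι (vac K ι) = 0 := by
  rw [degreeOp_eq]
  have h1 : cNumber K ι (vac K ι) = 0 := locSum_apply_eq_zero fun x => by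
    rw [Module.End.mul_apply, bBasis_vac, map_zero]
  have h2 : bNumber K ι (vac K ι) = 0 := locSum_apply_eq_zero fun x => by
    rw [Module.End.mul_apply, cBasis_vac, map_zero]
  have h3 : betaNumber K ι (vac K ι) = 0 := locSum_apply_eq_zero fun x => by
    rw [Module.End.mul_apply, gammaBasis_vac, map_zero]
  have h4 : gammaNumber K ι (vac K ι) = 0 := locSum_apply_eq_zero fun x => by
    rw [Module.End.mul_apply, betaBasis_vac, map_zero]
  simp [h1, h2, h3, h4]

theorem mem_weilDeg {p : ℤ} {v : Weil K ι} : v ∈ weilDeg K ι p ↔ degreeOp K ι v = p • v := by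
  rw [weilDeg, LinearMap.mem_ker, LinearMap.sub_apply, sub_eq_zero]
  rfl

theorem cMinus_mem_weilDeg (y : ι × ℕ) {p : ℤ} {v : Weil K ι} (hv : v ∈ weilDeg K ι p) :
    cMinus K y v ∈ weilDeg K ι (p + 1) := by
  rw [mem_weilDeg] at hv ⊢
  have h := LinearMap.congr_fun (degreeOp_cMinus (K := K) y) v
  simp only [Module.End.mul_apply, LinearMap.add_apply, hv, map_zsmul] at h
  rw [h, add_smul, one_smul]

theorem gammaMinus_mem_weilDeg (y : ι × ℕ) {p : ℤ} {v : Weil K ι} (hv : v ∈ weilDeg K ι p) :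
    gammaMinus K y v ∈ weilDeg K ι (p + 2) := by
  rw [mem_weilDeg] at hv ⊢
  have h := LinearMap.congr_fun (degreeOp_gammaMinus (K := K) y) v
  simp only [Module.End.mul_apply, LinearMap.add_apply, hv, map_zsmul, LinearMap.smul_apply] at h
  rw [h, add_smul, two_nsmul, two_zsmul]

theorem cGammaStates_graded (e : Module.Basis ι K g) :
    cGammaStates e ≤ ⨆ p, cGammaStates e ⊓ weilDeg K ι p := by
  refine cGammaStates_le e ?_ ?_ ?_
  · refine Submodule.mem_iSup_of_mem 0 ⟨vac_mem_cGammaStates e, ?_⟩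
    rw [SetLike.mem_coe, mem_weilDeg, degreeOp_vac, zero_smul]
  · intro x v hv
    have h : (⨆ p, cGammaStates e ⊓ weilDeg K ι p) ≤
        (⨆ p, cGammaStates e ⊓ weilDeg K ι p).comap (cMinus K x) := iSup_le fun p w hw =>
      Submodule.mem_iSup_of_mem (p + 1) ⟨cMinus_mem e x hw.1, cMinus_mem_weilDeg x hw.2⟩
    exact h hv
  · intro x v hv
    have h : (⨆ p, cGammaStates e ⊓ weilDeg K ι p) ≤
        (⨆ p, cGammaStates e ⊓ weilDeg K ι p).comap (gammaMinus K x) := iSup_le fun p w hw =>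
      Submodule.mem_iSup_of_mem (p + 2) ⟨gammaMinus_mem e x hw.1, gammaMinus_mem_weilDeg x hw.2⟩
    exact h hv

/-- The differential has degree `1` on `⟨c, γ⟩`, since it maps creation modes of the `c^{ξᵢ*}` to
creation modes of the `γ^{ξᵢ*}`. -/
theorem degreeOp_weilD [IsLieAbelian g] (e : Module.Basis ι K g) {v : Weil K ι}
    (hv : v ∈ cGammaStates e) :
    degreeOp K ι (weilD e v) = weilD e (degreeOp K ι v) + weilD e v := by
  have h : cGammaStates e ≤
      LinearMap.ker (degreeOp K ι * weilD e - weilD e * degreeOp K ι - weilD e) := by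
    refine cGammaStates_le e ?_ ?_ ?_
    · simp [weilD_vac, degreeOp_vac]
    · intro x v hv
      have hv' : degreeOp K ι (weilD e v) - weilD e (degreeOp K ι v) - weilD e v = 0 := hv
      have h1 : ∀ w, weilD e (cMinus K x w) = gammaMinus K x w - cMinus K x (weilD e w) :=
        fun w => eq_sub_of_add_eq (LinearMap.congr_fun (weilD_cMinus e x) w)
      have h2 : ∀ w, degreeOp K ι (cMinus K x w) = cMinus K x (degreeOp K ι w) + cMinus K x w :=
        LinearMap.congr_fun (degreeOp_cMinus x)
      have h3 : ∀ w, degreeOp K ι (gammaMinus K x w) =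
          gammaMinus K x (degreeOp K ι w) + 2 • gammaMinus K x w :=
        LinearMap.congr_fun (degreeOp_gammaMinus x)
      have hv'' := congrArg (cMinus K x) hv'
      rw [map_sub, map_sub, map_zero] at hv''
      rw [LinearMap.mem_ker, ← neg_zero, ← hv'']
      simp only [LinearMap.sub_apply, Module.End.mul_apply, h1, h2, map_sub, map_add, h3]
      abel
    · intro x v hv
      have hv' : degreeOp K ι (weilD e v) - weilD e (degreeOp K ι v) - weilD e v = 0 := hv
      have h1 : ∀ w, weilD e (gammaMinus K x w) = gammaMinus K x (weilD e w) :=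
        LinearMap.congr_fun (weilD_gammaBasis e x.1 (-x.2 - 1)).eq
      have h3 : ∀ w, degreeOp K ι (gammaMinus K x w) =
          gammaMinus K x (degreeOp K ι w) + 2 • gammaMinus K x w :=
        LinearMap.congr_fun (degreeOp_gammaMinus x)
      have hv'' := congrArg (gammaMinus K x) hv'
      rw [map_sub, map_sub, map_zero] at hv''
      rw [LinearMap.mem_ker, ← hv'']
      simp only [LinearMap.sub_apply, Module.End.mul_apply, h1, map_add, h3, map_nsmul]
      abel
  have := h hv
  rw [LinearMap.mem_ker, LinearMap.sub_apply, LinearMap.sub_apply, Module.End.mul_apply,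
    Module.End.mul_apply, sub_eq_zero, sub_eq_iff_eq_add'] at this
  exact this

theorem weightOp_cBasis_vac (i : ι) : weightOp K ι (cBasis K i (-1) (vac K ι)) = 0 := by
  classical
  have h1 : ∀ j (n : ℕ), cBasis K j n (cBasis K i (-1) (vac K ι)) = 0 := fun j n => by
    have := LinearMap.congr_fun (cBasis_anticomm (K := K) j i n (-1)) (vac K ι)
    simpa [cBasis_vac] using this
  have h2 : ∀ j (n : ℕ), gammaBasis K j n (cBasis K i (-1) (vac K ι)) = 0 := fun j n => by
    have := LinearMap.congr_fun (cBasis_gammaBasis_comm (K := K) i j (-1) n).eq (vac K ι)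
    simpa [gammaBasis_vac] using this.symm
  have h3 : ∀ j (n : ℕ), betaBasis K j n (cBasis K i (-1) (vac K ι)) = 0 := fun j n => by
    have := LinearMap.congr_fun (cBasis_betaBasis_comm (K := K) i j (-1) n).eq (vac K ι)
    simpa [betaBasis_vac] using this.symm
  have h4 : ∀ j (n : ℕ), n ≠ 0 → bBasis K j n (cBasis K i (-1) (vac K ι)) = 0 := fun j n hn => by
    have := LinearMap.congr_fun (bPlus_cMinus K (j, n) (i, 0)) (vac K ι)
    rw [if_neg (by simp [hn])] at this
    change (bBasis K j n * cBasis K i (-1) + cBasis K i (-1) * bBasis K j n) (vac K ι) = 0 at this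
    simpa [bBasis_vac] using this
  have h5 : ∀ j : ℕ, (1 + (j : ℤ)) - 1 = (j : ℕ) := fun j => by ring
  simp only [weightOp, omegaField, Pi.add_apply, Pi.neg_apply, Finset.sum_apply,
    LinearMap.add_apply, LinearMap.neg_apply, LinearMap.sum_apply]
  rw [Finset.sum_eq_zero, Finset.sum_eq_zero, neg_zero, add_zero]
  · intro j _
    rw [nthProd_neg_one]
    refine locSum_apply_eq_zero fun n => ?_
    simp only [LinearMap.add_apply, Module.End.mul_apply, LinearMap.smul_apply, derivField, h5, h2,
      h3, map_zero, smul_zero, add_zero]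
  · intro j _
    rw [nthProd_neg_one]
    refine locSum_apply_eq_zero fun n => ?_
    simp only [LinearMap.add_apply, Module.End.mul_apply, LinearMap.smul_apply, derivField, h5, h1,
      map_zero, smul_zero, zero_add]
    by_cases hn : n = 0
    · subst hn
      simp
    · rw [h4 j n hn, map_zero, smul_zero, smul_zero]

theorem state_cField_coord (e : Module.Basis ι K g) (i : ι) :
    state (vac K ι) (cField e (e.coord i)) = cBasis K i (-1) (vac K ι) := by
  rw [cField_coord]
  rfl

theorem state_cField_mem_weilGr (e : Module.Basis ι K g) (i : ι) :
    state (vac K ι) (cField e (e.coord i)) ∈ weilGr K ι (1, 1, 0) := by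
  rw [state_cField_coord]
  refine ⟨⟨?_, ?_⟩, ?_⟩
  · simp [weilParity_cBasis_vac, sgn]
  · exact cMinus_mem_weilDeg (K := K) (i, 0) (p := 0) (v := vac K ι)
      (by rw [mem_weilDeg, degreeOp_vac, zero_smul])
  · simp [weightOp_cBasis_vac]

/-- The relation `d_W c^{ξᵢ*}₍₋₁₎𝟏 = γ^{ξᵢ*}₍₋₁₎𝟏`, which on a module becomes
`[d, c^{ξᵢ*}(z)] = γ^{ξᵢ*}(z)`. -/
theorem state_gammaField_coord [IsLieAbelian g] (e : Module.Basis ι K g) (i : ι) :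
    state (vac K ι) (gammaField e (e.coord i)) =
      weilD e (state (vac K ι) (cField e (e.coord i))) := by
  have h := LinearMap.congr_fun (weilD_cMinus e (i, 0)) (vac K ι)
  rw [LinearMap.add_apply, Module.End.mul_apply, Module.End.mul_apply, weilD_vac, map_zero,
    add_zero] at h
  rw [state_cField_coord, gammaField_coord]
  exact h.symm

end Differential

/-! ### Operators on differential `sg[t]`-modules and chiral `W*`-modules -/

section SgModuleLemmas

variable {K g A : Type*} [Field K] [LieRing g] [LieAlgebra K g] [AddCommGroup A] [Module K A]

namespace SgModule

variable (M : SgModule K g A)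

/-- The operator acting on `gr q` as the integer `w q`. -/
def gradOp (w : ZMod 2 × ℤ × ℤ → ℤ) : Module.End K A :=
  (DirectSum.toModule K (ZMod 2 × ℤ × ℤ) A fun q => w q • (M.gr q).subtype) ∘ₗ
    (LinearEquiv.ofBijective (DirectSum.coeLinearMap M.gr) M.internal).symm.toLinearMap

theorem gradOp_apply (w : ZMod 2 × ℤ × ℤ → ℤ) {q : ZMod 2 × ℤ × ℤ} {a : A} (ha : a ∈ M.gr q) :
    M.gradOp w a = w q • a := by
  classical
  have h : (LinearEquiv.ofBijective (DirectSum.coeLinearMap M.gr) M.internal).symm a =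
      DirectSum.lof K _ (fun q => M.gr q) q ⟨a, ha⟩ := by
    exact (LinearEquiv.symm_apply_eq _).2 (DirectSum.coeLinearMap_of M.gr q ⟨a, ha⟩).symm
  rw [gradOp, LinearMap.comp_apply, LinearEquiv.coe_coe, h, DirectSum.toModule_lof]
  rfl

theorem iSup_gr : ⨆ q, M.gr q = ⊤ := M.internal.submodule_iSup_eq_top

theorem end_ext {f f' : Module.End K A} (h : ∀ q, ∀ a ∈ M.gr q, f a = f' a) : f = f' := by
  have h1 : (⊤ : Submodule K A) ≤ LinearMap.ker (f - f') := by
    rw [← M.iSup_gr]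
    exact iSup_le fun q a ha => by simp [h q a ha]
  ext a
  exact sub_eq_zero.1 (h1 (Submodule.mem_top (x := a)))

/-- The operator acting as `p` on the vectors of degree `p`. -/
def degOp : Module.End K A := M.gradOp fun q => q.2.1

theorem parity_apply {q : ZMod 2 × ℤ × ℤ} {a : A} (ha : a ∈ M.gr q) :
    M.parity a = sgn q.1 • a :=
  M.gradOp_apply (fun q => sgn q.1) ha

theorem degOp_apply {q : ZMod 2 × ℤ × ℤ} {a : A} (ha : a ∈ M.gr q) :
    M.degOp a = q.2.1 • a :=
  M.gradOp_apply (fun q => q.2.1) ha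

theorem sgn_add (s t : ZMod 2) : sgn (s + t) = sgn s * sgn t := by
  revert s t
  decide

theorem sgn_mul_self (s : ZMod 2) : sgn s * sgn s = 1 := by
  revert s
  decide

theorem parity_mul_self : M.parity * M.parity = 1 := M.end_ext fun q a ha => by
  rw [Module.End.mul_apply, M.parity_apply ha, map_zsmul, M.parity_apply ha, smul_smul,
    sgn_mul_self, one_smul]
  rfl

theorem parity_mul {q : ZMod 2 × ℤ × ℤ} {f : Module.End K A} (hf : IsHomog M.gr q f) :
    M.parity * f = sgn q.1 • (f * M.parity) := M.end_ext fun r a ha => by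
  rw [Module.End.mul_apply, M.parity_apply (hf r a ha), LinearMap.smul_apply,
    Module.End.mul_apply, M.parity_apply ha, map_zsmul, smul_smul, Prod.fst_add, sgn_add, mul_comm]

theorem parity_mul_odd {p n : ℤ} {f : Module.End K A} (hf : IsHomog M.gr (1, p, n) f) :
    M.parity * f = -(f * M.parity) := by
  rw [M.parity_mul hf, show sgn 1 = -1 from rfl, neg_one_smul]

theorem degOp_mul {q : ZMod 2 × ℤ × ℤ} {f : Module.End K A} (hf : IsHomog M.gr q f) :
    M.degOp * f = f * M.degOp + q.2.1 • f := M.end_ext fun r a ha => by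
  rw [Module.End.mul_apply, M.degOp_apply (hf r a ha), LinearMap.add_apply, LinearMap.smul_apply,
    Module.End.mul_apply, M.degOp_apply ha, map_zsmul, ← add_smul]
  rfl

theorem mem_inv {a : A} : a ∈ M.inv ↔ ∀ n ξ, M.L n ξ a = 0 := by
  simp [inv, Submodule.mem_iInf]

theorem mem_hor {a : A} : a ∈ M.hor ↔ ∀ n ξ, M.iota n ξ a = 0 := by
  simp [hor, Submodule.mem_iInf]

theorem mem_bas {a : A} : a ∈ M.bas ↔ (∀ n ξ, M.iota n ξ a = 0) ∧ ∀ n ξ, M.L n ξ a = 0 := by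
  rw [bas, Submodule.mem_inf, mem_hor, mem_inv]

/-- It suffices to test horizontality on a basis. -/
theorem mem_hor_iff_basis {ι : Type*} (e : Module.Basis ι K g) {a : A} :
    a ∈ M.hor ↔ ∀ x : ι × ℕ, M.iota x.2 (e x.1) a = 0 := by
  rw [mem_hor]
  refine ⟨fun h x => h _ _, fun h n ξ => ?_⟩
  have h1 : (LinearMap.applyₗ a ∘ₗ M.iota n : g →ₗ[K] A) = 0 := e.ext fun i => h (i, n)
  exact LinearMap.congr_fun h1 ξ

theorem d_mem_inv {a : A} (ha : a ∈ M.inv) : M.d a ∈ M.inv := by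
  rw [mem_inv] at ha ⊢
  intro n ξ
  have h := LinearMap.congr_fun (M.d_L n ξ) a
  simpa [ha] using h

theorem d_mem_bas {a : A} (ha : a ∈ M.bas) : M.d a ∈ M.bas := by
  refine ⟨?_, M.d_mem_inv ha.2⟩
  have ha' := M.mem_bas.1 ha
  rw [SetLike.mem_coe, mem_hor]
  intro n ξ
  have h := LinearMap.congr_fun (M.d_iota n ξ) a
  simpa [ha'.1, ha'.2] using h

theorem parity_mem_bas {a : A} (ha : a ∈ M.bas) : M.parity a ∈ M.bas := by
  rw [mem_bas] at ha ⊢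
  refine ⟨fun n ξ => ?_, fun n ξ => ?_⟩
  · have h := LinearMap.congr_fun (M.parity_mul_odd (M.iota_homog n ξ)) a
    simpa [ha.1] using h
  · have h := LinearMap.congr_fun (M.parity_mul (M.L_homog n ξ)) a
    simpa [ha.2, sgn] using h.symm

theorem parity_mem_inv {a : A} (ha : a ∈ M.inv) : M.parity a ∈ M.inv := by
  rw [mem_inv] at ha ⊢
  intro n ξ
  have h := LinearMap.congr_fun (M.parity_mul (M.L_homog n ξ)) a
  simpa [ha, sgn] using h.symm

theorem iota_mem_inv [IsLieAbelian g] (n : ℕ) (ξ : g) {a : A} (ha : a ∈ M.inv) :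
    M.iota n ξ a ∈ M.inv := by
  rw [mem_inv] at ha ⊢
  intro m η
  have h := LinearMap.congr_fun (M.L_iota m n η ξ) a
  rw [trivial_lie_zero g g η ξ, map_zero] at h
  simpa [ha] using h

theorem mem_deg_of_mem_gr {q : ZMod 2 × ℤ × ℤ} {a : A} (ha : a ∈ M.gr q) : a ∈ M.deg q.2.1 :=
  Submodule.mem_iSup_of_mem q.1 (Submodule.mem_iSup_of_mem q.2.2 ha)

theorem degOp_of_mem_deg {p : ℤ} {a : A} (ha : a ∈ M.deg p) : M.degOp a = p • a := by
  have h : M.deg p ≤ LinearMap.ker (M.degOp - p • 1) := iSup_le fun s => iSup_le fun n a ha => by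
    simp [M.degOp_apply ha]
  have := h ha
  rw [LinearMap.mem_ker, LinearMap.sub_apply, sub_eq_zero] at this
  exact this

theorem deg_map {q : ZMod 2 × ℤ × ℤ} {f : Module.End K A} (hf : IsHomog M.gr q f) {p : ℤ} {a : A}
    (ha : a ∈ M.deg p) : f a ∈ M.deg (p + q.2.1) := by
  have h : M.deg p ≤ (M.deg (p + q.2.1)).comap f := iSup_le fun s => iSup_le fun n a ha =>
    M.mem_deg_of_mem_gr (q := (s, p, n) + q) (hf _ a ha)
  exact h ha

/-- The common kernel of a family of homogeneous operators is graded. -/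
theorem graded_of_kernel {J : Type*} {f : J → Module.End K A}
    (hf : ∀ j, ∃ q, IsHomog M.gr q (f j)) {a : A} (ha : ∀ j, f j a = 0) :
    ∃ (s : Finset (ZMod 2 × ℤ × ℤ)) (b : ZMod 2 × ℤ × ℤ → A),
      a = ∑ q ∈ s, b q ∧ (∀ q, b q ∈ M.gr q) ∧ ∀ q j, f j (b q) = 0 := by
  classical
  obtain ⟨z, rfl⟩ := M.internal.2 a
  refine ⟨z.support, fun q => z q, ?_, fun q => (z q).2, fun q j => ?_⟩
  · exact DirectSum.coeAddMonoidHom_eq_dfinsuppSum M.gr z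
  · obtain ⟨r, hr⟩ := hf j
    have h1 : DirectSum.coeAddMonoidHom M.gr z = ∑ q ∈ z.support, (z q : A) :=
      DirectSum.coeAddMonoidHom_eq_dfinsuppSum M.gr z
    by_cases hq : q ∈ z.support
    · have h2 : ∑ q ∈ z.support, f j (z q) = 0 := by rw [← map_sum, ← h1]; exact ha j
      have h3 := M.internal.submodule_iSupIndep
      have h4 : iSupIndep fun q => M.gr (q + r) := h3.comp (add_left_injective r)
      have h6 := (iSupIndep_iff_finsetSum_eq_zero_imp_eq_zero _).1 h4
      exact h6 z.support (fun q => f j (z q)) (fun q _ => hr q _ (z q).2) h2 q hq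
    · change f j (z q : A) = 0
      rw [DFinsupp.notMem_support_iff.1 hq]
      simp

end SgModule

end SgModuleLemmas

section Locality

variable {K V : Type*} [Field K] [AddCommGroup V] [Module K V]

/-- The `n`-th products, `n ≥ 0`, of two fields with supercommuting modes vanish: the terms of the
product cancel in pairs `j`, `n - j`. -/
theorem nthProd_eq_zero {s t : ZMod 2} {A B : Modes K V}
    (h : ∀ m n, A m * B n = koszul s t • (B n * A m)) (n : ℕ) : nthProd s t n A B = 0 := by
  funext m
  have hz : ∀ j, j ∉ Finset.range (n + 1) → ((-1 : ℤ) ^ j * Ring.choose (n : ℤ) j) •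
      (A (n - j) * B (m + j) -
        (koszul s t * (((n : ℤ).negOnePow : ℤˣ) : ℤ)) • (B (m + n - j) * A j)) = 0 := by
    intro j hj
    rw [Ring.choose_natCast, Nat.choose_eq_zero_of_lt (by simpa using hj)]
    simp
  have hf : LocFin fun j : ℕ => ((-1 : ℤ) ^ j * Ring.choose (n : ℤ) j) •
      (A (n - j) * B (m + j) -
        (koszul s t * (((n : ℤ).negOnePow : ℤˣ) : ℤ)) • (B (m + n - j) * A j)) := fun v =>
    (Finset.range (n + 1)).finite_toSet.subset fun j hj => by
      by_contra h0
      exact hj (by simp only [hz j h0, LinearMap.zero_apply])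
  refine LinearMap.ext fun v => ?_
  change _ = (0 : V)
  rw [nthProd, locSum_apply_eq_sum hf fun j hj => by rw [hz j hj, LinearMap.zero_apply]]
  have h1 : ∀ j ∈ Finset.range (n + 1), (((-1 : ℤ) ^ j * Ring.choose (n : ℤ) j) •
      (A (n - j) * B (m + j) -
        (koszul s t * (((n : ℤ).negOnePow : ℤˣ) : ℤ)) • (B (m + n - j) * A j))) v =
      ((-1 : ℤ) ^ j * n.choose j * koszul s t) • B (m + j) (A (n - j) v) -
      ((-1 : ℤ) ^ (n - j) * n.choose (n - j) * koszul s t) •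
        B (m + (n - j : ℕ)) (A (n - (n - j : ℕ)) v) := by
    intro j hj
    have hj' : j ≤ n := by simpa [Nat.lt_succ_iff] using hj
    rw [h, Ring.choose_natCast, Nat.choose_symm hj']
    have e1 : m + ((n - j : ℕ) : ℤ) = m + n - j := by push_cast [hj']; ring
    have e2 : (n : ℤ) - ((n - j : ℕ) : ℤ) = j := by push_cast [hj']; ring
    have e3 : (-1 : ℤ) ^ (n - j) = (-1) ^ j * (-1) ^ n := by
      obtain ⟨k, rfl⟩ := Nat.exists_eq_add_of_le hj'
      rw [Nat.add_sub_cancel_left, pow_add, ← mul_assoc, ← pow_add, Even.neg_one_pow ⟨j, rfl⟩,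
        one_mul]
    rw [e1, e2, e3]
    have e4 : (((n : ℤ).negOnePow : ℤˣ) : ℤ) = (-1) ^ n := by
      rw [Int.negOnePow_def, zpow_natCast]
      simp
    rw [e4]
    simp only [LinearMap.smul_apply, LinearMap.sub_apply, Module.End.mul_apply, smul_sub, smul_smul]
    congr 2
    ring
  rw [Finset.sum_congr rfl h1, Finset.sum_sub_distrib, sub_eq_zero]
  have h2 := Finset.sum_range_reflect (fun j : ℕ =>
    ((-1 : ℤ) ^ j * n.choose j * koszul s t) • B (m + j) (A (n - j) v)) (n + 1)
  rw [← h2]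
  refine Finset.sum_congr rfl fun j _ => ?_
  rw [Nat.add_sub_cancel]

end Locality

namespace ChiralWStarModule

variable {K ι g A : Type*} [Field K] [Fintype ι] [LieRing g] [LieAlgebra K g]
  {e : Module.Basis ι K g} [AddCommGroup A] [Module K A] (M : ChiralWStarModule e A)

/-- If two fields in `⟨c, γ⟩` have supercommuting modes, then so do the vertex operators by which
they act on the module: their `n`-th products, `n ≥ 0`, vanish, so that the Borcherds identity
reduces to the vanishing of the supercommutators. -/
theorem Y_supercomm {s t : ZMod 2} (x : cGamma e s) (y : cGamma e t)
    (h : ∀ m n, x.1 m * y.1 n = koszul s t • (y.1 n * x.1 m)) (m n : ℤ) :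
    M.Y s x m * M.Y t y n = koszul s t • (M.Y t y n * M.Y s x m) := by
  refine LinearMap.ext fun a => ?_
  have h0 : ∀ j : ℕ, vsa.prod (0 + j : ℤ) x y = 0 := fun j => by
    refine Subtype.ext ?_
    rw [zero_add]
    exact nthProd_eq_zero h j
  have hB := M.Y_borcherds s t x y 0 m n a
  simp only [h0, map_zero] at hB
  rw [finsum_eq_zero_of_forall_eq_zero (fun j => by simp), finsum_eq_single _ 0] at hB
  · simp only [CharP.cast_eq_zero, pow_zero, Ring.choose_zero_right, mul_one, one_smul, add_zero,
      sub_zero, Int.negOnePow_zero, Units.val_one] at hB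
    exact sub_eq_zero.1 hB.symm
  · intro j hj
    rw [Ring.choose_zero_pos ℤ (Nat.pos_of_ne_zero hj), mul_zero, zero_smul]

/-- The operator `c^{ξᵢ*}₍₋ₙ₋₁₎` on the module, for `x = (i, n)`. -/
def cA (x : ι × ℕ) : Module.End K A := M.Y 1 (cElt e (e.coord x.1)) (-x.2 - 1)

/-- The operator `[d, c^{ξᵢ*}₍₋ₙ₋₁₎] = γ^{ξᵢ*}₍₋ₙ₋₁₎` on the module, for `x = (i, n)`. -/
def gammaA (x : ι × ℕ) : Module.End K A := M.d * M.cA x + M.cA x * M.d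

/-- The operator `ι_{ξᵢ,(n)}` on the module, for `x = (i, n)`. -/
def iotaA (x : ι × ℕ) : Module.End K A := M.iota x.2 (e x.1)

theorem cA_homog (x : ι × ℕ) : ∃ n, IsHomog M.gr (1, 1, n) (M.cA x) :=
  ⟨_, M.Y_homog 1 (cElt e (e.coord x.1)) 1 0 (state_cField_mem_weilGr e x.1) (-x.2 - 1)⟩

theorem parity_cA (x : ι × ℕ) : M.parity * M.cA x = -(M.cA x * M.parity) := by
  obtain ⟨n, hn⟩ := M.cA_homog x
  exact M.parity_mul_odd hn

theorem parity_d : M.parity * M.d = -(M.d * M.parity) := M.parity_mul_odd M.d_homog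

theorem parity_iotaA (x : ι × ℕ) : M.parity * M.iotaA x = -(M.iotaA x * M.parity) :=
  M.parity_mul_odd (M.iota_homog _ _)

theorem parity_gammaA (x : ι × ℕ) : Commute M.parity (M.gammaA x) := by
  unfold Commute SemiconjBy
  rw [gammaA, mul_add, add_mul, ← mul_assoc, ← mul_assoc, M.parity_d, M.parity_cA, neg_mul, neg_mul,
    mul_assoc, mul_assoc, M.parity_d, M.parity_cA, mul_neg, mul_neg, neg_neg, neg_neg, mul_assoc,
    mul_assoc]

theorem degOp_cA (x : ι × ℕ) : M.degOp * M.cA x = M.cA x * M.degOp + M.cA x := by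
  obtain ⟨n, hn⟩ := M.cA_homog x
  rw [M.degOp_mul hn, one_smul]

theorem degOp_d : M.degOp * M.d = M.d * M.degOp + M.d := by
  rw [M.degOp_mul M.d_homog, one_smul]

theorem degOp_gammaA (x : ι × ℕ) :
    M.degOp * M.gammaA x = M.gammaA x * M.degOp + 2 • M.gammaA x := by
  simp only [gammaA, mul_add, add_mul, ← mul_assoc, M.degOp_cA, M.degOp_d]
  simp only [mul_assoc, M.degOp_cA, M.degOp_d]
  noncomm_ring

theorem cA_anticomm (x y : ι × ℕ) : M.cA x * M.cA y + M.cA y * M.cA x = 0 := by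
  have h := M.Y_supercomm (cElt e (e.coord x.1)) (cElt e (e.coord y.1)) (fun m n => by
    change cField e _ m * cField e _ n = koszul 1 1 • (cField e _ n * cField e _ m)
    rw [cField_coord, cField_coord, show koszul 1 1 = -1 from rfl, neg_one_smul,
      ← add_eq_zero_iff_eq_neg, cBasis_anticomm]) (-x.2 - 1) (-y.2 - 1)
  rw [show koszul 1 1 = -1 from rfl, neg_one_smul, ← add_eq_zero_iff_eq_neg] at h
  exact h

/-- `γ^φ` as an element of the parity `1 + 1` part of `⟨c, γ⟩`; this is the form of the parity `0`
in which `d` applied to the odd element `c^φ` is given. -/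
def gammaElt' (e : Module.Basis ι K g) (φ : Module.Dual K g) : cGamma e (1 + 1) :=
  ⟨gammaField e φ, Generated.gen (Or.inr ⟨rfl, φ, rfl⟩)⟩

/-- The operator `[d, c^{ξᵢ*}₍₋ₙ₋₁₎]` is a mode of the vertex operator of `γ^{ξᵢ*}`, because
`d_W c^{ξᵢ*} = γ^{ξᵢ*}`. -/
theorem gammaA_eq [IsLieAbelian g] (x : ι × ℕ) :
    M.gammaA x = M.Y (1 + 1) (gammaElt' e (e.coord x.1)) (-x.2 - 1) := by
  have h := M.d_Y 1 (cElt e (e.coord x.1)) (gammaElt' e (e.coord x.1))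
    (state_gammaField_coord e x.1) (-x.2 - 1)
  rw [← h, show sgn 1 = -1 from rfl, neg_one_smul, sub_neg_eq_add]
  rfl

theorem gammaA_cA_comm [IsLieAbelian g] (x y : ι × ℕ) : Commute (M.gammaA x) (M.cA y) := by
  rw [gammaA_eq]
  have h := M.Y_supercomm (gammaElt' e (e.coord x.1)) (cElt e (e.coord y.1)) (fun m n => by
    change gammaField e _ m * cField e _ n = koszul (1 + 1) 1 • (cField e _ n * gammaField e _ m)
    rw [cField_coord, gammaField_coord, show koszul (1 + 1) 1 = 1 from rfl, one_smul,
      (cBasis_gammaBasis_comm _ _ _ _).eq]) (-x.2 - 1) (-y.2 - 1)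
  rw [show koszul (1 + 1) 1 = 1 from rfl, one_smul] at h
  exact h

open Classical in
theorem iotaA_cA (x y : ι × ℕ) :
    M.iotaA x * M.cA y + M.cA y * M.iotaA x = if x = y then 1 else 0 := by
  have h := M.iota_c x.2 (-y.2 - 1) (e x.1) (e.coord y.1)
  refine Eq.trans h ?_
  by_cases hxy : x = y
  · subst hxy
    rw [if_pos (show (x.2 : ℤ) + (-x.2 - 1) = -1 by ring), if_pos rfl]
    simp
  · rw [if_neg hxy]
    split_ifs with h1
    · have h2 : x.1 ≠ y.1 := fun h2 => hxy ((index_eq_iff x y).1 ⟨h2, h1⟩)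
      rw [Module.Basis.coord_apply, Module.Basis.repr_self, Finsupp.single_eq_of_ne' h2, zero_smul]
    · rfl

theorem iotaA_anticomm (x y : ι × ℕ) :
    M.iotaA x * M.iotaA y + M.iotaA y * M.iotaA x = 0 := M.iota_iota _ _ _ _

theorem L_cA_comm [IsLieAbelian g] (n : ℕ) (ξ : g) (x : ι × ℕ) : Commute (M.L n ξ) (M.cA x) := by
  have h := M.L_c n (-x.2 - 1) ξ (e.coord x.1)
  have h1 : coad ξ (e.coord x.1) = 0 := by
    ext η
    simp [coad, trivial_lie_zero]
  have h2 : cElt e (0 : Module.Dual K g) = 0 := Subtype.ext (by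
    change cField e 0 = 0
    simp [cField])
  rw [h1, h2, map_zero] at h
  exact sub_eq_zero.1 h

theorem L_gammaA_comm [IsLieAbelian g] (n : ℕ) (ξ : g) (x : ι × ℕ) :
    Commute (M.L n ξ) (M.gammaA x) := by
  have h1 : Commute (M.L n ξ) M.d := (sub_eq_zero.1 (M.d_L n ξ)).symm
  have h2 := M.L_cA_comm n ξ x
  exact (h1.mul_right h2).add_right (h2.mul_right h1)

/-- This follows from `[ι, [d, c]] = [L, c] - [d, [ι, c]]`, in which `[L, c] = 0` and `[ι, c]` is a
scalar. -/
theorem iotaA_gammaA_comm [IsLieAbelian g] (x y : ι × ℕ) :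
    Commute (M.iotaA x) (M.gammaA y) := by
  classical
  have h1 : M.iotaA x * M.d = M.L x.2 (e x.1) - M.d * M.iotaA x :=
    eq_sub_of_add_eq' (M.d_iota x.2 (e x.1))
  have h2 : M.iotaA x * M.cA y = (if x = y then 1 else 0) - M.cA y * M.iotaA x :=
    eq_sub_of_add_eq (M.iotaA_cA x y)
  have h3 := (M.L_cA_comm x.2 (e x.1) y).eq
  have h4 : M.d * (if x = y then (1 : Module.End K A) else 0) =
      (if x = y then 1 else 0) * M.d := by split_ifs <;> simp
  unfold Commute SemiconjBy
  rw [gammaA, mul_add, add_mul, ← mul_assoc, ← mul_assoc, h1, h2, sub_mul, sub_mul, mul_assoc,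
    mul_assoc, h1, h2, mul_sub, mul_sub, h3, h4, mul_assoc, mul_assoc]
  abel

theorem locFin_iotaA : LocFin M.iotaA := fun a => by
  obtain ⟨k, hk⟩ := M.continuous a
  refine (Finset.univ ×ˢ Finset.range k : Finset (ι × ℕ)).finite_toSet.subset fun x hx => ?_
  by_contra h
  have h' : k ≤ x.2 := by simpa using h
  exact hx (hk x.2 h' (e x.1)).2

theorem mem_bas_iff {a : A} : a ∈ M.bas ↔ a ∈ M.inv ∧ ∀ x, M.iotaA x a = 0 := by
  rw [SgModule.bas, Submodule.mem_inf, M.mem_hor_iff_basis e, and_comm]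
  rfl

theorem cA_mem_inv [IsLieAbelian g] (x : ι × ℕ) {a : A} (ha : a ∈ M.inv) : M.cA x a ∈ M.inv := by
  rw [SgModule.mem_inv] at ha ⊢
  intro n ξ
  have h := LinearMap.congr_fun (M.L_cA_comm n ξ x).eq a
  simpa [ha] using h

theorem gammaA_mem_bas [IsLieAbelian g] (x : ι × ℕ) {a : A} (ha : a ∈ M.bas) :
    M.gammaA x a ∈ M.bas := by
  rw [mem_bas_iff] at ha ⊢
  refine ⟨?_, fun y => ?_⟩
  · rw [SgModule.mem_inv]
    intro n ξ
    have h := LinearMap.congr_fun (M.L_gammaA_comm n ξ x).eq a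
    simpa [M.mem_inv.1 ha.1] using h
  · have h := LinearMap.congr_fun (M.iotaA_gammaA_comm y x).eq a
    simpa [ha.2] using h

theorem bas_graded : M.bas ≤ ⨆ p, M.bas ⊓ M.deg p := by
  intro a ha
  rw [SgModule.mem_bas] at ha
  obtain ⟨s, b, rfl, hb, hf⟩ := M.graded_of_kernel
    (f := fun x : (ℕ × g) ⊕ (ℕ × g) => Sum.elim (fun y => M.iota y.1 y.2) (fun y => M.L y.1 y.2) x)
    (by
      rintro (y | y)
      · exact ⟨_, M.iota_homog _ _⟩
      · exact ⟨_, M.L_homog _ _⟩)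
    (a := a) (by
      rintro (y | y)
      · exact ha.1 _ _
      · exact ha.2 _ _)
  refine Submodule.sum_mem _ fun q _ => Submodule.mem_iSup_of_mem q.2.1 ⟨?_, ?_⟩
  · exact M.mem_bas.2 ⟨fun n ξ => hf q (Sum.inl (n, ξ)), fun n ξ => hf q (Sum.inr (n, ξ))⟩
  · exact M.mem_deg_of_mem_gr (hb q)

end ChiralWStarModule

/-! ### Tensor products of subspaces, graded subspaces -/

section TensorLemmas

variable {K V W : Type*} [Field K] [AddCommGroup V] [Module K V] [AddCommGroup W] [Module K W]
  {J : Type*}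

/-- The subspace `P ⊗ Q` of `V ⊗ W`. -/
abbrev tens (P : Submodule K V) (Q : Submodule K W) : Submodule K (V ⊗[K] W) :=
  Submodule.map₂ (TensorProduct.mk K V W) P Q

theorem tmul_mem_tens {P : Submodule K V} {Q : Submodule K W} {v : V} {w : W} (hv : v ∈ P)
    (hw : w ∈ Q) : v ⊗ₜ[K] w ∈ tens P Q :=
  Submodule.apply_mem_map₂ _ hv hw

theorem tens_le {P : Submodule K V} {Q : Submodule K W} {q : Submodule K (V ⊗[K] W)}
    (h : ∀ v ∈ P, ∀ w ∈ Q, v ⊗ₜ[K] w ∈ q) : tens P Q ≤ q :=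
  Submodule.map₂_le.2 h

theorem tens_mono {P P' : Submodule K V} {Q Q' : Submodule K W} (h : P ≤ P') (h' : Q ≤ Q') :
    tens P Q ≤ tens P' Q' :=
  Submodule.map₂_le_map₂ h h'

theorem map_mem_tens {P P' : Submodule K V} {Q Q' : Submodule K W} {f : Module.End K V}
    {g : Module.End K W} (hf : ∀ v ∈ P, f v ∈ P') (hg : ∀ w ∈ Q, g w ∈ Q') {x : V ⊗[K] W}
    (hx : x ∈ tens P Q) : TensorProduct.map f g x ∈ tens P' Q' := by
  have h : tens P Q ≤ (tens P' Q').comap (TensorProduct.map f g) := tens_le fun v hv w hw => by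
    rw [Submodule.mem_comap, TensorProduct.map_tmul]
    exact tmul_mem_tens (hf v hv) (hg w hw)
  exact h hx

theorem locFin_map_right (f : J → Module.End K V) {g : J → Module.End K W} (hg : LocFin g) :
    LocFin fun j => (TensorProduct.map (f j) (g j) : Module.End K (V ⊗[K] W)) := fun x => by
  induction x with
  | zero => simp
  | add x y hx hy =>
    refine (hx.union hy).subset fun j hj => ?_
    by_contra h
    simp only [Set.mem_union, Function.mem_support, not_or, not_not] at h
    exact hj (by simp only [map_add, h.1, h.2, add_zero])
  | tmul v w =>
    refine (hg w).subset fun j hj h => hj ?_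
    simp only at h
    simp only [TensorProduct.map_tmul, h, TensorProduct.tmul_zero]

theorem locFin_map_left {f : J → Module.End K V} (g : J → Module.End K W) (hf : LocFin f) :
    LocFin fun j => (TensorProduct.map (f j) (g j) : Module.End K (V ⊗[K] W)) := fun x => by
  induction x with
  | zero => simp
  | add x y hx hy =>
    refine (hx.union hy).subset fun j hj => ?_
    by_contra h
    simp only [Set.mem_union, Function.mem_support, not_or, not_not] at h
    exact hj (by simp only [map_add, h.1, h.2, add_zero])
  | tmul v w =>
    refine (hf v).subset fun j hj h => hj ?_
    simp only at h
    simp only [TensorProduct.map_tmul, h, TensorProduct.zero_tmul]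

/-- The common kernel of operators `f ⊗ 1` on `P ⊗ Q` is the tensor product of the common
kernel of the operators `f` on `P` with `Q`. -/
theorem mem_tens_of_map_left {P P' : Submodule K V} {Q : Submodule K W} {f : J → Module.End K V}
    (hP' : ∀ v ∈ P, (∀ j, f j v = 0) → v ∈ P') {x : V ⊗[K] W} (hx : x ∈ tens P Q)
    (h : ∀ j, TensorProduct.map (f j) (1 : Module.End K W) x = 0) : x ∈ tens P' Q := by
  classical
  let b := Module.Basis.ofVectorSpace K Q
  obtain ⟨π, hπ⟩ := Q.subtype.exists_leftInverse_of_injective Q.ker_subtype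
  have hπ' : ∀ q : Q, π q = q := LinearMap.congr_fun hπ
  -- the coefficient of a tensor at a basis vector of `Q`
  let E := fun k => (TensorProduct.rid K V).toLinearMap ∘ₗ
    TensorProduct.map (LinearMap.id : V →ₗ[K] V) (b.coord k ∘ₗ π)
  have hE : ∀ k v w, E k (v ⊗ₜ[K] w) = b.coord k (π w) • v := fun k v w => by simp [E]
  have h1 : ∀ k, E k x ∈ P := fun k => by
    have : tens P Q ≤ P.comap (E k) := tens_le fun v hv w _ => by
      rw [Submodule.mem_comap, hE]
      exact P.smul_mem _ hv
    exact this hx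
  have h2 : ∀ k j, f j (E k x) = 0 := fun k j => by
    have h3 : f j ∘ₗ E k = E k ∘ₗ TensorProduct.map (f j) (1 : Module.End K W) :=
      TensorProduct.ext' fun v w => by simp [hE]
    have h4 := LinearMap.congr_fun h3 x
    exact h4.trans ((congrArg (E k) (h j)).trans (map_zero _))
  -- a tensor is recovered from its coefficients; all large enough index sets are allowed, so that
  -- the condition is additive
  have h5 : ∃ s : Finset _, x = ∑ k ∈ s, E k x ⊗ₜ[K] (b k : W) := by
    let q : Submodule K (V ⊗[K] W) :=
      { carrier := {x | ∃ s₀ : Finset _, ∀ s, s₀ ⊆ s → x = ∑ k ∈ s, E k x ⊗ₜ[K] (b k : W)}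
        zero_mem' := ⟨∅, fun s _ => by simp⟩
        add_mem' := by
          rintro y z ⟨s, hs⟩ ⟨t, ht⟩
          refine ⟨s ∪ t, fun r hr => ?_⟩
          conv_lhs => rw [hs r (Finset.union_subset_left hr), ht r (Finset.union_subset_right hr)]
          simp only [map_add, TensorProduct.add_tmul, Finset.sum_add_distrib]
        smul_mem' := by
          rintro a y ⟨s, hs⟩
          refine ⟨s, fun r hr => ?_⟩
          conv_lhs => rw [hs r hr]
          simp only [map_smul, Finset.smul_sum, TensorProduct.smul_tmul'] }
    have hq : tens P Q ≤ q := tens_le fun v _ w hw => by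
      refine ⟨(b.repr ⟨w, hw⟩).support, fun s hs => ?_⟩
      have h6 : w = ∑ k ∈ s, b.repr ⟨w, hw⟩ k • (b k : W) := by
        have h7 := congrArg Subtype.val (b.linearCombination_repr ⟨w, hw⟩)
        rw [Finsupp.linearCombination_apply, Finsupp.sum_of_support_subset _ hs _ (by simp)] at h7
        simpa using h7.symm
      have h8 : π w = ⟨w, hw⟩ := hπ' ⟨w, hw⟩
      simp only [hE, h8, Module.Basis.coord_apply]
      conv_lhs => rw [h6]
      rw [TensorProduct.tmul_sum]
      exact Finset.sum_congr rfl fun k _ => by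
        rw [TensorProduct.tmul_smul, TensorProduct.smul_tmul']
    obtain ⟨s, hs⟩ := hq hx
    exact ⟨s, hs s subset_rfl⟩
  obtain ⟨s, hs⟩ := h5
  rw [hs]
  exact Submodule.sum_mem _ fun k _ => tmul_mem_tens (hP' _ (h1 k) (h2 k)) (b k).2

theorem comm_mem_tens {P : Submodule K V} {Q : Submodule K W} {x : V ⊗[K] W} (hx : x ∈ tens P Q) :
    TensorProduct.comm K V W x ∈ tens Q P := by
  have h : tens P Q ≤ (tens Q P).comap (TensorProduct.comm K V W).toLinearMap :=
    tens_le fun v hv w hw => by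
      rw [Submodule.mem_comap, LinearEquiv.coe_coe, TensorProduct.comm_tmul]
      exact tmul_mem_tens hw hv
  exact h hx

/-- The common kernel of operators `1 ⊗ g` on `P ⊗ Q` is the tensor product of `P` with the common
kernel of the operators `g` on `Q`. -/
theorem mem_tens_of_map_right {P : Submodule K V} {Q Q' : Submodule K W} {g : J → Module.End K W}
    (hQ' : ∀ w ∈ Q, (∀ j, g j w = 0) → w ∈ Q') {x : V ⊗[K] W} (hx : x ∈ tens P Q)
    (h : ∀ j, TensorProduct.map (1 : Module.End K V) (g j) x = 0) : x ∈ tens P Q' := by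
  have h1 : TensorProduct.comm K V W x ∈ tens Q' P := by
    refine mem_tens_of_map_left hQ' (comm_mem_tens hx) fun j => ?_
    rw [TensorProduct.map_comm, h j, map_zero]
  have h2 := comm_mem_tens h1
  rwa [TensorProduct.comm_comm] at h2

end TensorLemmas

section Graded

variable {K V : Type*} [Field K] [AddCommGroup V] [Module K V]

theorem iSupIndep_integer_eigenspaces [CharZero K] (f : Module.End K V) :
    iSupIndep fun p : ℤ => LinearMap.ker (f - p • (1 : Module.End K V)) := by
  have h := (Module.End.eigenspaces_iSupIndep f).comp (Int.cast_injective (α := K))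
  refine h.mono fun p x hx => ?_
  rw [LinearMap.mem_ker, LinearMap.sub_apply, sub_eq_zero] at hx
  rw [Function.comp_apply, Module.End.mem_eigenspace_iff, hx, Int.cast_smul_eq_zsmul]
  rfl

/-- In a direct sum of subspaces `q p` of independent spaces `r p`, the vectors of `r p` lie in
`q p`. -/
theorem mem_of_mem_iSup {q r : ℤ → Submodule K V} (hqr : ∀ p, q p ≤ r p) (hr : iSupIndep r)
    {x : V} {p : ℤ} (hx : x ∈ ⨆ p, q p) (hxp : x ∈ r p) : x ∈ q p := by
  have h1 : ⨆ p, q p ≤ q p ⊔ ⨆ j, ⨆ (_ : j ≠ p), q j := iSup_le fun j => by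
    by_cases h : j = p
    · subst h
      exact le_sup_left
    · exact le_sup_of_le_right (le_iSup₂_of_le j h le_rfl)
  obtain ⟨a, ha, b, hb, rfl⟩ := Submodule.mem_sup.1 (h1 hx)
  have hb1 : b ∈ r p := by simpa using sub_mem hxp (hqr p ha)
  have hb2 : b ∈ ⨆ j, ⨆ (_ : j ≠ p), r j := iSup₂_mono (fun j _ => hqr j) hb
  have hb0 : b = 0 := by
    have := (hr p).le_bot ⟨hb1, hb2⟩
    simpa using this
  rw [hb0, add_zero]
  exact ha

end Graded

section OddPairs

theorem odd_pair_commute {R : Type*} [Ring R] {a b c d : R} (hac : a * c + c * a = 0)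
    (had : a * d + d * a = 0) (hbc : b * c + c * b = 0) (hbd : b * d + d * b = 0) :
    Commute (a * b) (c * d) := by
  have h1 := mul_commutator_odd a b c
  have h2 := mul_commutator_odd a b d
  rw [hac, hbc, mul_zero, zero_mul, sub_zero, sub_eq_zero] at h1
  rw [had, hbd, mul_zero, zero_mul, sub_zero, sub_eq_zero] at h2
  exact Commute.mul_right h1 h2

theorem odd_pair_sq {R : Type*} [Ring R] {a b : R} (hab : a * b + b * a = 0) (hb : b * b = 0) :
    a * b * (a * b) = 0 := by
  rw [mul_assoc, ← mul_assoc b, eq_neg_of_add_eq_zero_right hab, neg_mul, mul_assoc, hb, mul_zero,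
    neg_zero, mul_zero]

variable {K V : Type*} [Field K] [AddCommGroup V] [Module K V]

/-- A locally finite sum of operators which shift the eigenvalues of `T` by `k` shifts them by
`k`. -/
theorem locSum_graded {J : Type*} {f : J → Module.End K V} (hf : LocFin f) {T : Module.End K V}
    (k : ℤ) (h : ∀ j, T * f j = f j * T + k • f j) :
    T * locSum f = locSum f * T + k • locSum f := by
  have hk : LocFin fun j => (k • 1 : Module.End K V) * f j := hf.mul_left _
  have h1 : ∀ F : Module.End K V, k • F = (k • 1) * F := fun F => by rw [smul_mul_assoc, one_mul]
  rw [h1, mul_locSum hf, mul_locSum hf, locSum_mul hf, ← locSum_add (hf.mul_right T) hk]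
  congr 1
  funext j
  rw [h, h1]

variable [CharZero K]

theorem mul_self_eq_zero_of_anticomm {b : Module.End K V} (h : b * b + b * b = 0) : b * b = 0 := by
  have h2 : (2 : K) • (b * b) = 0 := by rw [two_smul, h]
  exact (smul_eq_zero.1 h2).resolve_left two_ne_zero

/-- A locally finite sum of products of pairwise anticommuting operators is locally nilpotent. -/
theorem locNilp_locSum_odd {J : Type*} {a b : J → Module.End K V}
    (hf : LocFin fun j => a j * b j) (haa : ∀ i j, a i * a j + a j * a i = 0)
    (hab : ∀ i j, a i * b j + b j * a i = 0) (hbb : ∀ i j, b i * b j + b j * b i = 0) :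
    LocNilp (locSum fun j => a j * b j) :=
  locNilp_locSum hf
    (fun i j => odd_pair_commute (haa i j) (hab i j) (by rw [add_comm, hab]) (hbb i j))
    fun j => odd_pair_sq (hab j j) (mul_self_eq_zero_of_anticomm (hbb j j))

/-- If `U = -[f, T]` commutes with `f`, then `T exp(f) = exp(f) (T + U)`. -/
theorem mul_locExp {f T U : Module.End K V} (hf : LocNilp f) (h : f * T = T * f + -U)
    (hU : Commute f U) : T * locExp f = locExp f * (T + U) := by
  have h1 : locExp f * T = (T + -U) * locExp f :=
    locExp_mul hf (by rw [h]; abel) (by rw [mul_neg, neg_mul, hU.eq])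
  have h2 : locExp f * U = (U + 0) * locExp f :=
    locExp_mul hf (by rw [hU.eq, sub_self]) (by simp)
  rw [mul_add, h1, h2, ← add_mul, add_zero, neg_add_cancel_right]

theorem locExp_neg_mul {f T U : Module.End K V} (hf : LocNilp f) (h : f * T = T * f + -U)
    (hU : Commute f U) : locExp (-f) * T = (T + U) * locExp (-f) :=
  locExp_mul hf.neg (by rw [neg_mul, mul_neg, h]; abel) (by rw [neg_mul, mul_neg, hU.eq])

end OddPairs

/-! ### The space of the small chiral Cartan model -/

namespace ChiralWStarModule

section TensorOperators

variable {K ι A : Type*} [Field K] [AddCommGroup A] [Module K A]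

/-- The operator `f ⊗ 1` on `A ⊗ W`. -/
def leftOp (f : Module.End K A) : Module.End K (A ⊗[K] Weil K ι) := TensorProduct.map f 1

/-- The operator `1 ⊗ f` on `A ⊗ W`, for an even operator `f`. -/
def rightEven (f : Module.End K (Weil K ι)) : Module.End K (A ⊗[K] Weil K ι) :=
  TensorProduct.map 1 f

@[simp] theorem leftOp_tmul (f : Module.End K A) (a : A) (w : Weil K ι) :
    leftOp f (a ⊗ₜ[K] w) = f a ⊗ₜ w := rfl

@[simp] theorem rightEven_tmul (f : Module.End K (Weil K ι)) (a : A) (w : Weil K ι) :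
    rightEven f (a ⊗ₜ[K] w) = a ⊗ₜ f w := rfl

theorem leftOp_anticomm {f f' : Module.End K A} {u : Module.End K A} (h : f * f' + f' * f = u) :
    (leftOp f * leftOp f' + leftOp f' * leftOp f : Module.End K (A ⊗[K] Weil K ι)) = leftOp u :=
  TensorProduct.ext' fun a w => by
    simp [← h, TensorProduct.add_tmul]

theorem leftOp_rightEven_comm (f : Module.End K A) (f' : Module.End K (Weil K ι)) :
    Commute (leftOp f) (rightEven f') :=
  TensorProduct.ext' fun a w => by simp

theorem leftOp_comm {f f' : Module.End K A} (h : Commute f f') :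
    Commute (leftOp f : Module.End K (A ⊗[K] Weil K ι)) (leftOp f') :=
  TensorProduct.ext' fun a w => by
    have h : f (f' a) = f' (f a) := LinearMap.congr_fun h.eq a
    simp [h]

theorem leftOp_zero : leftOp (0 : Module.End K A) = (0 : Module.End K (A ⊗[K] Weil K ι)) :=
  TensorProduct.map_zero_left _

theorem rightEven_zero :
    rightEven (0 : Module.End K (Weil K ι)) = (0 : Module.End K (A ⊗[K] Weil K ι)) :=
  TensorProduct.map_zero_right _

theorem locFin_rightEven {J : Type*} {f : J → Module.End K (Weil K ι)} (hf : LocFin f) :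
    LocFin fun j => (rightEven (f j) : Module.End K (A ⊗[K] Weil K ι)) :=
  locFin_map_right _ hf

end TensorOperators

variable {K ι g A : Type*} [Field K] [Fintype ι] [LieRing g] [LieAlgebra K g]
  {e : Module.Basis ι K g} [AddCommGroup A] [Module K A] (M : ChiralWStarModule e A)

/-- The operator `1 ⊗ f` on `A ⊗ W`, for an odd operator `f`; the parity operator of `A` implements
the Koszul sign. -/
def rightOdd (f : Module.End K (Weil K ι)) : Module.End K (A ⊗[K] Weil K ι) :=
  TensorProduct.map M.parity f

@[simp] theorem rightOdd_tmul (f : Module.End K (Weil K ι)) (a : A) (w : Weil K ι) :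
    M.rightOdd f (a ⊗ₜ[K] w) = M.parity a ⊗ₜ f w := rfl

theorem parity_parity (a : A) : M.parity (M.parity a) = a :=
  LinearMap.congr_fun M.parity_mul_self a

theorem rightOdd_anticomm {f f' u : Module.End K (Weil K ι)} (h : f * f' + f' * f = u) :
    M.rightOdd f * M.rightOdd f' + M.rightOdd f' * M.rightOdd f = rightEven u :=
  TensorProduct.ext' fun a w => by
    simp [← h, TensorProduct.tmul_add, M.parity_parity]

theorem leftOp_rightOdd_anticomm {f : Module.End K A} (hf : M.parity * f = -(f * M.parity))
    (f' : Module.End K (Weil K ι)) :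
    leftOp f * M.rightOdd f' + M.rightOdd f' * leftOp f = 0 :=
  TensorProduct.ext' fun a w => by
    have h : M.parity (f a) = -f (M.parity a) := LinearMap.congr_fun hf a
    simp [h, TensorProduct.neg_tmul]

theorem leftOp_rightOdd_comm {f : Module.End K A} (hf : Commute M.parity f)
    (f' : Module.End K (Weil K ι)) : Commute (leftOp f) (M.rightOdd f') :=
  TensorProduct.ext' fun a w => by
    have h : M.parity (f a) = f (M.parity a) := LinearMap.congr_fun hf.eq a
    simp [h]

theorem rightOdd_rightEven_comm {f f' : Module.End K (Weil K ι)} (h : Commute f f') :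
    Commute (M.rightOdd f) (rightEven f') :=
  TensorProduct.ext' fun a w => by
    have h : f (f' w) = f' (f w) := LinearMap.congr_fun h.eq w
    simp [h]

/-- The operators `c^{ξᵢ*,A}₍₋ₙ₋₁₎ ⊗ 1`. -/
abbrev opC (x : ι × ℕ) : Module.End K (A ⊗[K] Weil K ι) := leftOp (M.cA x)

/-- The operators `ι_{ξᵢ,(n)} ⊗ 1`. -/
abbrev opI (x : ι × ℕ) : Module.End K (A ⊗[K] Weil K ι) := leftOp (M.iotaA x)

/-- The operators `1 ⊗ b^{ξᵢ}₍ₙ₎`. -/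
abbrev opB (x : ι × ℕ) : Module.End K (A ⊗[K] Weil K ι) := M.rightOdd (bPlus K x)

/-- The operators `1 ⊗ c^{ξᵢ*}₍₋ₙ₋₁₎`. -/
abbrev opCW (x : ι × ℕ) : Module.End K (A ⊗[K] Weil K ι) := M.rightOdd (cMinus K x)

theorem opC_opC (x y : ι × ℕ) : M.opC x * M.opC y + M.opC y * M.opC x = 0 := by
  rw [leftOp_anticomm (M.cA_anticomm x y), leftOp_zero]

theorem opI_opI (x y : ι × ℕ) : M.opI x * M.opI y + M.opI y * M.opI x = 0 := by
  rw [leftOp_anticomm (M.iotaA_anticomm x y), leftOp_zero]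

open Classical in
theorem opI_opC (x y : ι × ℕ) :
    M.opI x * M.opC y + M.opC y * M.opI x = if x = y then 1 else 0 := by
  rw [leftOp_anticomm (M.iotaA_cA x y)]
  split_ifs
  · exact TensorProduct.map_one
  · exact leftOp_zero

theorem opB_opB (x y : ι × ℕ) : M.opB x * M.opB y + M.opB y * M.opB x = 0 := by
  rw [M.rightOdd_anticomm (bBasis_anticomm _ _ _ _), rightEven_zero]

theorem opCW_opCW (x y : ι × ℕ) : M.opCW x * M.opCW y + M.opCW y * M.opCW x = 0 := by
  rw [M.rightOdd_anticomm (cBasis_anticomm _ _ _ _), rightEven_zero]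

open Classical in
theorem opB_opCW (x y : ι × ℕ) :
    M.opB x * M.opCW y + M.opCW y * M.opB x = if x = y then 1 else 0 := by
  rw [M.rightOdd_anticomm (bPlus_cMinus K x y)]
  split_ifs
  · exact TensorProduct.map_one
  · exact rightEven_zero

theorem opC_opB (x y : ι × ℕ) : M.opC x * M.opB y + M.opB y * M.opC x = 0 :=
  M.leftOp_rightOdd_anticomm (M.parity_cA x) _

theorem opI_opB (x y : ι × ℕ) : M.opI x * M.opB y + M.opB y * M.opI x = 0 :=
  M.leftOp_rightOdd_anticomm (M.parity_iotaA x) _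

theorem opI_opCW (x y : ι × ℕ) : M.opI x * M.opCW y + M.opCW y * M.opI x = 0 :=
  M.leftOp_rightOdd_anticomm (M.parity_iotaA x) _

theorem locFin_rightOdd {J : Type*} {f : J → Module.End K (Weil K ι)} (hf : LocFin f) :
    LocFin fun j => M.rightOdd (f j) :=
  locFin_map_right _ hf

theorem locFin_opB : LocFin M.opB := M.locFin_rightOdd (locFin_bBasis K ι)

theorem locFin_opI : LocFin M.opI := locFin_map_left _ M.locFin_iotaA

theorem phiAW_eq : M.phiAW = locSum fun x => M.opC x * M.opB x := by
  rw [phiAW, phiOp]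
  congr 1
  funext x
  exact TensorProduct.ext' fun a w => rfl

theorem locFin_opC_opB : LocFin fun x => M.opC x * M.opB x := M.locFin_opB.mul_left _

/-- The exponent `∑ c^{ξᵢ*}₍₋ₙ₋₁₎ ⊗ ι_{ξᵢ,(n)}` of `Φ_{W,A}`, transported to `A ⊗ W` by the
switching map. -/
def phiWASwitch : Module.End K (A ⊗[K] Weil K ι) := locSum fun x => M.opCW x * M.opI x

theorem locFin_opCW_opI : LocFin fun x => M.opCW x * M.opI x := M.locFin_opI.mul_left _

theorem phiAW_opI (y : ι × ℕ) : M.phiAW * M.opI y = M.opI y * M.phiAW + -M.opB y := by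
  classical
  rw [phiAW_eq]
  refine locSum_commutator_single M.locFin_opC_opB y fun x => ?_
  rw [mul_commutator_odd, add_comm (M.opB x * _), opI_opB, add_comm (M.opC x * _), opI_opC]
  by_cases h : x = y
  · simp [h]
  · simp [h, Ne.symm h]

theorem phiAW_opB (y : ι × ℕ) : Commute M.phiAW (M.opB y) := by
  rw [phiAW_eq]
  refine locSum_commute M.locFin_opC_opB fun x => sub_eq_zero.1 ?_
  rw [mul_commutator_odd, opB_opB, opC_opB, mul_zero, zero_mul, sub_zero]

theorem phiWASwitch_opB (y : ι × ℕ) :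
    M.phiWASwitch * M.opB y = M.opB y * M.phiWASwitch + -M.opI y := by
  classical
  refine locSum_commutator_single M.locFin_opCW_opI y fun x => ?_
  rw [mul_commutator_odd, opI_opB, add_comm (M.opCW x * _), opB_opCW]
  by_cases h : x = y
  · simp [h]
  · simp [h, Ne.symm h]

theorem phiWASwitch_opI (y : ι × ℕ) : Commute M.phiWASwitch (M.opI y) := by
  refine locSum_commute M.locFin_opCW_opI fun x => sub_eq_zero.1 ?_
  rw [mul_commutator_odd, opI_opI, add_comm (M.opCW x * _), opI_opCW, mul_zero, zero_mul, sub_zero]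

theorem switch_tmul (w : Weil K ι) (a : A) : M.switch (w ⊗ₜ a) =
    (2 : K)⁻¹ • ((a + M.parity a) ⊗ₜ w + (a - M.parity a) ⊗ₜ weilParity K ι w) := by
  simp [switch]

theorem phiWA_factor (x : ι × ℕ) :
    (TensorProduct.map (cBasis K x.1 (-x.2 - 1) * weilParity K ι) (M.iotaA x) :
      Module.End K (Weil K ι ⊗[K] A)) =
    TensorProduct.map (cMinus K x) 1 * TensorProduct.map (weilParity K ι) (M.iotaA x) :=
  TensorProduct.ext' fun _ _ => rfl

theorem locFin_phiWA : LocFin fun x : ι × ℕ =>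
    (TensorProduct.map (cBasis K x.1 (-x.2 - 1) * weilParity K ι) (M.iotaA x) :
      Module.End K (Weil K ι ⊗[K] A)) :=
  locFin_map_right _ M.locFin_iotaA

/-- The modes of the `c^{ξᵢ*}` on the module commute with the operators `L_{ξ,(n)}`, so that the
exponent of `Φ_{A,W}` preserves `A_inv ⊗ ⟨c, γ⟩`. -/
theorem phiAW_mem [IsLieAbelian g] {x : A ⊗[K] Weil K ι} (hx : x ∈ tens M.inv (cGammaStates e)) :
    M.phiAW x ∈ tens M.inv (cGammaStates e) := by
  rw [phiAW_eq]
  refine locSum_mem fun y => ?_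
  exact map_mem_tens (fun a ha => M.cA_mem_inv y ha) (fun w hw => hw)
    (map_mem_tens (fun a ha => M.parity_mem_inv ha) (fun w hw => bPlus_mem e y hw) hx)

theorem phiWASwitch_mem [IsLieAbelian g] {x : A ⊗[K] Weil K ι}
    (hx : x ∈ tens M.inv (cGammaStates e)) : M.phiWASwitch x ∈ tens M.inv (cGammaStates e) := by
  refine locSum_mem fun y => ?_
  exact map_mem_tens (fun a ha => M.parity_mem_inv ha) (fun w hw => cMinus_mem e y hw)
    (map_mem_tens (fun a ha => M.iota_mem_inv _ _ ha) (fun w hw => hw) hx)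

/-- The switching map carries the exponent of `Φ_{W,A}` to `phiWASwitch`. -/
theorem switch_phiWA (v : Weil K ι ⊗[K] A) :
    M.switch (M.phiWA v) = M.phiWASwitch (M.switch v) := by
  refine comp_locSum M.locFin_phiWA M.locFin_opCW_opI M.switch (fun x v => ?_) v
  have h : M.switch ∘ₗ TensorProduct.map (cBasis K x.1 (-x.2 - 1) * weilParity K ι) (M.iotaA x) =
      (M.opCW x * M.opI x) ∘ₗ M.switch := by
    refine TensorProduct.ext' fun w a => ?_
    have h1 : weilParity K ι (cMinus K x w) = -cMinus K x (weilParity K ι w) :=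
      LinearMap.congr_fun (weilParity_cBasis _ _) w
    have h2 : weilParity K ι (cMinus K x (weilParity K ι w)) = -cMinus K x w := by
      have h3 : weilParity K ι (cMinus K x (weilParity K ι w)) =
        -cMinus K x (weilParity K ι (weilParity K ι w)) :=
        LinearMap.congr_fun (weilParity_cBasis _ _) _
      rw [h3, show weilParity K ι (weilParity K ι w) = w from
        LinearMap.congr_fun weilParity_mul_self w]
    have h4 : ∀ a, M.parity (M.iotaA x a) = -M.iotaA x (M.parity a) :=
      LinearMap.congr_fun (M.parity_iotaA x)
    simp only [LinearMap.comp_apply, TensorProduct.map_tmul, Module.End.mul_apply, switch_tmul,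
      map_smul, map_add, leftOp_tmul, rightOdd_tmul, h2, h4, map_sub, parity_parity]
    simp only [TensorProduct.add_tmul, TensorProduct.sub_tmul, TensorProduct.neg_tmul,
      TensorProduct.tmul_neg]
    congr 1
    abel
  exact LinearMap.congr_fun h v

section CharZero

variable [CharZero K]

theorem locNilp_phiAW : LocNilp M.phiAW := by
  rw [phiAW_eq]
  exact locNilp_locSum_odd M.locFin_opC_opB M.opC_opC M.opC_opB M.opB_opB

theorem locNilp_phiWASwitch : LocNilp M.phiWASwitch :=
  locNilp_locSum_odd M.locFin_opCW_opI M.opCW_opCW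
    (fun x y => by rw [add_comm, opI_opCW]) M.opI_opI

theorem locNilp_phiWA : LocNilp M.phiWA := by
  have h : M.phiWA = locSum fun x : ι × ℕ =>
      (TensorProduct.map (cMinus K x) 1 * TensorProduct.map (weilParity K ι) (M.iotaA x) :
        Module.End K (Weil K ι ⊗[K] A)) := by
    simp only [← phiWA_factor]
    rfl
  rw [h]
  have hP : ∀ w : Weil K ι, weilParity K ι (weilParity K ι w) = w :=
    LinearMap.congr_fun weilParity_mul_self
  refine locNilp_locSum_odd ?_ (fun x y => ?_) (fun x y => ?_) (fun x y => ?_)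
  · simpa only [← phiWA_factor] using M.locFin_phiWA
  · refine TensorProduct.ext' fun w a => ?_
    have h1 : cMinus K x (cMinus K y w) + cMinus K y (cMinus K x w) = 0 :=
      LinearMap.congr_fun (cBasis_anticomm _ _ _ _) w
    simp [← TensorProduct.add_tmul, h1]
  · refine TensorProduct.ext' fun w a => ?_
    have h1 : weilParity K ι (cMinus K x w) = -cMinus K x (weilParity K ι w) :=
      LinearMap.congr_fun (weilParity_cBasis _ _) w
    simp [h1, TensorProduct.neg_tmul]
  · refine TensorProduct.ext' fun w a => ?_
    have h1 : M.iotaA x (M.iotaA y a) + M.iotaA y (M.iotaA x a) = 0 :=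
      LinearMap.congr_fun (M.iotaA_anticomm x y) a
    simp [hP, ← TensorProduct.tmul_add, h1]

theorem switch_locExp (v : Weil K ι ⊗[K] A) :
    M.switch (locExp (-M.phiWA) v) = locExp (-M.phiWASwitch) (M.switch v) :=
  comp_locExp M.locNilp_phiWA.neg M.locNilp_phiWASwitch.neg M.switch
    (fun v => by rw [LinearMap.neg_apply, LinearMap.neg_apply, map_neg, switch_phiWA]) v

theorem switch_tmul_of_even {w : Weil K ι} (hw : w ∈ gammaStates e) (a : A) :
    M.switch (w ⊗ₜ a) = a ⊗ₜ w := by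
  have h2 : a + a = (2 : K) • a := (two_smul K a).symm
  rw [switch_tmul, weilParity_gammaStates e hw, ← TensorProduct.add_tmul, add_add_sub_cancel, h2,
    ← TensorProduct.smul_tmul', smul_smul, inv_mul_cancel₀ two_ne_zero, one_smul]

theorem map_switch_cartanWA : M.cartanWA.map M.switch = tens M.inv (gammaStates e) := by
  apply le_antisymm
  · rw [Submodule.map_le_iff_le_comap]
    refine tens_le fun w hw a ha => ?_
    rw [Submodule.mem_comap, M.switch_tmul_of_even hw]
    exact tmul_mem_tens ha hw
  · refine tens_le fun a ha w hw => ?_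
    exact ⟨w ⊗ₜ a, tmul_mem_tens hw ha, M.switch_tmul_of_even hw a⟩

/-- Since `⟨γ⟩` is even, the switching map carries `⟨γ⟩ ⊗ A_inv` to `A_inv ⊗ ⟨γ⟩` without signs. -/
theorem smallCartanSpace_eq_map : M.smallCartanSpace =
    (tens M.inv (gammaStates e)).map (locExp M.phiAW * locExp (-M.phiWASwitch)) := by
  rw [smallCartanSpace, ← map_switch_cartanWA, ← Submodule.map_comp]
  congr 1
  refine LinearMap.ext fun v => ?_
  simp only [LinearMap.comp_apply, Module.End.mul_apply, switch_locExp]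

/-- With `φ_{A,W}`, `φ_{W,A}` the exponents of `Φ_{A,W}`, `Φ_{W,A}` on `A ⊗ W`, the operator
`exp(φ_{A,W}) exp(-φ_{W,A})` conjugates `1 ⊗ b^{ξᵢ}₍ₙ₎` to `ι_{ξᵢ,(n)} ⊗ 1`: the
second factor maps `1 ⊗ b` to `1 ⊗ b + ι ⊗ 1`, and the first one maps this to `ι ⊗ 1`. -/
theorem locExp_conj (y : ι × ℕ) :
    M.opI y * (locExp M.phiAW * locExp (-M.phiWASwitch)) =
      locExp M.phiAW * locExp (-M.phiWASwitch) * M.opB y := by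
  have h1 : M.opI y * locExp M.phiAW = locExp M.phiAW * (M.opI y + M.opB y) :=
    mul_locExp M.locNilp_phiAW (M.phiAW_opI y) (M.phiAW_opB y)
  have h2 : locExp (-M.phiWASwitch) * M.opB y =
      (M.opB y + M.opI y) * locExp (-M.phiWASwitch) :=
    locExp_neg_mul M.locNilp_phiWASwitch (M.phiWASwitch_opB y) (M.phiWASwitch_opI y)
  rw [← mul_assoc, h1, mul_assoc, add_comm (M.opI y), ← h2, mul_assoc]

variable [IsLieAbelian g]

/-- The operator `Φ_{A,W} τ Φ_{W,A}⁻¹ τ⁻¹` restricts to an automorphism of `A_inv ⊗ ⟨c, γ⟩` which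
conjugates `1 ⊗ b^ξ₍ₙ₎` to `ι_{ξ,(n)} ⊗ 1`, so that it maps the common kernel `A_inv ⊗ ⟨γ⟩` of
the former onto the common kernel `A_bas ⊗ ⟨c, γ⟩` of the latter. -/
theorem smallCartanSpace_eq : M.smallCartanSpace = tens M.bas (cGammaStates e) := by
  rw [smallCartanSpace_eq_map]
  apply le_antisymm
  · rintro _ ⟨x, hx, rfl⟩
    have hx' : x ∈ tens M.inv (cGammaStates e) :=
      tens_mono le_rfl (gammaStates_le_cGammaStates e) hx
    refine mem_tens_of_map_left (P := M.inv) (f := M.iotaA) (fun a ha h => M.mem_bas_iff.2 ⟨ha, h⟩)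
      ?_ fun y => ?_
    · exact locExp_mem (fun v hv => M.phiAW_mem hv)
        (locExp_mem (fun v hv => neg_mem (M.phiWASwitch_mem hv)) hx')
    · have h1 : M.opB y x = 0 := by
        have : tens M.inv (gammaStates e) ≤ LinearMap.ker (M.opB y) := tens_le fun a _ w hw => by
          rw [LinearMap.mem_ker, rightOdd_tmul, bPlus_gammaStates e y hw, TensorProduct.tmul_zero]
        exact this hx
      have h2 := LinearMap.congr_fun (M.locExp_conj y) x
      rw [Module.End.mul_apply (_ * _), h1, map_zero] at h2
      exact h2
  · intro y hy
    have hy' : y ∈ tens M.inv (cGammaStates e) :=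
      tens_mono (fun a ha => (M.mem_bas_iff.1 ha).1) le_rfl hy
    have e1 : locExp M.phiAW * locExp (-M.phiAW) = 1 := locExp_mul_locExp_neg M.locNilp_phiAW
    have e2 : locExp (-M.phiWASwitch) * locExp M.phiWASwitch = 1 := by
      simpa using locExp_mul_locExp_neg M.locNilp_phiWASwitch.neg
    have e3 : locExp (-M.phiAW) * locExp M.phiAW = 1 := by
      simpa using locExp_mul_locExp_neg M.locNilp_phiAW.neg
    have e4 : locExp M.phiWASwitch * locExp (-M.phiWASwitch) = 1 :=
      locExp_mul_locExp_neg M.locNilp_phiWASwitch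
    refine ⟨(locExp M.phiWASwitch * locExp (-M.phiAW)) y, ?_, ?_⟩
    · refine mem_tens_of_map_right (Q := cGammaStates e) (g := bPlus K)
        (fun w hw h => mem_gammaStates e hw h) ?_ fun x => ?_
      · exact locExp_mem (fun v hv => M.phiWASwitch_mem hv)
          (locExp_mem (fun v hv => neg_mem (M.phiAW_mem hv)) hy')
      · have h0 : M.opI x y = 0 := by
          have : tens M.bas (cGammaStates e) ≤ LinearMap.ker (M.opI x) := tens_le fun a ha w _ => by
            rw [LinearMap.mem_ker, leftOp_tmul, (M.mem_bas_iff.1 ha).2 x, TensorProduct.zero_tmul]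
          exact this hy
        have h1 : M.opB x * (locExp M.phiWASwitch * locExp (-M.phiAW)) =
            locExp M.phiWASwitch * locExp (-M.phiAW) * M.opI x := by
          have h := congrArg (fun T => locExp M.phiWASwitch * locExp (-M.phiAW) * T *
            (locExp M.phiWASwitch * locExp (-M.phiAW))) (M.locExp_conj x)
          have h5 : locExp M.phiAW * locExp (-M.phiWASwitch) *
              (locExp M.phiWASwitch * locExp (-M.phiAW)) = 1 := by
            rw [mul_assoc, ← mul_assoc (locExp (-M.phiWASwitch)), e2, one_mul, e1]
          have h6 : locExp M.phiWASwitch * locExp (-M.phiAW) *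
              (locExp M.phiAW * locExp (-M.phiWASwitch)) = 1 := by
            rw [mul_assoc, ← mul_assoc (locExp (-M.phiAW)), e3, one_mul, e4]
          rw [mul_assoc _ (M.opI x * _), mul_assoc (M.opI x), h5, mul_one,
            ← mul_assoc _ _ (M.opB x), h6, one_mul] at h
          exact h.symm
        have h2 := LinearMap.congr_fun h1 y
        rw [Module.End.mul_apply, Module.End.mul_apply _ (M.opI x), h0, map_zero] at h2
        have h3 := congrArg (leftOp M.parity) h2
        rw [map_zero] at h3
        rw [← h3]
        generalize (locExp M.phiWASwitch * locExp (-M.phiAW)) y = z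
        have h4 : TensorProduct.map (1 : Module.End K A) (bPlus K x) =
            leftOp M.parity * M.opB x := TensorProduct.ext' fun a w => by simp [M.parity_parity]
        exact LinearMap.congr_fun h4 z
    · have h5 : locExp M.phiAW * locExp (-M.phiWASwitch) *
          (locExp M.phiWASwitch * locExp (-M.phiAW)) = 1 := by
        rw [mul_assoc, ← mul_assoc (locExp (-M.phiWASwitch)), e2, one_mul, e1]
      exact LinearMap.congr_fun h5 y

end CharZero

end ChiralWStarModule

/-! ### The differential of the small chiral Cartan model and its homotopy -/

section Conjugation

variable {K V J : Type*} [Field K] [AddCommGroup V] [Module K V]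

theorem locSum_commutator {f h : J → Module.End K V} (hf : LocFin f) (hh : LocFin h)
    {T : Module.End K V} (H : ∀ j, f j * T - T * f j = -h j) :
    locSum f * T = T * locSum f + -locSum h := by
  rw [← sub_eq_iff_eq_add', locSum_mul hf, mul_locSum hf,
    ← locSum_sub (hf.mul_right T) (hf.mul_left fun _ => T), ← locSum_neg hh]
  congr 1
  exact funext H

theorem locSum_anticommutator {f h : J → Module.End K V} (hf : LocFin f) {T : Module.End K V}
    (H : ∀ j, f j * T + T * f j = h j) : locSum f * T + T * locSum f = locSum h := by
  rw [locSum_mul hf, mul_locSum hf, ← locSum_add (hf.mul_right T) (hf.mul_left fun _ => T)]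
  congr 1
  exact funext H

variable [CharZero K]

theorem locExp_mul_mul_locExp_neg {f T U : Module.End K V} (hf : LocNilp f)
    (h : f * T = T * f + -U) (hU : Commute f U) : locExp f * T * locExp (-f) = T - U := by
  have h1 : locExp f * T = (T + -U) * locExp f :=
    locExp_mul hf (by rw [h]; abel) (by rw [mul_neg, neg_mul, hU.eq])
  rw [h1, mul_assoc, locExp_mul_locExp_neg hf, mul_one, sub_eq_add_neg]

theorem locExp_conj_sq {f T : Module.End K V} (hf : LocNilp f) (hT : T * T = 0) :
    locExp f * T * locExp (-f) * (locExp f * T * locExp (-f)) = 0 := by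
  have h : locExp (-f) * locExp f = 1 := by simpa using locExp_mul_locExp_neg hf.neg
  calc locExp f * T * locExp (-f) * (locExp f * T * locExp (-f))
      = locExp f * T * (locExp (-f) * locExp f) * T * locExp (-f) := by simp only [mul_assoc]
    _ = locExp f * (T * T) * locExp (-f) := by rw [h, mul_one, mul_assoc (locExp f)]
    _ = 0 := by rw [hT, mul_zero, zero_mul]

end Conjugation

namespace ChiralWStarModule

section Vacuum

variable {K ι A : Type*} [Field K] [AddCommGroup A] [Module K A]

/-- The functional on `W` which sends the vacuum to `1` and all monomials of positive length in the
creation modes to `0`. -/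
def weilCounit (K ι : Type*) [Field K] : Weil K ι →ₗ[K] K :=
  (TensorProduct.lid K K).toLinearMap ∘ₗ TensorProduct.map
    (ExteriorAlgebra.algebraMapInv (R := K) (M := Label ι →₀ K)).toLinearMap
    (MvPolynomial.aeval (fun _ : Label ι => (0 : K))).toLinearMap

theorem weilCounit_vac : weilCounit K ι (vac K ι) = 1 := by
  have h : weilCounit K ι (vac K ι) =
      ExteriorAlgebra.algebraMapInv (R := K) (M := Label ι →₀ K) 1 *
        MvPolynomial.aeval (fun _ : Label ι => (0 : K)) (1 : MvPolynomial (Label ι) K) := rfl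
  rw [h, map_one, map_one, one_mul]

theorem tensorVac_apply (a : A) : tensorVac a = a ⊗ₜ[K] vac K ι := rfl

theorem tensorVac_injective : Function.Injective
    (tensorVac : A →ₗ[K] A ⊗[K] Weil K ι) := by
  have h : ∀ a : A, TensorProduct.rid K A (TensorProduct.map LinearMap.id (weilCounit K ι)
      (tensorVac a : A ⊗[K] Weil K ι)) = a := fun a => by
    rw [tensorVac, LinearMap.flip_apply, TensorProduct.mk_apply, TensorProduct.map_tmul,
      weilCounit_vac, TensorProduct.rid_tmul, one_smul]
    rfl
  exact Function.LeftInverse.injective (g := fun x => TensorProduct.rid K A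
    (TensorProduct.map LinearMap.id (weilCounit K ι) x)) h

end Vacuum

variable {K ι g A : Type*} [Field K] [Fintype ι] [LieRing g] [LieAlgebra K g]
  {e : Module.Basis ι K g} [AddCommGroup A] [Module K A] (M : ChiralWStarModule e A)

@[simp] theorem tensorD_tmul (a : A) (w : Weil K ι) :
    M.tensorD (a ⊗ₜ w) = M.d a ⊗ₜ w + M.parity a ⊗ₜ weilD e w := rfl

/-- The operators `γ^{ξᵢ*,A}₍₋ₙ₋₁₎ ⊗ 1`. -/
abbrev opG (x : ι × ℕ) : Module.End K (A ⊗[K] Weil K ι) := leftOp (M.gammaA x)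

/-- The difference `∑ γ^{ξᵢ*,A}₍₋ₙ₋₁₎ ⊗ b^{ξᵢ}₍ₙ₎` of `d_A ⊗ 1 + 1 ⊗ d_W` and its conjugate by
`Φ_{A,W}`. -/
def opR : Module.End K (A ⊗[K] Weil K ι) := locSum fun x => M.opG x * M.opB x

/-- The contracting homotopy `∑ 1 ⊗ c^{ξᵢ*}₍₋ₙ₋₁₎ β^{ξᵢ}₍ₙ₎`. -/
def opH : Module.End K (A ⊗[K] Weil K ι) :=
  locSum fun x => M.opCW x * rightEven (betaPlus K x)

/-- The degree operator of `A ⊗ W`. -/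
def opDeg : Module.End K (A ⊗[K] Weil K ι) := leftOp M.degOp + rightEven (degreeOp K ι)

@[simp] theorem opDeg_tmul (a : A) (w : Weil K ι) :
    M.opDeg (a ⊗ₜ w) = M.degOp a ⊗ₜ w + a ⊗ₜ degreeOp K ι w := rfl

theorem locFin_opG_opB : LocFin fun x => M.opG x * M.opB x := M.locFin_opB.mul_left _

theorem locFin_opH : LocFin fun x => M.opCW x * rightEven (betaPlus K x) :=
  (locFin_rightEven (locFin_betaBasis K ι)).mul_left _

theorem parity_d_apply (a : A) : M.parity (M.d a) = -M.d (M.parity a) :=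
  LinearMap.congr_fun M.parity_d a

theorem tensorD_opC (x : ι × ℕ) : M.tensorD * M.opC x + M.opC x * M.tensorD = M.opG x := by
  refine TensorProduct.ext' fun a w => ?_
  have h1 : M.parity (M.cA x a) = -M.cA x (M.parity a) := LinearMap.congr_fun (M.parity_cA x) a
  have h2 : M.gammaA x a = M.d (M.cA x a) + M.cA x (M.d a) := rfl
  simp only [LinearMap.add_apply, Module.End.mul_apply, leftOp_tmul, tensorD_tmul, map_add, h1, h2,
    TensorProduct.neg_tmul, TensorProduct.add_tmul]
  abel

theorem tensorD_opB [IsLieAbelian g] (x : ι × ℕ) :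
    M.tensorD * M.opB x + M.opB x * M.tensorD = 0 := by
  refine TensorProduct.ext' fun a w => ?_
  have h1 : weilD e (bPlus K x w) + bPlus K x (weilD e w) = 0 :=
    LinearMap.congr_fun (weilD_bBasis e _ _) w
  simp only [LinearMap.add_apply, Module.End.mul_apply, rightOdd_tmul, tensorD_tmul, map_add,
    parity_d_apply, TensorProduct.neg_tmul, parity_parity, LinearMap.zero_apply]
  rw [eq_neg_of_add_eq_zero_left h1, TensorProduct.tmul_neg]
  abel

theorem tensorD_opCW [IsLieAbelian g] (x : ι × ℕ) :
    M.tensorD * M.opCW x + M.opCW x * M.tensorD = rightEven (gammaMinus K x) := by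
  refine TensorProduct.ext' fun a w => ?_
  have h1 : weilD e (cMinus K x w) + cMinus K x (weilD e w) = gammaMinus K x w :=
    LinearMap.congr_fun (weilD_cMinus e _) w
  simp only [LinearMap.add_apply, Module.End.mul_apply, rightOdd_tmul, tensorD_tmul, map_add,
    parity_d_apply, TensorProduct.neg_tmul, parity_parity, rightEven_tmul]
  rw [← h1, TensorProduct.tmul_add]
  abel

theorem rightEven_betaPlus_tensorD [IsLieAbelian g] (x : ι × ℕ) :
    rightEven (betaPlus K x) * M.tensorD - M.tensorD * rightEven (betaPlus K x) = M.opB x := by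
  refine TensorProduct.ext' fun a w => ?_
  have h1 : weilD e (betaPlus K x w) = betaPlus K x (weilD e w) + -bPlus K x w :=
    LinearMap.congr_fun (weilD_betaPlus e _) w
  simp only [LinearMap.sub_apply, Module.End.mul_apply, rightOdd_tmul, tensorD_tmul, map_add,
    rightEven_tmul, h1, TensorProduct.tmul_add, TensorProduct.tmul_neg]
  abel

theorem tensorD_sq [IsLieAbelian g] [CharZero K] : M.tensorD * M.tensorD = 0 := by
  refine TensorProduct.ext' fun a w => ?_
  have h1 : weilD e (weilD e w) = 0 := LinearMap.congr_fun (weilD_sq e) w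
  have h2 : M.d (M.d a) = 0 := LinearMap.congr_fun M.d_sq a
  simp only [Module.End.mul_apply, tensorD_tmul, map_add, h1, h2, parity_d_apply,
    TensorProduct.zero_tmul, TensorProduct.tmul_zero, TensorProduct.neg_tmul, LinearMap.zero_apply]
  abel

theorem phiAW_tensorD [IsLieAbelian g] : M.phiAW * M.tensorD = M.tensorD * M.phiAW + -M.opR := by
  rw [phiAW_eq]
  refine locSum_commutator M.locFin_opC_opB M.locFin_opG_opB fun x => ?_
  rw [mul_commutator_odd, add_comm (M.opB x * _), tensorD_opB, add_comm (M.opC x * _), tensorD_opC,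
    mul_zero, zero_sub]

theorem opG_opB_comm (x y : ι × ℕ) : Commute (M.opG x) (M.opB y) :=
  M.leftOp_rightOdd_comm (M.parity_gammaA x) _

theorem phiAW_opR [IsLieAbelian g] : Commute M.phiAW M.opR := by
  rw [phiAW_eq]
  refine locSum_commute M.locFin_opC_opB fun x => ?_
  refine (locSum_commute M.locFin_opG_opB fun y => ?_).symm
  have h1 : Commute (M.opG y) (M.opC x * M.opB x) :=
    (leftOp_comm (M.gammaA_cA_comm y x)).mul_right (M.opG_opB_comm y x)
  have h2 : Commute (M.opC x * M.opB x) (M.opB y) := sub_eq_zero.1 <| by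
    rw [mul_commutator_odd, opB_opB, opC_opB, mul_zero, zero_mul, sub_zero]
  exact h1.mul_left h2.symm

/-- The differential of the small Cartan model: the commutator of the exponent of `Φ_{A,W}` with
`d_A ⊗ 1 + 1 ⊗ d_W` is `-opR`, which commutes with that exponent, so that the exponential series
stops after the linear term. -/
theorem smallCartan_d [IsLieAbelian g] [CharZero K] : M.smallCartan.d = M.tensorD - M.opR :=
  locExp_mul_mul_locExp_neg M.locNilp_phiAW M.phiAW_tensorD M.phiAW_opR

theorem smallCartan_d_sq [IsLieAbelian g] [CharZero K] (x : A ⊗[K] Weil K ι) :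
    M.smallCartan.d (M.smallCartan.d x) = 0 :=
  LinearMap.congr_fun (locExp_conj_sq M.locNilp_phiAW M.tensorD_sq) x

theorem opH_tensorD [IsLieAbelian g] : M.opH * M.tensorD + M.tensorD * M.opH =
    locSum fun x => M.opCW x * M.opB x +
      rightEven (gammaMinus K x) * rightEven (betaPlus K x) := by
  refine locSum_anticommutator M.locFin_opH fun x => ?_
  rw [mul_anticommutator_odd_even, rightEven_betaPlus_tensorD, add_comm (M.opCW x * M.tensorD),
    tensorD_opCW]

theorem opR_opCW (y : ι × ℕ) : M.opR * M.opCW y + M.opCW y * M.opR = M.opG y := by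
  classical
  refine locSum_anticommutator_single M.locFin_opG_opB y fun x => ?_
  have h : M.opG x * M.opCW y - M.opCW y * M.opG x = 0 :=
    sub_eq_zero.2 (M.leftOp_rightOdd_comm (M.parity_gammaA x) _).eq
  rw [mul_anticommutator_even_odd, opB_opCW, h, zero_mul, sub_zero]
  split_ifs with hxy
  · rw [hxy, mul_one]
  · rw [mul_zero]

theorem opR_betaPlus (y : ι × ℕ) : Commute M.opR (rightEven (betaPlus K y)) :=
  locSum_commute M.locFin_opG_opB fun _ => (leftOp_rightEven_comm _ _).mul_left
    (M.rightOdd_rightEven_comm (bBasis_betaBasis_comm _ _ _ _))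

theorem opH_opR : M.opH * M.opR + M.opR * M.opH =
    locSum fun x => M.opG x * rightEven (betaPlus K x) := by
  refine locSum_anticommutator M.locFin_opH fun x => ?_
  rw [mul_anticommutator_odd_even, sub_eq_zero.2 (M.opR_betaPlus x).symm.eq, mul_zero, zero_add,
    add_comm (M.opCW x * _), opR_opCW]

/-- The homotopy and `d_A ⊗ 1 + 1 ⊗ d_W` have the number of creation modes as anticommutator. -/
theorem number_tmul [IsLieAbelian g] (a : A) (w : Weil K ι) :
    (M.opH * M.tensorD + M.tensorD * M.opH) (a ⊗ₜ w) =
      a ⊗ₜ (cNumber K ι + gammaNumber K ι) w := by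
  rw [opH_tensorD, cNumber, gammaNumber,
    ← locSum_add (locFin_cMinus_bPlus K ι) (locFin_gammaMinus_betaPlus K ι)]
  refine (comp_locSum ((locFin_cMinus_bPlus K ι).add (locFin_gammaMinus_betaPlus K ι)) ?_
    (TensorProduct.mk K A (Weil K ι) a) (fun x w => ?_) w).symm
  · exact (M.locFin_opB.mul_left _).add
      ((locFin_rightEven (locFin_betaBasis K ι)).mul_left fun x => rightEven (gammaMinus K x))
  · simp [TensorProduct.tmul_add, parity_parity]

/-- The anticommutator of the differential with `opH` is the number of creation modes, up to terms
of lower order. -/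
theorem homotopy_lower [IsLieAbelian g] [CharZero K] {k : ℕ} {x : A ⊗[K] Weil K ι}
    (hx : x ∈ tens M.bas (cGammaFilt K ι (k + 1))) :
    M.smallCartan.d (M.opH x) + M.opH (M.smallCartan.d x) - (k + 1 : K) • x ∈
      tens M.bas (cGammaFilt K ι k) := by
  have h : tens M.bas (cGammaFilt K ι (k + 1)) ≤ (tens M.bas (cGammaFilt K ι k)).comap
      (M.smallCartan.d * M.opH + M.opH * M.smallCartan.d - (k + 1 : K) • 1) := by
    refine tens_le fun a ha w hw => ?_
    have h1 := M.number_tmul a w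
    have h2 := LinearMap.congr_fun M.opH_opR (a ⊗ₜ[K] w)
    have h3 : (locSum fun x => M.opG x * rightEven (betaPlus K x)) (a ⊗ₜ[K] w) ∈
        tens M.bas (cGammaFilt K ι k) := locSum_mem fun x =>
      tmul_mem_tens (M.gammaA_mem_bas x ha) (betaPlus_lower x k w hw)
    have h4 : a ⊗ₜ[K] ((cNumber K ι + gammaNumber K ι) w - (k + 1 : K) • w) ∈
        tens M.bas (cGammaFilt K ι k) := tmul_mem_tens ha (number_cGammaFilt k w hw)
    rw [← h2] at h3
    rw [TensorProduct.tmul_sub, ← h1] at h4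
    refine (congrArg (· ∈ tens M.bas (cGammaFilt K ι k)) ?_).mpr (sub_mem h4 h3)
    rw [smallCartan_d]
    simp only [LinearMap.sub_apply, LinearMap.add_apply, Module.End.mul_apply, LinearMap.smul_apply,
      Module.End.one_apply, map_sub, TensorProduct.tmul_smul]
    abel
  exact h hx

/-! ### Degrees -/

theorem parity_degOp : Commute M.degOp M.parity := by
  have h : IsHomog M.gr 0 M.parity := fun r a ha => by
    rw [M.parity_apply ha, add_zero]
    exact zsmul_mem ha _
  have h1 := M.degOp_mul h
  unfold Commute SemiconjBy
  rw [h1]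
  exact add_eq_left.2 (zero_smul ℤ _)

theorem opDeg_opR : M.opDeg * M.opR = M.opR * M.opDeg + M.opR := by
  have h := locSum_graded (K := K) M.locFin_opG_opB (T := M.opDeg) 1 fun x => by
    refine TensorProduct.ext' fun a w => ?_
    have h1 : ∀ a, M.degOp (M.gammaA x a) = M.gammaA x (M.degOp a) + 2 • M.gammaA x a :=
      LinearMap.congr_fun (M.degOp_gammaA x)
    have h2 : ∀ w, degreeOp K ι (bPlus K x w) = bPlus K x (degreeOp K ι w) - bPlus K x w :=
      LinearMap.congr_fun (degreeOp_bPlus x)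
    have h3 : M.degOp (M.parity a) = M.parity (M.degOp a) :=
      LinearMap.congr_fun M.parity_degOp.eq a
    rw [one_smul]
    simp only [LinearMap.add_apply, Module.End.mul_apply, leftOp_tmul, rightOdd_tmul, opDeg_tmul,
      h1, h2, h3, map_add, TensorProduct.add_tmul, TensorProduct.tmul_sub, two_nsmul]
    abel
  rwa [one_smul] at h

theorem opDeg_opH : M.opDeg * M.opH = M.opH * M.opDeg + (-1 : ℤ) • M.opH := by
  refine locSum_graded (K := K) M.locFin_opH (-1) fun x => ?_
  refine TensorProduct.ext' fun a w => ?_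
  have h1 : ∀ w, degreeOp K ι (cMinus K x w) = cMinus K x (degreeOp K ι w) + cMinus K x w :=
    LinearMap.congr_fun (degreeOp_cMinus x)
  have h2 : ∀ w, degreeOp K ι (betaPlus K x w) =
      betaPlus K x (degreeOp K ι w) - 2 • betaPlus K x w :=
    LinearMap.congr_fun (degreeOp_betaPlus x)
  have h3 : M.degOp (M.parity a) = M.parity (M.degOp a) :=
    LinearMap.congr_fun M.parity_degOp.eq a
  rw [neg_one_smul]
  simp only [LinearMap.add_apply, LinearMap.neg_apply, Module.End.mul_apply, rightEven_tmul,
    rightOdd_tmul, opDeg_tmul, h1, h2, h3, map_add, map_sub, TensorProduct.tmul_add,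
    TensorProduct.tmul_sub, two_nsmul]
  abel

theorem opDeg_tensorD [IsLieAbelian g] {x : A ⊗[K] Weil K ι}
    (hx : x ∈ tens M.bas (cGammaStates e)) :
    M.opDeg (M.tensorD x) = M.tensorD (M.opDeg x) + M.tensorD x := by
  have h : tens M.bas (cGammaStates e) ≤
      LinearMap.ker (M.opDeg * M.tensorD - M.tensorD * M.opDeg - M.tensorD) := by
    refine tens_le fun a _ w hw => ?_
    have h1 : M.degOp (M.d a) = M.d (M.degOp a) + M.d a := LinearMap.congr_fun M.degOp_d a
    have h3 : M.degOp (M.parity a) = M.parity (M.degOp a) :=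
      LinearMap.congr_fun M.parity_degOp.eq a
    rw [LinearMap.mem_ker]
    simp only [LinearMap.sub_apply, Module.End.mul_apply, opDeg_tmul, tensorD_tmul, map_add, h1, h3,
      degreeOp_weilD e hw, TensorProduct.add_tmul, TensorProduct.tmul_add]
    abel
  have h1 := h hx
  rw [LinearMap.mem_ker, LinearMap.sub_apply, LinearMap.sub_apply, sub_sub, sub_eq_zero] at h1
  exact h1

/-- The vectors of degree `p` in `A_bas ⊗ ⟨c, γ⟩`. -/
def basPiece (p : ℤ) : Submodule K (A ⊗[K] Weil K ι) :=
  tens M.bas (cGammaStates e) ⊓ LinearMap.ker (M.opDeg - p • (1 : Module.End K _))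

theorem mem_basPiece {p : ℤ} {x : A ⊗[K] Weil K ι} :
    x ∈ M.basPiece p ↔ x ∈ tens M.bas (cGammaStates e) ∧ M.opDeg x = p • x := by
  rw [basPiece, Submodule.mem_inf, LinearMap.mem_ker, LinearMap.sub_apply, sub_eq_zero]
  rfl

theorem tensorD_mem [IsLieAbelian g] {x : A ⊗[K] Weil K ι}
    (hx : x ∈ tens M.bas (cGammaStates e)) :
    M.tensorD x ∈ tens M.bas (cGammaStates e) :=
  add_mem (map_mem_tens (fun _ ha => M.d_mem_bas ha) (fun _ hw => hw) hx)
    (map_mem_tens (fun _ ha => M.parity_mem_bas ha) (fun _ hw => weilD_mem e hw) hx)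

theorem opR_mem [IsLieAbelian g] {x : A ⊗[K] Weil K ι} (hx : x ∈ tens M.bas (cGammaStates e)) :
    M.opR x ∈ tens M.bas (cGammaStates e) :=
  locSum_mem fun y => map_mem_tens (fun _ ha => M.gammaA_mem_bas y ha) (fun _ hw => hw)
    (map_mem_tens (fun _ ha => M.parity_mem_bas ha) (fun _ hw => bPlus_mem e y hw) hx)

theorem opH_mem {x : A ⊗[K] Weil K ι} (hx : x ∈ tens M.bas (cGammaStates e)) :
    M.opH x ∈ tens M.bas (cGammaStates e) :=
  locSum_mem fun y => map_mem_tens (fun _ ha => M.parity_mem_bas ha)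
    (fun _ hw => cMinus_mem e y hw)
    (map_mem_tens (fun _ ha => ha) (fun _ hw => betaPlus_mem e y hw) hx)

theorem opH_mem_basPiece {p : ℤ} {x : A ⊗[K] Weil K ι} (hx : x ∈ M.basPiece p) :
    M.opH x ∈ M.basPiece (p - 1) := by
  rw [mem_basPiece] at hx ⊢
  refine ⟨M.opH_mem hx.1, ?_⟩
  have h : M.opDeg (M.opH x) = M.opH (M.opDeg x) + (-1 : ℤ) • M.opH x :=
    LinearMap.congr_fun M.opDeg_opH x
  rw [h, hx.2, map_zsmul, ← add_smul, sub_eq_add_neg]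

theorem d_mem_basPiece [IsLieAbelian g] [CharZero K] {p : ℤ} {x : A ⊗[K] Weil K ι}
    (hx : x ∈ M.basPiece p) : M.smallCartan.d x ∈ M.basPiece (p + 1) := by
  rw [mem_basPiece] at hx ⊢
  rw [smallCartan_d, LinearMap.sub_apply]
  refine ⟨sub_mem (M.tensorD_mem hx.1) (M.opR_mem hx.1), ?_⟩
  have h : M.opDeg (M.opR x) = M.opR (M.opDeg x) + M.opR x := LinearMap.congr_fun M.opDeg_opR x
  rw [map_sub, h, M.opDeg_tensorD hx.1, hx.2, map_zsmul, map_zsmul, add_smul, one_smul, smul_sub]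
  abel

theorem iSupIndep_basPiece [CharZero K] : iSupIndep M.basPiece :=
  (iSupIndep_integer_eigenspaces M.opDeg).mono fun _ => inf_le_right

theorem tensorDeg_le (p : ℤ) :
    M.tensorDeg p ≤ LinearMap.ker (M.opDeg - p • (1 : Module.End K _)) := by
  refine iSup_le fun q => tens_le fun a ha w hw => ?_
  rw [LinearMap.mem_ker, LinearMap.sub_apply, sub_eq_zero, opDeg_tmul, M.degOp_of_mem_deg ha,
    mem_weilDeg.1 hw, ← TensorProduct.smul_tmul', TensorProduct.tmul_smul, ← add_smul,
    add_sub_cancel]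
  rfl

theorem tens_graded : tens M.bas (cGammaStates e) ≤
    ⨆ p, tens M.bas (cGammaStates e) ⊓ M.tensorDeg p := by
  refine tens_le fun a ha w hw => ?_
  have h1 : tens (⨆ p, M.bas ⊓ M.deg p) (⨆ q, cGammaStates e ⊓ weilDeg K ι q) ≤
      ⨆ p, tens M.bas (cGammaStates e) ⊓ M.tensorDeg p := by
    rw [tens, Submodule.map₂_iSup_left]
    refine iSup_le fun p => ?_
    rw [Submodule.map₂_iSup_right]
    refine iSup_le fun q => tens_le fun a ha w hw =>
      Submodule.mem_iSup_of_mem (p + q) ⟨tmul_mem_tens ha.1 hw.1, ?_⟩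
    refine Submodule.mem_iSup_of_mem p (tmul_mem_tens ha.2 ?_)
    rw [add_sub_cancel_left]
    exact hw.2
  exact h1 (tmul_mem_tens (M.bas_graded ha) (cGammaStates_graded e hw))

/-- The elements of degree `p` of the small Cartan model form an eigenspace of the degree
operator. -/
theorem smallCartan_piece [IsLieAbelian g] [CharZero K] (p : ℤ) :
    M.smallCartan.piece p = M.basPiece p := by
  have h : M.smallCartan.piece = fun p => tens M.bas (cGammaStates e) ⊓ M.tensorDeg p :=
    funext fun p => congrArg (· ⊓ M.tensorDeg p) M.smallCartanSpace_eq
  rw [h]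
  apply le_antisymm
  · exact inf_le_inf le_rfl (M.tensorDeg_le p)
  · intro x hx
    exact mem_of_mem_iSup (fun p => le_trans inf_le_right (M.tensorDeg_le p))
      (iSupIndep_integer_eigenspaces M.opDeg) (M.tens_graded hx.1) hx.2

theorem smallCartan_isComplex [IsLieAbelian g] [CharZero K] : M.smallCartan.IsComplex where
  independent := by
    have h : M.smallCartan.piece = M.basPiece := funext M.smallCartan_piece
    rw [h]
    exact M.iSupIndep_basPiece
  graded := by
    apply le_antisymm
    · exact iSup_le fun p => inf_le_left
    · have h := M.tens_graded
      rw [← M.smallCartanSpace_eq] at h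
      exact h
  d_mem := fun p x hx => by
    rw [smallCartan_piece] at hx ⊢
    exact M.d_mem_basPiece hx
  d_sq := fun x _ => M.smallCartan_d_sq x

theorem basicComplex_isComplex [CharZero K] : M.basicComplex.IsComplex where
  independent := (iSupIndep_integer_eigenspaces M.degOp).mono fun p a ha => by
    rw [LinearMap.mem_ker, LinearMap.sub_apply, sub_eq_zero, M.degOp_of_mem_deg ha.2]
    rfl
  graded := le_antisymm (iSup_le fun p => inf_le_left) M.bas_graded
  d_mem := fun p a ha => ⟨M.d_mem_bas ha.1, M.deg_map M.d_homog ha.2⟩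
  d_sq := fun a _ => LinearMap.congr_fun M.d_sq a

/-! ### The quasi-isomorphism -/

theorem exists_mem_tens_filt {x : A ⊗[K] Weil K ι} (hx : x ∈ tens M.bas (cGammaStates e)) :
    ∃ k, x ∈ tens M.bas (cGammaFilt K ι k) := by
  rw [cGammaStates_eq, tens, Submodule.map₂_iSup_right] at hx
  have hmono : Monotone fun k => tens M.bas (cGammaFilt K ι k) := fun i j hij =>
    tens_mono le_rfl (filt_mono hij)
  exact (Submodule.mem_iSup_of_directed _ hmono.directed_le).1 hx

theorem opH_tens_vac {x : A ⊗[K] Weil K ι} (hx : x ∈ tens M.bas (K ∙ vac K ι)) :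
    M.opH x = 0 := by
  have h : tens M.bas (K ∙ vac K ι) ≤ LinearMap.ker M.opH := tens_le fun a _ w hw => by
    obtain ⟨r, rfl⟩ := Submodule.mem_span_singleton.1 hw
    refine locSum_apply_eq_zero fun x => ?_
    rw [Module.End.mul_apply, rightEven_tmul, map_smul, betaBasis_vac, smul_zero,
      TensorProduct.tmul_zero, map_zero]
  exact h hx

/-- Every homogeneous element whose differential lies in `A_bas ⊗ 1` is, up to a coboundary, an
element of `A_bas ⊗ 1`. -/
theorem exists_cohomologous [IsLieAbelian g] [CharZero K] (k : ℕ) {p : ℤ} :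
    ∀ x ∈ tens M.bas (cGammaFilt K ι k), x ∈ M.basPiece p →
      M.smallCartan.d x ∈ tens M.bas (K ∙ vac K ι) →
    ∃ x₀ ∈ tens M.bas (K ∙ vac K ι), ∃ u ∈ M.basPiece (p - 1),
      x = x₀ + M.smallCartan.d u := by
  induction k with
  | zero => exact fun x hx _ _ => ⟨x, hx, 0, Submodule.zero_mem _, by rw [map_zero, add_zero]⟩
  | succ k ih =>
    intro x hx hxp hdx
    have hk : (k + 1 : K) ≠ 0 := Nat.cast_add_one_ne_zero k
    -- `(k + 1) x` is `d (opH x)` minus an element `y` of the previous piece, to which the induction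
    -- hypothesis applies; `opH (d x)` vanishes because `d x` lies in `A_bas ⊗ 1`
    have h1 := M.homotopy_lower hx
    rw [M.opH_tens_vac hdx, add_zero] at h1
    have hH := M.opH_mem_basPiece hxp
    have hdH := M.d_mem_basPiece hH
    rw [sub_add_cancel] at hdH
    obtain ⟨x₀, hx₀, u, hu, h⟩ := ih
      (-(k + 1 : K)⁻¹ • (M.smallCartan.d (M.opH x) - (k + 1 : K) • x))
      (Submodule.smul_mem _ _ h1)
      (Submodule.smul_mem _ _ (sub_mem hdH (Submodule.smul_mem _ _ hxp))) (by
        rw [map_smul, map_sub, smallCartan_d_sq, map_smul]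
        exact Submodule.smul_mem _ _ (sub_mem (Submodule.zero_mem _) (Submodule.smul_mem _ _ hdx)))
    refine ⟨x₀, hx₀, u + (k + 1 : K)⁻¹ • M.opH x,
      add_mem hu (Submodule.smul_mem _ _ hH), ?_⟩
    rw [map_add, map_smul, ← add_assoc, ← h, smul_sub, smul_smul, neg_mul, inv_mul_cancel₀ hk]
    module

theorem opDeg_tensorVac (a : A) : M.opDeg (tensorVac a) = tensorVac (M.degOp a) := by
  rw [tensorVac_apply, opDeg_tmul, degreeOp_vac, TensorProduct.tmul_zero, add_zero,
    tensorVac_apply]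

theorem smallCartan_d_tensorVac [CharZero K] [IsLieAbelian g] (a : A) :
    M.smallCartan.d (tensorVac a) = tensorVac (M.d a) := by
  have h : M.opR (a ⊗ₜ vac K ι) = 0 := locSum_apply_eq_zero fun x => by
    rw [Module.End.mul_apply, rightOdd_tmul, bBasis_vac, TensorProduct.tmul_zero, map_zero]
  rw [smallCartan_d, LinearMap.sub_apply, tensorVac_apply, h, tensorD_tmul, weilD_vac,
    TensorProduct.tmul_zero, add_zero, sub_zero, tensorVac_apply]

theorem tensorVac_mem_basPiece {p : ℤ} {a : A} :
    (tensorVac a : A ⊗[K] Weil K ι) ∈ M.basPiece p → M.degOp a = p • a := fun h => by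
  have h1 := (M.mem_basPiece.1 h).2
  rw [opDeg_tensorVac, ← map_zsmul] at h1
  exact tensorVac_injective h1

theorem mem_basicComplex_piece [CharZero K] {p : ℤ} {a : A} :
    a ∈ M.basicComplex.piece p ↔ a ∈ M.bas ∧ M.degOp a = p • a := by
  refine ⟨fun h => ⟨h.1, M.degOp_of_mem_deg h.2⟩, fun h => ?_⟩
  refine mem_of_mem_iSup (r := fun p => LinearMap.ker (M.degOp - p • (1 : Module.End K A)))
    (fun p b hb => ?_) (iSupIndep_integer_eigenspaces M.degOp) (M.bas_graded h.1) ?_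
  · rw [LinearMap.mem_ker, LinearMap.sub_apply, sub_eq_zero, M.degOp_of_mem_deg hb.2]
    rfl
  · rw [LinearMap.mem_ker, LinearMap.sub_apply, sub_eq_zero, h.2]
    rfl

theorem tensorVac_isChainMap [IsLieAbelian g] [CharZero K] :
    PreComplex.IsChainMap M.basicComplex M.smallCartan
      (tensorVac : A →ₗ[K] A ⊗[K] Weil K ι) where
  mem := fun p a ha => by
    rw [mem_basicComplex_piece] at ha
    rw [smallCartan_piece, mem_basPiece]
    exact ⟨tmul_mem_tens ha.1 (vac_mem_cGammaStates e), by
      rw [opDeg_tensorVac, ha.2, map_zsmul]⟩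
  comm := fun p a _ => M.smallCartan_d_tensorVac a

theorem tens_vac_le {x : A ⊗[K] Weil K ι} (hx : x ∈ tens M.bas (K ∙ vac K ι)) :
    ∃ a ∈ M.bas, tensorVac a = x := by
  have h : tens M.bas (K ∙ vac K ι) ≤
      M.bas.map (tensorVac : A →ₗ[K] A ⊗[K] Weil K ι) := tens_le fun a ha w hw => by
    obtain ⟨r, rfl⟩ := Submodule.mem_span_singleton.1 hw
    rw [TensorProduct.tmul_smul]
    exact Submodule.smul_mem _ _ ⟨a, ha, rfl⟩
  exact h hx

/-- A homogeneous element whose differential lies in `A_bas ⊗ 1` differs from some `a ⊗ 1`, with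
`a` basic of the same degree, by a coboundary. -/
theorem exists_basic_cohomologous [IsLieAbelian g] [CharZero K] {p : ℤ} {x : A ⊗[K] Weil K ι}
    (hx : x ∈ M.smallCartan.piece p) (hdx : M.smallCartan.d x ∈ tens M.bas (K ∙ vac K ι)) :
    ∃ a ∈ M.basicComplex.piece p, ∃ u ∈ M.smallCartan.piece (p - 1),
      x = tensorVac a + M.smallCartan.d u := by
  rw [smallCartan_piece] at hx ⊢
  obtain ⟨k, hk⟩ := M.exists_mem_tens_filt hx.1
  obtain ⟨x₀, hx₀, u, hu, rfl⟩ := M.exists_cohomologous k x hk hx hdx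
  obtain ⟨a, ha, rfl⟩ := M.tens_vac_le hx₀
  have hdu := M.d_mem_basPiece hu
  rw [sub_add_cancel] at hdu
  have h1 : tensorVac a ∈ M.basPiece p := by simpa using sub_mem hx hdu
  exact ⟨a, M.mem_basicComplex_piece.2 ⟨ha, M.tensorVac_mem_basPiece h1⟩, u, hu, rfl⟩

theorem tensorVac_isQuasiIso [IsLieAbelian g] [CharZero K] :
    PreComplex.IsQuasiIso M.basicComplex M.smallCartan
      (tensorVac : A →ₗ[K] A ⊗[K] Weil K ι) := by
  refine ⟨M.tensorVac_isChainMap, fun p => ⟨?_, ?_⟩⟩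
  · rw [injective_iff_map_eq_zero]
    intro y
    obtain ⟨⟨a, ha⟩, rfl⟩ := Submodule.mkQ_surjective _ y
    intro h
    have h1 : (⟨tensorVac a, M.tensorVac_isChainMap.cocycle p a ha⟩ :
        M.smallCartan.cocycles p) ∈ (M.smallCartan.coboundaries p).comap
          (M.smallCartan.cocycles p).subtype := (Submodule.Quotient.mk_eq_zero _).1 h
    obtain ⟨z, hz, hza⟩ := h1
    have hza' : M.smallCartan.d z = tensorVac a := hza
    have hdz : M.smallCartan.d z ∈ tens M.bas (K ∙ vac K ι) := by
      rw [hza']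
      exact tmul_mem_tens ha.1.1 (Submodule.mem_span_singleton_self _)
    obtain ⟨b, hb, u, _, rfl⟩ := M.exists_basic_cohomologous hz hdz
    rw [map_add, smallCartan_d_sq, add_zero, smallCartan_d_tensorVac] at hza'
    refine (Submodule.Quotient.mk_eq_zero _).2 ?_
    exact ⟨b, hb, tensorVac_injective hza'⟩
  · intro y
    obtain ⟨⟨z, hz⟩, rfl⟩ := Submodule.mkQ_surjective _ y
    have hdz : M.smallCartan.d z = 0 := hz.2
    obtain ⟨a, ha, u, hu, rfl⟩ := M.exists_basic_cohomologous hz.1 (by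
      rw [hdz]; exact Submodule.zero_mem _)
    rw [map_add, smallCartan_d_sq, add_zero, smallCartan_d_tensorVac] at hdz
    have hda : M.d a = 0 := tensorVac_injective (hdz.trans (map_zero _).symm)
    refine ⟨Submodule.Quotient.mk ⟨a, ha, hda⟩, ?_⟩
    refine (Submodule.Quotient.eq _).2 ?_
    refine ⟨-u, neg_mem hu, ?_⟩
    change M.smallCartan.d (-u) = tensorVac a - (tensorVac a + M.smallCartan.d u)
    rw [map_neg]
    abel

end ChiralWStarModule

end ChiralWeil

end

theorem mainTheorem2 {K : Type*} [RCLike K] {t : Type*} [LieRing t] [LieAlgebra K t]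
    [IsLieAbelian t] {ι : Type*} [Fintype ι] (e : Module.Basis ι K t)
    {A : Type*} [AddCommGroup A] [Module K A] (M : ChiralWeil.ChiralWStarModule e A) :
    M.basicComplex.IsComplex ∧
    M.smallCartan.IsComplex ∧
    M.smallCartan.carrier =
      Submodule.map₂ (TensorProduct.mk K A (ChiralWeil.Weil K ι)) M.bas
        (ChiralWeil.cGammaStates e) ∧
    ChiralWeil.PreComplex.IsQuasiIso M.basicComplex M.smallCartan
      (ChiralWeil.ChiralWStarModule.tensorVac : A →ₗ[K] A ⊗[K] ChiralWeil.Weil K ι) :=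
  ⟨M.basicComplex_isComplex, M.smallCartan_isComplex, M.smallCartanSpace_eq,
    M.tensorVac_isQuasiIso⟩
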